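/- Let $\mathbb{F}_q$ be a finite field with $q$ elements, $k=\mathbb{F}_q(\theta)$, $k_\infty=\mathbb{F}_q((1/\theta))$, let $\mathbb{C}_\infty$ be the completion of an algebraic closure of $k_\infty$, and let $\mathbb{K}$ be an algebraically closed field with $k\subset\mathbb{K}\subset\mathbb{C}_\infty$. Let $t$ be a variable independent from $\mathbb{C}_\infty$, and let $\mathbb{K}[t,\sigma]$ be the ring generated over $\mathbb{K}$ by $t$ and $\sigma$ subject to $tc=ct$, $t\sigma=\sigma t$, $\sigma c=c^{1/q}\sigma$ for $c\in\mathbb{K}$. A *dual $t$-motive* over $\mathbb{K}$ is a left $\mathbb{K}[t,\sigma]$-module $M$ that is free of finite rank over $\mathbb{K}[t]$, free of finite rank over $\mathbb{K}[\sigma]$, and satisfies $(t-\theta)^N(M/\sigma M)=0$ for some integer $N\ge 0$. A finite extension of $\mathbb{F}_q(t)$ is *totally real* if the infinite place $\infty$ of $\mathbb{F}_q(t)$ splits completely in it. Let $K$ be a *CM field*, that is, a finite separable extension of $\mathbb{F}_q(t)$ such that every place above $\infty$ of its maximal totally real subfield $K^+$ has a unique extension to $K$. Assume that $K$ is *geometric*,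 i.e. that $\mathbb{F}_q$ is algebraically closed in $K$. Let $X\to X^+\to\mathbb{P}^1$ be the smooth projective curves over $\mathbb{F}_q$ and the morphisms corresponding to $\mathbb{F}_q(t)\subset K^+\subset K$, let $\mathbf{X}\to\mathbf{X}^+\to\mathbb{P}^1$ be their base changes to $\mathbb{K}$, and let $\mathbf{U}\subset\mathbf{X}$ be the complement of the points above $\infty$. For $f\in\mathbb{K}(\mathbf{X})$ and $i\in\mathbb{Z}$ let $f^{(i)}$ be obtained by raising the coefficients in $\mathbb{K}$ to the power $q^i$, and for a divisor $D$ of $\mathbf{X}$ let $D^{(i)}$ be obtained by raising the coordinates of its points to the power $q^i$. Let $J_K$ (resp. $J_{K^+}$) be the set of points of $\mathbf{X}$ (resp. $\mathbf{X}^+$) with $t=\theta$. Let $\Xi=\sum_{\xi\in J_K}m_\xi\,\xi$ be a *generalized CM type* of $K$, i.e. a nonzero effective divisor supported on $J_K$ such that the sum of the $m_\xi$ over the points $\xi$ above $\xi^+$ is the same for all $\xi^+\in J_{K^+}$. Evaluation at $\xi\in J_K$ is an embedding $\nu_\xi:K\to\mathbb{K}\subset\mathbb{C}_\infty$ with $\nu_\xi(t)=\theta$;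 composing its restriction to $\{f\in K : |\nu_\xi(f)|\le 1\}$ with the reduction map from the valuation ring of $\mathbb{C}_\infty$ to its residue field $\overline{\mathbb{F}}_q\subset\mathbb{K}$ defines a point $\overline{\infty}_\xi$ of $\mathbf{X}$ above $\infty$. Put $I_\Xi=\sum_\xi m_\xi\,\overline{\infty}_\xi$. Let $W$ be a divisor of $\mathbf{X}$ and let $h\in\mathbb{K}(\mathbf{X})^\times$ satisfy $\operatorname{div}(h)=W^{(1)}-W+\Xi-I_\Xi$. Then $$M=\Gamma\bigl(\mathbf{U},\mathcal{O}_{\mathbf{X}}(-W^{(1)})\bigr)=\bigl\{f\in\mathbb{K}(\mathbf{X}) : f=0\ \text{or}\ (\operatorname{div}(f)-W^{(1)})|_{\mathbf{U}}\ge 0\bigr\},$$ with the natural action of $\mathbb{K}[t]$ and with $\sigma m=h\cdot m^{(-1)}$, is a left $\mathbb{K}[t,\sigma]$-module and a dual $t$-motive over $\mathbb{K}$. Its rank over $\mathbb{K}[t]$ is $[K:\mathbb{F}_q(t)]$ and its rank over $\mathbb{K}[\sigma]$ is $\deg\Xi$. -/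

import Mathlib

noncomputable section

namespace CMMotive

open scoped NNReal WithZero TensorProduct Polynomial

section Base

variable (Fq : Type*) [Field Fq]

/-- `k_∞ = 𝔽_q((1/θ))`, the completion of `k = 𝔽_q(θ)` at its infinite place. -/
abbrev KInfty : Type _ := @RatFunc.CompletionAtInfty Fq _ (Classical.decEq _)

theorem kInfty_valuation_coe (x : RatFunc Fq) :
    Valued.v (algebraMap (RatFunc Fq) (KInfty Fq) x) =
      @RatFunc.inftyValuation Fq _ (Classical.decEq _) x := by
  let _ := Classical.decEq (RatFunc Fq)
  exact Valued.extensionValuation_apply_coe (hv := RatFunc.inftyValued Fq) x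

instance : CompleteSpace (KInfty Fq) := by
  let _ := Classical.decEq (RatFunc Fq)
  let _ := RatFunc.inftyValued Fq
  exact inferInstanceAs (CompleteSpace (UniformSpace.Completion (RatFunc Fq)))

variable [Fintype Fq]

theorem one_lt_card_nnreal : (1 : ℝ≥0) < (Fintype.card Fq : ℝ≥0) := by
  exact_mod_cast Fintype.one_lt_card

/-- The absolute value on `k_∞` is normalized by `|θ| = q`. -/
instance kInftyRankOne : Valuation.RankOne (Valued.v : Valuation (KInfty Fq) ℤᵐ⁰) where
  hom' := (WithZeroMulInt.toNNReal (ne_of_gt (lt_trans zero_lt_one (one_lt_card_nnreal Fq)))).comp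
    MonoidWithZeroHom.ValueGroup₀.embedding
  strictMono' := (WithZeroMulInt.toNNReal_strictMono (one_lt_card_nnreal Fq)).comp
    MonoidWithZeroHom.ValueGroup₀.embedding_strictMono
  exists_val_nontrivial := by
    refine ⟨algebraMap (RatFunc Fq) (KInfty Fq) RatFunc.X, ?_⟩
    rw [kInfty_valuation_coe]
    simp

instance kInftyNormed : NontriviallyNormedField (KInfty Fq) :=
  Valued.toNontriviallyNormedField (KInfty Fq) ℤᵐ⁰

instance kInftyUltrametric : IsUltrametricDist (KInfty Fq) :=
  Valued.instIsUltrametricDist (KInfty Fq) ℤᵐ⁰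

/-- A fixed algebraic closure of `k_∞`, with the unique extension of the absolute value. -/
abbrev KInftyAlg : Type _ := AlgebraicClosure (KInfty Fq)

instance kInftyAlgNormed : NormedField (KInftyAlg Fq) :=
  spectralNorm.normedField (KInfty Fq) (KInftyAlg Fq)

/-- `ℂ_∞`, the completion of the algebraic closure of `k_∞`. -/
def CInfty : Type _ := UniformSpace.Completion (KInftyAlg Fq)

instance cInftyNormed : NormedField (CInfty Fq) :=
  inferInstanceAs (NormedField (UniformSpace.Completion (KInftyAlg Fq)))

/-- The inclusion of `k = 𝔽_q(θ)` in `ℂ_∞`; the variable of `RatFunc Fq` is `θ` here. -/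
def kToCInfty : RatFunc Fq →+* CInfty Fq :=
  (UniformSpace.Completion.coeRingHom (α := KInftyAlg Fq)).comp
    ((algebraMap (KInfty Fq) (KInftyAlg Fq)).comp (algebraMap (RatFunc Fq) (KInfty Fq)))

instance cInftyAlgebra : Algebra (RatFunc Fq) (CInfty Fq) := (kToCInfty Fq).toAlgebra

instance cInftyAlgebraFq : Algebra Fq (CInfty Fq) :=
  ((kToCInfty Fq).comp (algebraMap Fq (RatFunc Fq))).toAlgebra

instance cInftyTower : IsScalarTower Fq (RatFunc Fq) (CInfty Fq) :=
  IsScalarTower.of_algebraMap_eq fun _ => rfl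

end Base

section Places

variable (Fq : Type*) [Field Fq]

/-- The place `∞` of `𝔽_q(t)`, as a valuation ring. -/
def inftyPlace : ValuationSubring (RatFunc Fq) :=
  (@RatFunc.inftyValuation Fq _ (Classical.decEq _)).valuationSubring

/-- `F / 𝔽_q(t)` is totally real: the place `∞` splits completely in `F`, that is, it has
`[F : 𝔽_q(t)]` extensions to `F`. -/
def IsTotallyReal (F : Type*) [Field F] [Algebra (RatFunc Fq) F] : Prop :=
  FiniteDimensional (RatFunc Fq) F ∧
    {A : ValuationSubring F | A.comap (algebraMap (RatFunc Fq) F) = inftyPlace Fq}.ncard =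
      Module.finrank (RatFunc Fq) F

/-- The maximal totally real subfield: the compositum of all totally real subfields
(which is totally real when `K / 𝔽_q(t)` is finite separable). -/
def maxTotallyReal (K : Type*) [Field K] [Algebra (RatFunc Fq) K] :
    IntermediateField (RatFunc Fq) K :=
  sSup {F | IsTotallyReal Fq F}

/-- CM fields over `𝔽_q(t)`: finite separable, and every place above `∞` of the maximal totally
real subfield has a unique extension to `K`. -/
structure IsCMField (K : Type*) [Field K] [Algebra (RatFunc Fq) K] : Prop where
  finite : FiniteDimensional (RatFunc Fq) K
  separable : Algebra.IsSeparable (RatFunc Fq) K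
  nonsplit : ∀ A : ValuationSubring (maxTotallyReal Fq K),
    A.comap (algebraMap (RatFunc Fq) (maxTotallyReal Fq K)) = inftyPlace Fq →
      ∃! B : ValuationSubring K, B.comap (algebraMap (maxTotallyReal Fq K) K) = A

/-- `K / 𝔽_q(t)` is geometric: the field of constants of `K` is `𝔽_q`. -/
def IsGeometric (K : Type*) [Field K] [Algebra Fq K] : Prop :=
  ∀ x : K, IsAlgebraic Fq x → x ∈ Set.range (algebraMap Fq K)

end Places

section Curve

variable (Fq L K : Type*) [Field Fq] [Field L] [Field K] [Algebra Fq L] [Algebra Fq K]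

/-- The function field `𝐊 = L(𝐗)` of the base change `𝐗` to `L` of the curve `X / 𝔽_q` with
function field `K`: the fraction field of `L ⊗ K` (a domain when `K` is geometric). -/
abbrev FunField : Type _ := FractionRing (L ⊗[Fq] K)

variable {L} in
/-- Constant functions. -/
def FunField.const : L →+* FunField Fq L K :=
  (algebraMap (L ⊗[Fq] K) (FunField Fq L K)).comp
    (Algebra.TensorProduct.includeLeftRingHom : L →+* L ⊗[Fq] K)

variable {K} in
/-- Functions defined over `𝔽_q`. -/
def FunField.ofBase : K →+* FunField Fq L K :=
  (algebraMap (L ⊗[Fq] K) (FunField Fq L K)).comp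
    (Algebra.TensorProduct.includeRight : K →ₐ[Fq] L ⊗[Fq] K).toRingHom

/-- The function `t` on `𝐗`. -/
def FunField.t [Algebra (RatFunc Fq) K] : FunField Fq L K :=
  FunField.ofBase Fq L (algebraMap (RatFunc Fq) K RatFunc.X)

/-- Closed points of the smooth projective curve `𝐗 / L` (`L` algebraically closed), given by
their normalized discrete valuations on the function field, trivial on the constants.
`val f = exp (-ord_P f)`. -/
@[ext]
structure ClosedPoint where
  val : Valuation (FunField Fq L K) ℤᵐ⁰
  val_const : ∀ c : L, c ≠ 0 → val (FunField.const Fq K c) = 1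
  surjective : Function.Surjective val

/-- The divisor group of `𝐗`. -/
abbrev Divisor : Type _ := ClosedPoint Fq L K →₀ ℤ

variable {Fq L K}

/-- The degree of a divisor (all residue fields are `L`). -/
def Divisor.deg (D : Divisor Fq L K) : ℤ := D.sum fun _ n => n

/-- `div(f) = D`, with `D` given by its multiplicities. -/
def HasDivisor (f : FunField Fq L K) (D : ClosedPoint Fq L K → ℤ) : Prop :=
  f ≠ 0 ∧ ∀ P, P.val f = WithZero.exp (-(D P))

/-- The open set `𝐔 = 𝐗 \ π⁻¹(∞)`, where `t` is regular. -/
def affinePart [Algebra (RatFunc Fq) K] : Set (ClosedPoint Fq L K) :=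
  {P | P.val (FunField.t Fq L K) ≤ 1}

/-- `Γ(𝐔, 𝒪(-D)) = {f | (div f - D)|_𝐔 ≥ 0}` (together with `0`). -/
def sections [Algebra (RatFunc Fq) K] (D : Divisor Fq L K) : Set (FunField Fq L K) :=
  {f | ∀ P ∈ affinePart, P.val f ≤ WithZero.exp (-(D P))}

variable (Fq L K) in
/-- `J_K = π⁻¹(θ)`, the points of `𝐗` with `t = θ`. -/
def pointsAboveTheta [Algebra (RatFunc Fq) K] [Algebra (RatFunc Fq) L] :
    Set (ClosedPoint Fq L K) :=
  {P | P.val (FunField.t Fq L K - FunField.const Fq K (algebraMap (RatFunc Fq) L RatFunc.X)) < 1}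

/-- For `i : K' → K`, the point `P` of `𝐗` maps to the point `P'` of `𝐗'`: the valuation of `P`
restricts to one equivalent to that of `P'`. It suffices to compare them on `L ⊗ K'`, whose
fraction field is the function field of `𝐗'`. -/
def ClosedPoint.LiesAbove {K' : Type*} [Field K'] [Algebra Fq K'] (i : K' →ₐ[Fq] K)
    (P : ClosedPoint Fq L K) (P' : ClosedPoint Fq L K') : Prop :=
  (P.val.comap ((algebraMap (L ⊗[Fq] K) (FunField Fq L K)).comp
      (Algebra.TensorProduct.map (AlgHom.id Fq L) i).toRingHom)).IsEquiv
    (P'.val.comap (algebraMap (L ⊗[Fq] K') (FunField Fq L K')))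

end Curve

section Twist

variable (Fq L K : Type*) [Field Fq] [Fintype Fq] [Field L] [IsAlgClosed L] [Field K]
  [Algebra Fq L] [Algebra Fq K]

/-- The automorphism `c ↦ c ^ q` of `L`. -/
def frob : L ≃ₐ[Fq] L :=
  AlgEquiv.ofBijective (FiniteField.frobeniusAlgHom Fq L)
    ⟨(FiniteField.frobeniusAlgHom Fq L).toRingHom.injective, fun c => by
      obtain ⟨d, hd⟩ := IsAlgClosed.exists_pow_nat_eq c (n := Fintype.card Fq) Fintype.card_pos
      exact ⟨d, hd⟩⟩

/-- The Frobenius twist `f ↦ f^{(1)}` on functions: it raises the coefficients in `L` to the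
power `q` and fixes `K`. -/
def twist : FunField Fq L K ≃+* FunField Fq L K :=
  IsFractionRing.ringEquivOfRingEquiv
    (Algebra.TensorProduct.congr (frob Fq L) (AlgEquiv.refl : K ≃ₐ[Fq] K)).toRingEquiv

variable {L K} in
theorem twist_const (c : L) :
    twist Fq L K (FunField.const Fq K c) = FunField.const Fq K (frob Fq L c) := by
  simp [twist, FunField.const]

variable {L K} in
theorem twist_ofBase (x : K) :
    twist Fq L K (FunField.ofBase Fq L x) = FunField.ofBase Fq L x := by
  simp [twist, FunField.ofBase]

variable {L K} in
theorem twist_symm_const (c : L) :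
    (twist Fq L K).symm (FunField.const Fq K c) = FunField.const Fq K ((frob Fq L).symm c) := by
  rw [RingEquiv.symm_apply_eq, twist_const, AlgEquiv.apply_symm_apply]

variable {L K} in
theorem twist_symm_ofBase (x : K) :
    (twist Fq L K).symm (FunField.ofBase Fq L x) = FunField.ofBase Fq L x := by
  rw [RingEquiv.symm_apply_eq, twist_ofBase]

variable {Fq L K}

/-- The Frobenius twist `P ↦ P^{(1)}` on closed points: `ord_{P^{(1)}} (f^{(1)}) = ord_P f`. -/
def ClosedPoint.twist : ClosedPoint Fq L K ≃ ClosedPoint Fq L K where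
  toFun P :=
    { val := P.val.comap (CMMotive.twist Fq L K).symm.toRingHom
      val_const := fun c hc => by
        simpa [twist_symm_const] using P.val_const ((frob Fq L).symm c) (by simpa using hc)
      surjective := P.surjective.comp (CMMotive.twist Fq L K).symm.surjective }
  invFun P :=
    { val := P.val.comap (CMMotive.twist Fq L K).toRingHom
      val_const := fun c hc => by
        simpa [twist_const] using P.val_const (frob Fq L c) (by simpa using hc)
      surjective := P.surjective.comp (CMMotive.twist Fq L K).surjective }
  left_inv P := by
    ext x
    simp
  right_inv P := by
    ext x
    simp

/-- The Frobenius twist `D ↦ D^{(1)}` on divisors. -/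
def Divisor.twist (D : Divisor Fq L K) : Divisor Fq L K :=
  Finsupp.equivMapDomain ClosedPoint.twist D

end Twist

section SkewRing

variable (Fq L : Type*) [Field Fq] [Fintype Fq] [Field L] [IsAlgClosed L] [Algebra Fq L]

/-- `n` acts on `L` by `c ↦ c ^ (q ^ (-n))`. -/
@[reducible]
def invFrobAction : MulSemiringAction (Multiplicative ℕ) L :=
  MulSemiringAction.compHom L (powersHom (L ≃ₐ[Fq] L) (frob Fq L).symm)

/-- The skew polynomial ring `L[σ]`, with `σ c = c^{1/q} σ` for `c ∈ L`. -/
def SigmaRing (_Fq L : Type*) [Field L] : Type _ := SkewPolynomial L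

instance : Ring (SigmaRing Fq L) :=
  letI := invFrobAction Fq L
  inferInstanceAs (Ring (SkewPolynomial L))

variable {L} in
/-- The inclusion `L → L[σ]`. -/
def SigmaRing.const : L →+* SigmaRing Fq L :=
  letI := invFrobAction Fq L
  SkewPolynomial.CRingHom

/-- The variable `σ` of `L[σ]`. -/
def SigmaRing.σ : SigmaRing Fq L := (SkewPolynomial.X : SkewPolynomial L)

variable {L} in
theorem SigmaRing.σ_mul_const (c : L) :
    SigmaRing.σ Fq L * SigmaRing.const Fq c =
      SigmaRing.const Fq ((frob Fq L).symm c) * SigmaRing.σ Fq L := by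
  let _ := invFrobAction Fq L
  refine (SkewPolynomial.monomial_mul_monomial (R := L) 1 0 1 c).trans (Eq.trans ?_
    (SkewPolynomial.monomial_mul_monomial (R := L) 0 1 ((frob Fq L).symm c) 1).symm)
  simp only [add_zero, zero_add, one_mul, Function.iterate_one, Function.iterate_zero, id_eq, mul_one]
  rfl

/-- The ring `L[t, σ]`: polynomials in a central variable `t` over `L[σ]`. -/
abbrev TSigmaRing : Type _ := (SigmaRing Fq L)[X]

/-- The inclusion `L[t] → L[t, σ]`. -/
def polyToTSigma : L[X] →+* TSigmaRing Fq L := Polynomial.mapRingHom (SigmaRing.const Fq)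

/-- The inclusion `L[σ] → L[t, σ]`. -/
def sigmaToTSigma : SigmaRing Fq L →+* TSigmaRing Fq L := Polynomial.C

variable (M : Type*) [AddCommGroup M] [Module (TSigmaRing Fq L) M]

/-- `M` is free of rank `n` over `L[t]`. -/
def IsFreeOfRankOverT (n : ℕ) : Prop :=
  letI : Module L[X] M := Module.compHom M (polyToTSigma Fq L)
  Nonempty (Module.Basis (Fin n) L[X] M)

/-- `M` is free of rank `n` as a left module over `L[σ]`. -/
def IsFreeOfRankOverSigma (n : ℕ) : Prop :=
  letI : Module (SigmaRing Fq L) M := Module.compHom M (sigmaToTSigma Fq L)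
  Nonempty (Module.Basis (Fin n) (SigmaRing Fq L) M)

/-- Anderson dual `t`-motives over `L`: left `L[t, σ]`-modules, free of finite rank over `L[t]` and
over `L[σ]`, with `(t - θ)^N (M / σ M) = 0` for some `N`. -/
structure IsDualTMotive [Algebra (RatFunc Fq) L] : Prop where
  free_t : ∃ r, IsFreeOfRankOverT Fq L M r
  free_sigma : ∃ d, IsFreeOfRankOverSigma Fq L M d
  nilpotent : ∃ N : ℕ, ∀ m : M, ∃ m' : M,
    polyToTSigma Fq L
      ((Polynomial.X - Polynomial.C (algebraMap (RatFunc Fq) L RatFunc.X)) ^ N) • m =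
        sigmaToTSigma Fq L (SigmaRing.σ Fq L) • m'

end SkewRing

section Action

variable {Fq L K : Type*} [Field Fq] [Fintype Fq] [Field L] [IsAlgClosed L] [Field K]
  [Algebra Fq L] [Algebra Fq K]

/-- `f ↦ h f^{(-1)}` on the function field. -/
def sigmaEnd (h : FunField Fq L K) : AddMonoid.End (FunField Fq L K) :=
  (AddMonoidHom.mulLeft h).comp (twist Fq L K).symm.toRingHom.toAddMonoidHom

theorem sigmaEnd_apply (h f : FunField Fq L K) :
    sigmaEnd h f = h * (twist Fq L K).symm f := rfl

variable (Fq L K) in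
/-- Multiplication by constants on the function field. -/
def constEnd : L →+* AddMonoid.End (FunField Fq L K) :=
  (Module.toAddMonoidEnd (FunField Fq L K) (FunField Fq L K)).comp (FunField.const Fq K)

theorem sigmaEnd_mul_constEnd (h : FunField Fq L K) (c : L) :
    sigmaEnd h * constEnd Fq L K c = constEnd Fq L K ((frob Fq L).symm c) * sigmaEnd h := by
  ext f
  change h * (twist Fq L K).symm (FunField.const Fq K c * f) =
    FunField.const Fq K ((frob Fq L).symm c) * (h * (twist Fq L K).symm f)
  rw [map_mul, twist_symm_const]
  ring

/-- The action of `L[σ]` on the function field with `σ f = h f^{(-1)}`. -/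
def sigmaAction (h : FunField Fq L K) :
    SigmaRing Fq L →+* AddMonoid.End (FunField Fq L K) :=
  letI := invFrobAction Fq L
  SkewMonoidAlgebra.liftNCRingHom (k := L) (G := Multiplicative ℕ) (constEnd Fq L K)
    (powersHom _ (sigmaEnd h)) (by
      intro c n
      induction n using Multiplicative.rec with | _ n
      change constEnd Fq L K ((((frob Fq L).symm ^ n : L ≃ₐ[Fq] L)) c) * sigmaEnd h ^ n =
        sigmaEnd h ^ n * constEnd Fq L K c
      induction n generalizing c with
      | zero => simp
      | succ n ih =>
        rw [pow_succ (sigmaEnd h), mul_assoc (sigmaEnd h ^ n), sigmaEnd_mul_constEnd, ← mul_assoc,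
          ← mul_assoc, ← ih, pow_succ]
        rfl)

theorem sigmaAction_const (h : FunField Fq L K) (c : L) :
    sigmaAction h (SigmaRing.const Fq c) = constEnd Fq L K c := by
  let _ := invFrobAction Fq L
  refine (SkewMonoidAlgebra.liftNC_single (k := L) (G := Multiplicative ℕ) _ _ _ _).trans ?_
  simp

theorem sigmaAction_σ (h : FunField Fq L K) :
    sigmaAction h (SigmaRing.σ Fq L) = sigmaEnd h := by
  let _ := invFrobAction Fq L
  refine (SkewMonoidAlgebra.liftNC_single (k := L) (G := Multiplicative ℕ) _ _ _ _).trans ?_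
  simp

variable [Algebra (RatFunc Fq) K]

variable (Fq L K) in
/-- Multiplication by `t` on the function field. -/
def tEnd : AddMonoid.End (FunField Fq L K) :=
  Module.toAddMonoidEnd (FunField Fq L K) (FunField Fq L K) (FunField.t Fq L K)

theorem commute_sigmaAction_tEnd (h : FunField Fq L K) (a : SigmaRing Fq L) :
    Commute (sigmaAction h a) (tEnd Fq L K) := by
  let _ := invFrobAction Fq L
  have hc (c : L) : Commute (constEnd Fq L K c) (tEnd Fq L K) := by
    change _ * _ = _ * _
    rw [constEnd, tEnd, RingHom.comp_apply, ← map_mul, mul_comm, map_mul]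
  have hs : Commute (sigmaEnd h) (tEnd Fq L K) := by
    ext f
    change h * (twist Fq L K).symm (FunField.t Fq L K * f) =
      FunField.t Fq L K * (h * (twist Fq L K).symm f)
    rw [map_mul, FunField.t, twist_symm_ofBase]
    ring
  refine SkewMonoidAlgebra.induction_on' (k := L) (G := Multiplicative ℕ)
    (p := fun a => Commute (sigmaAction h a) (tEnd Fq L K)) a (fun n c => ?_) (fun f g hf hg => ?_)
  · have : sigmaAction h (SkewMonoidAlgebra.single n c : SkewMonoidAlgebra L (Multiplicative ℕ)) =
        constEnd Fq L K c * sigmaEnd h ^ n.toAdd :=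
      SkewMonoidAlgebra.liftNC_single (k := L) (G := Multiplicative ℕ) _ _ _ _
    rw [this]
    exact (hc c).mul_left (hs.pow_left _)
  · have : sigmaAction h (f + g : SkewMonoidAlgebra L (Multiplicative ℕ)) =
        sigmaAction h f + sigmaAction h g := map_add (sigmaAction h) _ _
    rw [this]
    exact hf.add_left hg

/-- The action of `L[t, σ]` on the function field with `σ f = h f^{(-1)}`. -/
def tSigmaAction (h : FunField Fq L K) :
    TSigmaRing Fq L →+* AddMonoid.End (FunField Fq L K) :=
  Polynomial.eval₂RingHom' (sigmaAction h) (tEnd Fq L K) (commute_sigmaAction_tEnd h)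

/-- The function field as a left `L[t, σ]`-module, with `σ f = h f^{(-1)}`. -/
def TwistedFunField (_h : FunField Fq L K) : Type _ := FunField Fq L K

instance (h : FunField Fq L K) : AddCommGroup (TwistedFunField h) :=
  inferInstanceAs (AddCommGroup (FunField Fq L K))

instance (h : FunField Fq L K) : Module (TSigmaRing Fq L) (TwistedFunField h) :=
  Module.compHom (FunField Fq L K) (tSigmaAction h)

/-- The identity map. -/
def TwistedFunField.of (h : FunField Fq L K) : FunField Fq L K ≃+ TwistedFunField h :=
  AddEquiv.refl _

theorem TwistedFunField.σ_smul (h f : FunField Fq L K) :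
    sigmaToTSigma Fq L (SigmaRing.σ Fq L) • of h f = of h (h * (twist Fq L K).symm f) := by
  change (tSigmaAction h (Polynomial.C (SigmaRing.σ Fq L))) f = _
  rw [tSigmaAction]
  simp [Polynomial.eval₂RingHom', sigmaAction_σ]
  rfl

theorem TwistedFunField.const_smul (h f : FunField Fq L K) (c : L) :
    polyToTSigma Fq L (Polynomial.C c) • of h f = of h (FunField.const Fq K c * f) := by
  change (tSigmaAction h (Polynomial.map (SigmaRing.const Fq) (Polynomial.C c))) f = _
  rw [tSigmaAction]
  simp [Polynomial.eval₂RingHom', sigmaAction_const]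
  rfl

theorem TwistedFunField.t_smul (h f : FunField Fq L K) :
    polyToTSigma Fq L Polynomial.X • of h f = of h (FunField.t Fq L K * f) := by
  change (tSigmaAction h (Polynomial.map (SigmaRing.const Fq) Polynomial.X)) f = _
  rw [tSigmaAction]
  simp [Polynomial.eval₂RingHom']
  rfl

end Action

section CMType

variable {Fq : Type*} [Field Fq] {L K : Type*} [Field L] [Field K] [Algebra Fq L]
  [Algebra (RatFunc Fq) L] [Algebra Fq K] [Algebra (RatFunc Fq) K] [IsScalarTower Fq (RatFunc Fq) K]

open Classical in
/-- The sum of the multiplicities of `D` over the fibre of `𝐗 → 𝐗⁺` at a point of `𝐗⁺`, where `𝐗⁺`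
is the curve of the maximal totally real subfield. -/
def fibreSum (D : Divisor Fq L K) (P : ClosedPoint Fq L (maxTotallyReal Fq K)) : ℤ :=
  ∑ ξ ∈ D.support with ξ.LiesAbove ((maxTotallyReal Fq K).val.restrictScalars Fq) P, D ξ

/-- Generalized CM types of `K`: nonzero effective divisors supported on `J_K` whose sums over the
fibres at the points of `J_{K⁺}` all agree. -/
structure IsGeneralizedCMType (Ξ : Divisor Fq L K) : Prop where
  ne_zero : Ξ ≠ 0
  effective : 0 ≤ Ξ
  support_subset : ↑Ξ.support ⊆ pointsAboveTheta Fq L K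
  weight : ∀ P₁ ∈ pointsAboveTheta Fq L (maxTotallyReal Fq K),
    ∀ P₂ ∈ pointsAboveTheta Fq L (maxTotallyReal Fq K), fibreSum Ξ P₁ = fibreSum Ξ P₂

/-- `ν = ν_ξ` is the evaluation at `ξ` of the functions in `K`. -/
def IsEvaluation (ξ : ClosedPoint Fq L K) (ν : K →ₐ[Fq] L) : Prop :=
  ∀ f : K, ξ.val (FunField.ofBase Fq L f - FunField.const Fq K (ν f)) < 1

end CMType

section Reduction

variable {Fq : Type*} [Field Fq] [Fintype Fq] {L : IntermediateField (RatFunc Fq) (CInfty Fq)}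
  {K : Type*} [Field K] [Algebra Fq K]

/-- `P = ∞̄_ξ`, the reduction of `ξ`: the value at `P` of each `f ∈ K` with `|ν_ξ(f)| ≤ 1` is the
image of `ν_ξ(f)` in the residue field of `ℂ_∞`, which is identified with the algebraic closure of
`𝔽_q` in `ℂ_∞`. -/
def ReducesTo (ξ P : ClosedPoint Fq L K) : Prop :=
  ∃ ν : K →ₐ[Fq] L, IsEvaluation ξ ν ∧
    ∀ f : K, ‖(ν f : CInfty Fq)‖ ≤ 1 → ∀ c : L, IsAlgebraic Fq c →
      ‖(ν f : CInfty Fq) - (c : CInfty Fq)‖ < 1 →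
        P.val (FunField.ofBase Fq L f - FunField.const Fq K c) < 1

open Classical in
/-- The divisor `I_Ξ = ∑ m_ξ ∞̄_ξ` for `Ξ = ∑ m_ξ ξ`, by its multiplicities. -/
def inftyDivisor (Ξ : Divisor Fq L K) (P : ClosedPoint Fq L K) : ℤ :=
  ∑ ξ ∈ Ξ.support with ReducesTo ξ P, Ξ ξ

/-- `h` is a shtuka function associated to `W` for `Ξ`: `div(h) = W^{(1)} - W + Ξ - I_Ξ`. -/
def IsShtukaFunction [IsAlgClosed L] (Ξ W : Divisor Fq L K) (h : FunField Fq L K) : Prop :=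
  HasDivisor h fun P => W.twist P - W P + Ξ P - inftyDivisor Ξ P

end Reduction

end CMMotive

end

/-! Let T be the Frobenius twist P ↦ P^{(1)} on closed points. As div(h) = W^{(1)} − W + Ξ − I_Ξ,
the map σf = h f^{(-1)} satisfies ord_P(σf) = ord_{TP}(f) + W^{(1)}(P) − W(P) + Ξ(P) − I_Ξ(P)
(`val_sigma`). Since I_Ξ lies at infinity, on U this says that σ maps M = Γ(U, O(−W^{(1)}))
bijectively onto Γ(U, O(−W^{(1)} − Ξ)) (`sigma_mem_sections_iff`, `exists_eq_sigma`). Hence M is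
σ-stable, M/σM has dimension deg Ξ over L (`exists_linearMap_ker`), and a power of t − θ kills it
because Ξ is supported on t = θ (`exists_pow_mul_mem_sections`).

Over L[t], M is commensurable with the integral closure of L[t] in the function field, which is free
of rank [K : 𝔽_q(t)] (`exists_poly_basis`).

Over L[σ], the points at infinity matter. Filter M by V_n = {f : ord_P f ≥ W^{(1)}(P) − E_n(P) for
all P at infinity}, where E_{n+1}(P) = E_n(TP) + I_Ξ(P). Then σf ∈ V_{n+1} forces f ∈ V_n. If every
T-orbit at infinity meets I_Ξ, then E_n grows without bound, so the V_n exhaust M, and a suitable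
starting point makes V_0 = 0. Lifting a basis of M/σM compatibly with the filtration then gives a
basis of M (`exists_filtered_section`, `exists_sigma_basis`, assembled in `exists_motive`).

The CM hypothesis shows that the orbits do meet I_Ξ (`exists_mem_support_reducesTo`). A point P at
infinity induces a place of K, and below it a place of K⁺ over ∞, which comes from an embedding of
K⁺ in L (`exists_embeddingRing_eq`), hence from a point of J_{K⁺}. The weight condition puts some ξ
in the support of Ξ above that point. Since the place of K⁺ has only one extension to K, P and ν_ξ
induce the same place of K. Their residue maps therefore differ by a power of Frobenius
(`exists_norm_sub_pow_lt_one`), so ξ reduces to a twist of P. -/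

noncomputable section

namespace CMMotive

open scoped WithZero Polynomial IntermediateField
open IntermediateField.algebraAdjoinAdjoin IsDedekindDomain

/-! ### Places of a function field and integral closures of k[s] -/

section Places

variable {F : Type*} [Field F]

/-- Normalized discrete valuations are determined by their valuation rings. -/
theorem eq_of_le_one_iff {v w : Valuation F ℤᵐ⁰} (hv : Function.Surjective v)
    (hw : Function.Surjective w) (h : ∀ x, v x ≤ 1 ↔ w x ≤ 1) : v = w := by
  have hequiv : v.IsEquiv w := Valuation.isEquiv_iff_val_le_one.2 (fun {x} => h x)
  have h1 : ∀ x, v x = 1 ↔ w x = 1 := fun x => hequiv.eq_one_iff_eq_one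
  have hlt : ∀ x, v x < 1 ↔ w x < 1 := fun x => hequiv.lt_one_iff_lt_one
  obtain ⟨p, hp⟩ := hv (WithZero.exp (-1))
  obtain ⟨r, hr⟩ := hw (WithZero.exp (-1))
  have hp0 : p ≠ 0 := by rintro rfl; exact WithZero.exp_ne_zero (hp.symm.trans (map_zero v))
  have hr0 : r ≠ 0 := by rintro rfl; exact WithZero.exp_ne_zero (hr.symm.trans (map_zero w))
  obtain ⟨a, ha⟩ : ∃ a : ℤ, w p = WithZero.exp a :=
    ⟨_, (WithZero.exp_log ((Valuation.ne_zero_iff w).2 hp0)).symm⟩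
  obtain ⟨b, hb⟩ : ∃ b : ℤ, v r = WithZero.exp b :=
    ⟨_, (WithZero.exp_log ((Valuation.ne_zero_iff v).2 hr0)).symm⟩
  have ha1 : a < 0 := by
    have := (hlt p).1 (by rw [hp, ← WithZero.exp_zero, WithZero.exp_lt_exp]; lia)
    rwa [ha, ← WithZero.exp_zero, WithZero.exp_lt_exp] at this
  have hb1 : b < 0 := by
    have := (hlt r).2 (by rw [hr, ← WithZero.exp_zero, WithZero.exp_lt_exp]; lia)
    rwa [hb, ← WithZero.exp_zero, WithZero.exp_lt_exp] at this
  -- The exponent b makes r p^b a unit for v, hence for w, which reads ab = 1. As a and b are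
  -- negative, both are −1, so p is a uniformizer for w as well.
  have hab : w (r * p ^ b) = 1 := by
    rw [← h1, map_mul, map_zpow₀, hb, hp, ← WithZero.exp_zsmul, ← WithZero.exp_add]
    simp
  have hab' : a * b = 1 := by
    rw [map_mul, map_zpow₀, hr, ha, ← WithZero.exp_zsmul, ← WithZero.exp_add, ← WithZero.exp_zero,
      WithZero.exp_inj, smul_eq_mul] at hab
    linarith [mul_comm a b]
  have ha2 : a = -1 := by
    rcases Int.eq_one_or_neg_one_of_mul_eq_one hab' with h | h <;> lia
  ext x
  rcases eq_or_ne x 0 with rfl | hx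
  · simp
  obtain ⟨n, hn⟩ : ∃ n : ℤ, v x = WithZero.exp n :=
    ⟨_, (WithZero.exp_log ((Valuation.ne_zero_iff v).2 hx)).symm⟩
  have : w (x * p ^ n) = 1 := by
    rw [← h1, map_mul, map_zpow₀, hn, hp, ← WithZero.exp_zsmul, ← WithZero.exp_add]
    simp
  rw [map_mul, map_zpow₀, ha, ha2, ← WithZero.exp_zsmul] at this
  rw [hn, eq_comm, ← mul_right_inj' (WithZero.exp_ne_zero (a := n • (-1 : ℤ))), mul_comm, this,
    ← WithZero.exp_add]
  simp

/-- A proper valuation ring of the fraction field of a Dedekind domain `A` that contains `A` is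
the valuation ring of a maximal ideal of `A`. -/
theorem exists_heightOneSpectrum_of_le {A : Type*} [CommRing A] [IsDedekindDomain A] [Algebra A F]
    [IsFractionRing A F] (V : ValuationSubring F) (hA : ∀ a : A, algebraMap A F a ∈ V)
    (hV : V ≠ ⊤) :
    ∃ p : HeightOneSpectrum A, (∀ x, p.valuation F x ≤ 1 ↔ x ∈ V) ∧
      ∀ a, a ∈ p.asIdeal ↔ V.valuation (algebraMap A F a) < 1 := by
  let f : A →+* V := (algebraMap A F).codRestrict V hA
  let P : Ideal A := (IsLocalRing.maximalIdeal V).comap f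
  have hmem : ∀ a, a ∈ P ↔ V.valuation (algebraMap A F a) < 1 := fun a =>
    (V.valuation_lt_one_iff (f a))
  have hP : P ≠ ⊥ := by
    intro hP
    apply hV
    rw [eq_top_iff]
    intro x _
    obtain ⟨a, b, hb, rfl⟩ := IsFractionRing.div_surjective (A := A) x
    have hb0 : b ≠ 0 := nonZeroDivisors.ne_zero hb
    have : b ∉ P := by rw [hP]; simpa using hb0
    rw [hmem, not_lt] at this
    rw [← V.valuation_le_one_iff, map_div₀]
    have h1 := (V.valuation_le_one_iff _).2 (hA a)
    have h2 : V.valuation (algebraMap A F b) = 1 :=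
      le_antisymm ((V.valuation_le_one_iff _).2 (hA b)) this
    simpa [h2] using h1
  let p : HeightOneSpectrum A := ⟨P, inferInstance, hP⟩
  have hle : ∀ x, p.valuation F x ≤ 1 → x ∈ V := by
    intro x hx
    obtain ⟨n, d, hnd⟩ := p.exists_primeCompl_mul_eq_of_integer x hx
    have hd : (d : A) ∉ P := d.2
    rw [hmem, not_lt] at hd
    have h2 : V.valuation (algebraMap A F d) = 1 :=
      le_antisymm ((V.valuation_le_one_iff _).2 (hA d)) hd
    rw [← V.valuation_le_one_iff]
    have h3 := (V.valuation_le_one_iff _).2 (hA n)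
    rw [← hnd, map_mul, h2] at h3
    simpa using h3
  refine ⟨p, fun x => ⟨hle x, fun hx => ?_⟩, hmem⟩
  -- A discrete valuation ring is maximal among proper subrings: an x in V outside it would have
  -- powers that absorb the pole of any y, making V everything.
  by_contra hlt
  rw [not_le] at hlt
  apply hV
  rw [eq_top_iff]
  intro y _
  have hx0 : x ≠ 0 := by rintro rfl; simp at hlt
  rcases eq_or_ne y 0 with rfl | hy
  · exact V.zero_mem
  obtain ⟨a, ha⟩ : ∃ n : ℤ, p.valuation F x = WithZero.exp n :=
    ⟨_, (WithZero.exp_log ((Valuation.ne_zero_iff _).2 hx0)).symm⟩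
  obtain ⟨b, hb⟩ : ∃ n : ℤ, p.valuation F y = WithZero.exp n :=
    ⟨_, (WithZero.exp_log ((Valuation.ne_zero_iff _).2 hy)).symm⟩
  have ha0 : 0 < a := by
    rwa [ha, ← WithZero.exp_zero, WithZero.exp_lt_exp] at hlt
  have : y / x ^ b.toNat ∈ V := by
    apply hle
    rw [map_div₀, map_pow, ha, hb, ← WithZero.exp_nsmul, ← WithZero.exp_sub, ← WithZero.exp_zero,
      WithZero.exp_le_exp, nsmul_eq_mul]
    nlinarith [Int.self_le_toNat b]
  have h := V.mul_mem _ _ this (pow_mem hx b.toNat)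
  rwa [div_mul_cancel₀ _ (pow_ne_zero _ hx0)] at h

variable (k : Type*) [Field k] [Algebra k F]

/-- Normalized discrete valuations of `F` that are trivial on `k`. -/
structure IsPlace (v : Valuation F ℤᵐ⁰) : Prop where
  map_const : ∀ c : k, c ≠ 0 → v (algebraMap k F c) = 1
  surjective : Function.Surjective v

/-- `s` is a separating element of the function field `F / k`. -/
structure IsSeparatingElement (s : F) : Prop where
  transcendental : Transcendental k s
  finite : FiniteDimensional k⟮s⟯ F
  separable : Algebra.IsSeparable k⟮s⟯ F

/-- The integral closure of `k[s]` in `F`. -/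
abbrev affineRing (s : F) : Type _ := integralClosure (Algebra.adjoin k {s}) F

variable {k}

theorem IsPlace.map_const_le {v : Valuation F ℤᵐ⁰} (hv : IsPlace k v) (c : k) :
    v (algebraMap k F c) ≤ 1 := by
  rcases eq_or_ne c 0 with rfl | hc
  · simp
  · exact (hv.map_const c hc).le

theorem IsSeparatingElement.ne_zero {s : F} (hs : IsSeparatingElement k s) : s ≠ 0 := by
  rintro rfl
  exact hs.transcendental isAlgebraic_zero

theorem IsSeparatingElement.inv {s : F} (hs : IsSeparatingElement k s) :
    IsSeparatingElement k s⁻¹ := by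
  have h : k⟮s⁻¹⟯ = k⟮s⟯ := by
    apply le_antisymm
    · rw [IntermediateField.adjoin_simple_le_iff]
      exact inv_mem (IntermediateField.mem_adjoin_simple_self k s)
    · rw [IntermediateField.adjoin_simple_le_iff]
      simpa using inv_mem (IntermediateField.mem_adjoin_simple_self k s⁻¹)
  refine ⟨fun h => hs.transcendental (by simpa using h.inv), ?_, ?_⟩
  · rw [h]; exact hs.finite
  · rw [h]; exact hs.separable

theorem IsSeparatingElement.isPrincipalIdealRing {s : F} (_hs : IsSeparatingElement k s) :
    IsPrincipalIdealRing (Algebra.adjoin k {s}) := by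
  refine IsPrincipalIdealRing.of_surjective
    ((Polynomial.aeval s).codRestrict (Algebra.adjoin k {s})
      (fun p => Polynomial.aeval_mem_adjoin_singleton k s)).toRingHom ?_
  rintro ⟨x, hx⟩
  rw [Algebra.adjoin_singleton_eq_range_aeval] at hx
  obtain ⟨p, rfl⟩ := hx
  exact ⟨p, rfl⟩

theorem IsSeparatingElement.isDedekindDomain {s : F} (hs : IsSeparatingElement k s) :
    IsDedekindDomain (affineRing k s) := by
  have := hs.isPrincipalIdealRing
  have := hs.finite
  have := hs.separable
  exact integralClosure.isDedekindDomain (Algebra.adjoin k {s}) k⟮s⟯ F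

theorem IsSeparatingElement.isFractionRing {s : F} (hs : IsSeparatingElement k s) :
    IsFractionRing (affineRing k s) F := by
  have := hs.finite
  exact integralClosure.isFractionRing_of_finite_extension k⟮s⟯ F

/-- Valuation rings are integrally closed, and V contains k[s]. -/
theorem mem_of_integral {s : F} (V : ValuationSubring F) (hk : ∀ c : k, algebraMap k F c ∈ V)
    (hs : s ∈ V) (x : affineRing k s) : (x : F) ∈ V := by
  have hle : ∀ r : Algebra.adjoin k {s}, (r : F) ∈ V := by
    rintro ⟨r, hr⟩
    rw [Algebra.adjoin_singleton_eq_range_aeval] at hr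
    obtain ⟨p, rfl⟩ := hr
    change Polynomial.aeval s p ∈ V
    rw [Polynomial.aeval_eq_sum_range]
    refine sum_mem fun i _ => ?_
    rw [Algebra.smul_def]
    exact mul_mem (hk _) (pow_mem hs i)
  obtain ⟨p, hp, hx⟩ := x.2
  let f : Algebra.adjoin k {s} →+* V :=
    (algebraMap (Algebra.adjoin k {s}) F).codRestrict V hle
  have : IsIntegral V (x : F) := ⟨p.map f, hp.map f, by
    rw [Polynomial.eval₂_map]; exact hx⟩
  obtain ⟨y, hy⟩ := IsIntegrallyClosed.isIntegral_iff.1 this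
  rw [← hy]
  exact y.2

/-- One of s, s⁻¹ lies in V and both are separating, so V is centred on a maximal ideal of one of
the two affine charts. -/
theorem IsSeparatingElement.exists_isPlace {s : F} (hs : IsSeparatingElement k s)
    (V : ValuationSubring F) (hk : ∀ c : k, algebraMap k F c ∈ V) (hV : V ≠ ⊤) :
    ∃ v : Valuation F ℤᵐ⁰, IsPlace k v ∧ ∀ x, v x ≤ 1 ↔ x ∈ V := by
  wlog hsV : s ∈ V generalizing s
  · exact this hs.inv ((V.mem_or_inv_mem s).resolve_left hsV)
  have := hs.isDedekindDomain
  have := hs.isFractionRing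
  obtain ⟨p, hp, -⟩ := exists_heightOneSpectrum_of_le (A := affineRing k s) V
    (mem_of_integral V hk hsV) hV
  refine ⟨p.valuation F, ⟨fun c hc => ?_, p.valuation_surjective F⟩, hp⟩
  have h1 := (hp _).2 (hk c)
  have h2 := (hp _).2 (hk c⁻¹)
  rw [map_inv₀, map_inv₀] at h2
  refine le_antisymm h1 ?_
  have h0 : p.valuation F (algebraMap k F c) ≠ 0 := by simpa using hc
  exact (inv_le_one₀ (zero_lt_iff.2 h0)).1 h2

theorem IsPlace.ne_top {v : Valuation F ℤᵐ⁰} (hv : IsPlace k v) : v.valuationSubring ≠ ⊤ := by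
  intro h
  obtain ⟨x, hx⟩ := hv.surjective (WithZero.exp 1)
  have : x ∈ v.valuationSubring := h ▸ trivial
  rw [Valuation.mem_valuationSubring_iff, hx, ← WithZero.exp_zero, WithZero.exp_le_exp] at this
  lia

theorem IsPlace.exists_heightOneSpectrum {s : F}
    [IsDedekindDomain (affineRing k s)] [IsFractionRing (affineRing k s) F]
    {v : Valuation F ℤᵐ⁰} (hv : IsPlace k v) (hvs : v s ≤ 1) :
    ∃ p : HeightOneSpectrum (affineRing k s), v = p.valuation F := by
  obtain ⟨p, hp, -⟩ := exists_heightOneSpectrum_of_le (A := affineRing k s) v.valuationSubring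
    (mem_of_integral _ hv.map_const_le hvs) hv.ne_top
  exact ⟨p, eq_of_le_one_iff hv.surjective (p.valuation_surjective F) fun x => (hp x).symm⟩

theorem isPlace_valuation {s : F}
    [IsDedekindDomain (affineRing k s)] [IsFractionRing (affineRing k s) F]
    (p : HeightOneSpectrum (affineRing k s)) : IsPlace k (p.valuation F) := by
  refine ⟨fun c hc => ?_, p.valuation_surjective F⟩
  have h : ∀ c : k, p.valuation F (algebraMap k F c) ≤ 1 := fun c =>
    p.valuation_le_one (K := F) (algebraMap k (affineRing k s) c)
  have h2 := h c⁻¹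
  rw [map_inv₀, map_inv₀] at h2
  refine le_antisymm (h c) ?_
  have h0 : p.valuation F (algebraMap k F c) ≠ 0 := by simpa using hc
  exact (inv_le_one₀ (zero_lt_iff.2 h0)).1 h2

theorem self_mem_affineRing (s : F) : s ∈ integralClosure (Algebra.adjoin k {s}) F :=
  (integralClosure (Algebra.adjoin k {s}) F).algebraMap_mem
    ⟨s, Algebra.self_mem_adjoin_singleton k s⟩

theorem IsSeparatingElement.finite_zeros {s : F} (hs : IsSeparatingElement k s) {x : F}
    (hx : x ∈ integralClosure (Algebra.adjoin k {s}) F) (hx0 : x ≠ 0) :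
    {v : Valuation F ℤᵐ⁰ | IsPlace k v ∧ v s ≤ 1 ∧ v x < 1}.Finite := by
  have := hs.isDedekindDomain
  have := hs.isFractionRing
  let x' : affineRing k s := ⟨x, hx⟩
  have hx' : Ideal.span {x'} ≠ 0 := by
    rw [Ne, Ideal.zero_eq_bot, Ideal.span_singleton_eq_bot]
    intro h
    exact hx0 congr($(h).1)
  refine ((Ideal.finite_factors hx').image fun p => p.valuation F).subset ?_
  rintro v ⟨hv, hvs, hvx⟩
  obtain ⟨p, rfl⟩ := hv.exists_heightOneSpectrum hvs
  exact ⟨p, (p.valuation_lt_one_iff_dvd (K := F) x').1 hvx, rfl⟩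

/-- The places with v(s) ≤ 1 are the maximal ideals of the affine ring, and a Dedekind domain is the
intersection of its localizations at them. -/
theorem IsSeparatingElement.mem_affineRing_iff {s : F} (hs : IsSeparatingElement k s) (x : F) :
    x ∈ integralClosure (Algebra.adjoin k {s}) F ↔
      ∀ v : Valuation F ℤᵐ⁰, IsPlace k v → v s ≤ 1 → v x ≤ 1 := by
  have := hs.isDedekindDomain
  have := hs.isFractionRing
  refine ⟨fun hx v hv hvs =>
    mem_of_integral v.valuationSubring hv.map_const_le hvs ⟨x, hx⟩, fun h => ?_⟩
  obtain ⟨y, hy⟩ := HeightOneSpectrum.mem_integers_of_valuation_le_one (R := affineRing k s) F x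
    fun p => h _ (isPlace_valuation p)
      (p.valuation_le_one (K := F) (⟨s, self_mem_affineRing s⟩ : affineRing k s))
  rw [← hy]
  exact y.2

theorem IsSeparatingElement.exists_uniformizer {s : F} (hs : IsSeparatingElement k s)
    {v : Valuation F ℤᵐ⁰} (hv : IsPlace k v) (hvs : v s ≤ 1) :
    ∃ x ∈ integralClosure (Algebra.adjoin k {s}) F, v x = WithZero.exp (-1) := by
  have := hs.isDedekindDomain
  have := hs.isFractionRing
  obtain ⟨p, rfl⟩ := hv.exists_heightOneSpectrum hvs
  obtain ⟨x, hx⟩ := p.intValuation_exists_uniformizer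
  exact ⟨x, x.2, (p.valuation_of_algebraMap x).trans hx⟩

theorem IsSeparatingElement.exists_separating {s : F} (hs : IsSeparatingElement k s)
    {v w : Valuation F ℤᵐ⁰} (hv : IsPlace k v) (hvs : v s ≤ 1) (hw : IsPlace k w) (hws : w s ≤ 1)
    (hvw : v ≠ w) :
    ∃ x ∈ integralClosure (Algebra.adjoin k {s}) F, v x = 1 ∧ w x < 1 := by
  have := hs.isDedekindDomain
  have := hs.isFractionRing
  obtain ⟨p, rfl⟩ := hv.exists_heightOneSpectrum hvs
  obtain ⟨q, rfl⟩ := hw.exists_heightOneSpectrum hws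
  have : ¬ q.asIdeal ≤ p.asIdeal := by
    intro h
    exact hvw (by rw [HeightOneSpectrum.ext (q.isMaximal.eq_of_le p.isPrime.ne_top h)])
  obtain ⟨x, hxq, hxp⟩ := SetLike.not_le_iff_exists.1 this
  exact ⟨x, x.2, p.valuation_eq_one_iff_notMem.2 hxp, (q.valuation_lt_one_iff_mem x).2 hxq⟩

/-- The residue field is of finite type over k, so it is finite over k by Zariski's lemma and equals
k. -/
theorem IsPlace.exists_const_sub_lt [IsAlgClosed k] {s : F} (hs : IsSeparatingElement k s)
    {v : Valuation F ℤᵐ⁰} (hv : IsPlace k v) {x : F} (hx : v x ≤ 1) :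
    ∃ c : k, v (x - algebraMap k F c) < 1 := by
  wlog hvs : v s ≤ 1 generalizing s
  · refine this hs.inv ?_
    rw [map_inv₀]
    exact inv_le_one_of_one_le₀ (not_le.1 hvs).le
  have := hs.isDedekindDomain
  have := hs.isFractionRing
  have := hs.isPrincipalIdealRing
  have := hs.finite
  have := hs.separable
  have hfin : Module.Finite (Algebra.adjoin k {s}) (affineRing k s) :=
    IsIntegralClosure.finite _ k⟮s⟯ F _
  have : Algebra.FiniteType k (Algebra.adjoin k {s}) :=
    Subalgebra.fg_iff_finiteType _ |>.1 ⟨{s}, by simp⟩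
  have : Algebra.FiniteType k (affineRing k s) :=
    Algebra.FiniteType.trans (S := Algebra.adjoin k {s}) this inferInstance
  obtain ⟨p, rfl⟩ := hv.exists_heightOneSpectrum hvs
  obtain ⟨a, ha⟩ := p.exists_valuation_sub_lt_of_integer hx (γ := 1)
  have := p.isMaximal
  let _ : Field (affineRing k s ⧸ p.asIdeal) := Ideal.Quotient.field _
  have : Algebra.FiniteType k (affineRing k s ⧸ p.asIdeal) :=
    Algebra.FiniteType.of_surjective (Ideal.Quotient.mkₐ k p.asIdeal)
      Ideal.Quotient.mk_surjective
  have : Module.Finite k (affineRing k s ⧸ p.asIdeal) :=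
    finite_of_finite_type_of_isJacobsonRing k _
  obtain ⟨c, hc⟩ := (IsAlgClosed.algebraMap_bijective_of_isIntegral
    (k := k) (K := affineRing k s ⧸ p.asIdeal)).2 (Ideal.Quotient.mk _ a)
  refine ⟨c, ?_⟩
  have h2 : p.valuation F (algebraMap k F c - a) < 1 := by
    refine (p.valuation_lt_one_iff_mem (K := F) (algebraMap k (affineRing k s) c - a)).2 ?_
    rw [← Ideal.Quotient.eq, ← hc]
    rfl
  have : x - algebraMap k F c = -(a - x) - (algebraMap k F c - a) := by ring
  rw [this]
  exact Valuation.map_sub_lt _ (by rw [Valuation.map_neg]; exact ha) h2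

/-- The residue map at a place. -/
theorem IsPlace.exists_residue [IsAlgClosed k] {s : F} (hs : IsSeparatingElement k s)
    {v : Valuation F ℤᵐ⁰} (hv : IsPlace k v) :
    ∃ e : v.integer →+* k, ∀ x c, e x = c ↔ v (x - algebraMap k F c) < 1 := by
  have huniq : ∀ (x : F) (c d : k), v (x - algebraMap k F c) < 1 → v (x - algebraMap k F d) < 1 →
      c = d := by
    intro x c d hc hd
    by_contra hne
    have h1 := hv.map_const (c - d) (sub_ne_zero.2 hne)
    have h2 : algebraMap k F (c - d) = (x - algebraMap k F d) - (x - algebraMap k F c) := by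
      rw [map_sub]; ring
    rw [h2] at h1
    exact absurd h1 (Valuation.map_sub_lt v hd hc).ne
  choose e he using fun x : v.integer => hv.exists_const_sub_lt hs x.2
  have hiff : ∀ x c, e x = c ↔ v (x - algebraMap k F c) < 1 := fun x c =>
    ⟨fun h => h ▸ he x, fun h => huniq _ _ _ (he x) h⟩
  refine ⟨{ toFun := e, map_one' := ?_, map_mul' := ?_, map_zero' := ?_, map_add' := ?_ }, hiff⟩
  · rw [hiff]; simp
  · intro x y
    rw [hiff, map_mul]
    have : ((x * y : v.integer) : F) - algebraMap k F (e x) * algebraMap k F (e y) =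
        x * (y - algebraMap k F (e y)) + (x - algebraMap k F (e x)) * algebraMap k F (e y) := by
      push_cast; ring
    rw [this]
    refine Valuation.map_add_lt v ?_ ?_
    · rw [map_mul]
      exact (mul_le_of_le_one_left' x.2).trans_lt (he y)
    · rw [map_mul, mul_comm]
      exact (mul_le_of_le_one_left' (hv.map_const_le _)).trans_lt (he x)
  · rw [hiff]; simp
  · intro x y
    rw [hiff, map_add]
    have : ((x + y : v.integer) : F) - (algebraMap k F (e x) + algebraMap k F (e y)) =
        (x - algebraMap k F (e x)) + (y - algebraMap k F (e y)) := by
      push_cast; ring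
    rw [this]
    exact Valuation.map_add_lt v (he x) (he y)

/-- The valuation rings containing k intersect in the integral closure of k, which is k itself. This
replaces properness of the curve in the rest of the proof. -/
theorem IsSeparatingElement.mem_range_of_forall_le [IsAlgClosed k] {s : F}
    (hs : IsSeparatingElement k s) {x : F}
    (hx : ∀ v : Valuation F ℤᵐ⁰, IsPlace k v → v x ≤ 1) : ∃ c : k, algebraMap k F c = x := by
  have hmem : x ∈ (integralClosure (Subring.closure (Set.range (algebraMap k F))) F).toSubring := by
    rw [← iInf_valuationSubring_superset, Subring.mem_iInf]
    rintro ⟨V, hV⟩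
    by_cases htop : V = ⊤
    · subst htop; trivial
    obtain ⟨v, hv, hvV⟩ := hs.exists_isPlace V (fun c => hV ⟨c, rfl⟩) htop
    exact (hvV x).1 (hx v hv)
  have hcl : Subring.closure (Set.range (algebraMap k F)) = (algebraMap k F).range := by
    rw [← RingHom.coe_range, Subring.closure_eq]
  rw [hcl] at hmem
  have hint : IsIntegral k x := by
    obtain ⟨p, hp, hpx⟩ := hmem
    obtain ⟨q, hq, -, hqm⟩ := Polynomial.lifts_and_natDegree_eq_and_monic
      (f := (algebraMap k F).rangeRestrict)
      ((Polynomial.mem_lifts p).2 (Polynomial.map_surjective _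
        (algebraMap k F).rangeRestrict_surjective p)) hp
    refine ⟨q, hqm, ?_⟩
    rw [← hpx, ← hq, Polynomial.eval₂_map]
    rfl
  have h := IsAlgClosed.degree_eq_one_of_irreducible k (minpoly.irreducible hint)
  exact minpoly.mem_range_of_degree_eq_one k x h

end Places

end CMMotive

namespace CMMotive

open scoped TensorProduct Polynomial

/-! ### Geometric extensions: L ⊗ K is a domain -/

section Domain

/-- If `k` is algebraically closed in `K`, then minimal polynomials over `k` stay irreducible
over `K`. -/
theorem natDegree_minpoly_eq_of_geometric {k K Ω : Type*} [Field k] [Field K] [Field Ω]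
    [Algebra k K] [Algebra K Ω] [Algebra k Ω] [IsScalarTower k K Ω]
    (hgeom : IsGeometric k K) {x : Ω} (hx : IsIntegral k x) :
    (minpoly K x).natDegree = (minpoly k x).natDegree := by
  have hxK : IsIntegral K x := hx.tower_top
  have hdvd : minpoly K x ∣ (minpoly k x).map (algebraMap k K) :=
    minpoly.dvd_map_of_isScalarTower k K x
  have hle : (minpoly K x).natDegree ≤ (minpoly k x).natDegree := by
    simpa using Polynomial.natDegree_le_of_dvd hdvd
      (((minpoly.monic hx).map (algebraMap k K)).ne_zero)
  refine le_antisymm hle ?_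
  -- A monic factor over K of a monic polynomial over k has coefficients integral over k, and these
  -- lie in k because K is geometric.
  have hl := integralClosure.mem_lifts_of_monic_of_dvd_map K (minpoly.monic hx)
    (minpoly.monic hxK) hdvd
  have hl' : minpoly K x ∈ Polynomial.lifts (algebraMap k K) := by
    rw [Polynomial.lifts_iff_coeff_lifts] at hl ⊢
    intro n
    obtain ⟨y, hy⟩ := hl n
    rw [← hy]
    exact hgeom _ y.2.isAlgebraic
  obtain ⟨q, hq, hdeg, hmon⟩ := Polynomial.lifts_and_natDegree_eq_and_monic hl' (minpoly.monic hxK)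
  rw [← hdeg]
  refine Polynomial.natDegree_le_of_dvd (minpoly.dvd k x ?_) hmon.ne_zero
  rw [← Polynomial.aeval_map_algebraMap K, hq, minpoly.aeval]

theorem isDomain_tensorProduct_of_finite {k k' K : Type*} [Field k] [Finite k] [Field k'] [Field K]
    [Algebra k k'] [Algebra k K] [Module.Finite k k'] (hgeom : IsGeometric k K) :
    IsDomain (k' ⊗[k] K) := by
  let Ω := AlgebraicClosure K
  let f : k' →ₐ[k] Ω := IsAlgClosed.lift
  let pb := Field.powerBasisOfFiniteOfSeparable k k'
  let e : k' ≃ₐ[k] f.fieldRange := AlgEquiv.ofInjectiveField f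
  have hdeg : (minpoly K (f pb.gen)).natDegree = pb.dim := by
    rw [natDegree_minpoly_eq_of_geometric hgeom
      ((Algebra.IsIntegral.isIntegral pb.gen).map f), minpoly.algHom_eq f f.injective,
      pb.natDegree_minpoly]
  have H : f.fieldRange.LinearDisjoint K := by
    refine IntermediateField.LinearDisjoint.of_basis_left (pb.basis.map e.toLinearEquiv) ?_
    have h := linearIndependent_pow (K := K) (f pb.gen)
    rw [hdeg] at h
    convert h using 1
    ext i
    change f (pb.basis i) = _
    rw [pb.basis_eq_pow, map_pow]
  have := H.isDomain
  exact (Algebra.TensorProduct.congr e (AlgEquiv.refl : K ≃ₐ[k] K)).toMulEquiv.isDomain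

/-- Specialization to finite extensions of k: two elements with product zero have coefficients in a
finitely generated k-algebra R, whose residue fields at maximal ideals are finite over k, and
`isDomain_tensorProduct_of_finite` applies there. -/
theorem isDomain_tensorProduct {k L K : Type*} [Field k] [Finite k] [Field L] [Field K]
    [Algebra k L] [Algebra k K] (hgeom : IsGeometric k K) : IsDomain (L ⊗[k] K) := by
  classical
  let b := Module.Basis.ofVectorSpace k K
  have : Nontrivial (L ⊗[k] K) := inferInstance
  have : NoZeroDivisors (L ⊗[k] K) := by
    refine ⟨fun {x y} hxy => ?_⟩
    let bL := b.baseChange L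
    let s : Finset L := (bL.repr x).support.image (bL.repr x) ∪ (bL.repr y).support.image (bL.repr y)
    let R := Algebra.adjoin k (s : Set L)
    have hft : Algebra.FiniteType k R := (Subalgebra.fg_iff_finiteType _).1 ⟨s, rfl⟩
    have : IsJacobsonRing R := isJacobsonRing_of_finiteType (A := k)
    let bR := b.baseChange R
    let φ : R ⊗[k] K →ₐ[k] L ⊗[k] K := Algebra.TensorProduct.map R.val (AlgHom.id k K)
    have hφ : Function.Injective φ :=
      Module.Flat.rTensor_preserves_injective_linearMap R.val.toLinearMap Subtype.val_injective
    have lift : ∀ z : L ⊗[k] K, (∀ i, bL.repr z i ∈ R) →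
        ∃ z' : R ⊗[k] K, φ z' = z ∧ ∀ i, (bR.repr z' i : L) = bL.repr z i := by
      intro z hz
      refine ⟨∑ i ∈ (bL.repr z).support, (⟨bL.repr z i, hz i⟩ : R) • bR i, ?_, fun i => ?_⟩
      · conv_rhs => rw [← bL.linearCombination_repr z, Finsupp.linearCombination_apply, Finsupp.sum]
        rw [map_sum]
        refine Finset.sum_congr rfl fun i _ => ?_
        simp [φ, bR, bL, TensorProduct.smul_tmul']
      · simp only [map_sum, map_smul, Module.Basis.repr_self, Finsupp.coe_finsetSum, Finset.sum_apply,
          Finsupp.smul_apply, Finsupp.single_apply, smul_eq_mul, mul_ite, mul_one, mul_zero,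
          Finset.sum_ite_eq']
        split_ifs with h
        · rfl
        · simpa using (Finsupp.notMem_support_iff.1 h).symm
    have hsx : ∀ i, bL.repr x i ∈ R := fun i => by
      by_cases h : i ∈ (bL.repr x).support
      · exact Algebra.subset_adjoin (by simp only [s, Finset.coe_union]; left; exact Finset.mem_image_of_mem _ h)
      · rw [Finsupp.notMem_support_iff.1 h]; exact zero_mem R
    have hsy : ∀ i, bL.repr y i ∈ R := fun i => by
      by_cases h : i ∈ (bL.repr y).support
      · exact Algebra.subset_adjoin (by simp only [s, Finset.coe_union]; right; exact Finset.mem_image_of_mem _ h)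
      · rw [Finsupp.notMem_support_iff.1 h]; exact zero_mem R
    obtain ⟨x', hx', hxc⟩ := lift x hsx
    obtain ⟨y', hy', hyc⟩ := lift y hsy
    have hxy' : x' * y' = 0 := hφ (by rw [map_mul, hx', hy', hxy, map_zero])
    -- Modulo each maximal ideal one factor vanishes, so this product lies in the Jacobson radical
    -- of R. That is the nilradical, since R is Jacobson, and it is zero, since R is a domain.
    have key : ∀ i j, bR.repr x' i * bR.repr y' j = 0 := by
      intro i j
      have hmem : bR.repr x' i * bR.repr y' j ∈ (⊥ : Ideal R).jacobson := by
        rw [Ideal.jacobson, Ideal.mem_sInf]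
        rintro m ⟨-, hm⟩
        let _ : Field (R ⧸ m) := Ideal.Quotient.field m
        have : Algebra.FiniteType k (R ⧸ m) :=
          Algebra.FiniteType.of_surjective (Ideal.Quotient.mkₐ k m) Ideal.Quotient.mk_surjective
        have : Module.Finite k (R ⧸ m) := finite_of_finite_type_of_isJacobsonRing k _
        have hdom : IsDomain ((R ⧸ m) ⊗[k] K) := isDomain_tensorProduct_of_finite hgeom
        let ψ : R ⊗[k] K →ₐ[k] (R ⧸ m) ⊗[k] K :=
          Algebra.TensorProduct.map (Ideal.Quotient.mkₐ k m) (AlgHom.id k K)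
        let bm := b.baseChange (R ⧸ m)
        have hcoord : ∀ z i, bm.repr (ψ z) i = Ideal.Quotient.mk m (bR.repr z i) := by
          intro z i
          induction z using TensorProduct.induction_on with
          | zero => simp
          | tmul r a => simp [ψ, bm, bR, Algebra.smul_def]
          | add z w hz hw => simp [hz, hw]
        have h0 : ψ x' * ψ y' = 0 := by rw [← map_mul, hxy', map_zero]
        rcases mul_eq_zero.1 h0 with h | h
        · refine m.mul_mem_right _ ?_
          rw [← Ideal.Quotient.eq_zero_iff_mem, ← hcoord, h]; simp
        · refine m.mul_mem_left _ ?_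
          rw [← Ideal.Quotient.eq_zero_iff_mem, ← hcoord, h]; simp
      rw [← Ideal.radical_eq_jacobson] at hmem
      obtain ⟨n, hn⟩ := hmem
      exact eq_zero_of_pow_eq_zero hn
    by_cases h : x' = 0
    · left; rw [← hx', h, map_zero]
    · right
      obtain ⟨i, hi⟩ : ∃ i, bR.repr x' i ≠ 0 := by
        by_contra! hall
        exact h (bR.repr.map_eq_zero_iff.1 (Finsupp.ext hall))
      have : y' = 0 := bR.repr.map_eq_zero_iff.1
        (Finsupp.ext fun j => (mul_eq_zero.1 (key i j)).resolve_left hi)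
      rw [← hy', this, map_zero]
  exact NoZeroDivisors.to_isDomain _

end Domain

end CMMotive

namespace CMMotive

open scoped TensorProduct Polynomial IntermediateField
open IntermediateField.algebraAdjoinAdjoin

/-! ### The function field of the base change over L(t) -/

section FunctionField

theorem linearIndependent_one_tmul {k V : Type*} (L : Type*) [Field k] [Field L] [Algebra k L]
    [AddCommGroup V] [Module k V] {ι : Type*} {v : ι → V} (hv : LinearIndependent k v) :
    LinearIndependent L fun i => (1 : L) ⊗ₜ[k] v i := by
  let b := Module.Basis.sumExtend hv
  have h := (b.baseChange L).linearIndependent.comp Sum.inl Sum.inl_injective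
  convert h using 1
  ext i
  change (1 : L) ⊗ₜ[k] v i = b.baseChange L (Sum.inl i)
  rw [Module.Basis.baseChange_apply]
  simp [b, Module.Basis.sumExtend]
  rfl

/-- If a finite family spans a submonoid of `F` that generates a subring with fraction field `F`
over the field `E`, then it spans `F`. -/
theorem span_eq_top_of_adjoin {E F A ι : Type*} [Field E] [Field F] [Algebra E F] [Finite ι]
    [CommRing A] [Algebra A F] [IsFractionRing A F] (S : Submonoid F) (v : ι → F)
    (hS : (S : Set F) ⊆ Submodule.span E (Set.range v))
    (hA : ∀ a : A, algebraMap A F a ∈ Algebra.adjoin E (S : Set F)) :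
    Submodule.span E (Set.range v) = ⊤ := by
  have hS' : Subalgebra.toSubmodule (Algebra.adjoin E (S : Set F)) ≤
      Submodule.span E (Set.range v) := by
    rw [Algebra.adjoin_eq_span, Submonoid.closure_eq]
    exact Submodule.span_le.2 hS
  have hfin : Module.Finite E (Submodule.span E (Set.range v)) :=
    Module.Finite.span_of_finite E (Set.finite_range _)
  have hSfin : Module.Finite E (Algebra.adjoin E (S : Set F)) :=
    Submodule.finiteDimensional_of_le hS'
  have hfield : IsField (Algebra.adjoin E (S : Set F)) :=
    isField_of_isIntegral_of_isField' (Field.toIsField E)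
  rw [eq_top_iff]
  intro x _
  apply hS'
  have : IsDomain A := (IsFractionRing.injective A F).isDomain (algebraMap A F)
  obtain ⟨a, b, hb, rfl⟩ := IsFractionRing.div_surjective (A := A) x
  rw [div_eq_mul_inv, Subalgebra.mem_toSubmodule]
  refine mul_mem (hA a) ?_
  have hb0 : (⟨_, hA b⟩ : Algebra.adjoin E (S : Set F)) ≠ 0 := by
    intro h
    have := congr($(h).1)
    exact nonZeroDivisors.ne_zero hb ((map_eq_zero_iff _ (IsFractionRing.injective A F)).1 this)
  obtain ⟨c, hc⟩ := hfield.mul_inv_cancel hb0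
  have hc' : algebraMap A F b * (c : F) = 1 := congr($(hc).1)
  rw [← eq_inv_of_mul_eq_one_right hc']
  exact c.2

variable (Fq L K : Type*) [Field Fq] [Field L] [Field K] [Algebra Fq L] [Algebra Fq K]

theorem algebraMap_eq_const (c : L) :
    algebraMap L (FunField Fq L K) c = FunField.const Fq K c := rfl

theorem const_mul_ofBase (c : L) (x : K) :
    FunField.const Fq K c * FunField.ofBase Fq L x =
      algebraMap (L ⊗[Fq] K) (FunField Fq L K) (c ⊗ₜ x) := by
  rw [FunField.const, FunField.ofBase, RingHom.comp_apply, RingHom.comp_apply, ← map_mul]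
  simp

theorem const_algebraMap (c : Fq) :
    FunField.const Fq K (algebraMap Fq L c) = FunField.ofBase Fq L (algebraMap Fq K c) := by
  rw [FunField.const, FunField.ofBase, RingHom.comp_apply, RingHom.comp_apply]
  congr 1
  change algebraMap Fq L c ⊗ₜ[Fq] (1 : K) = (1 : L) ⊗ₜ[Fq] algebraMap Fq K c
  rw [Algebra.algebraMap_eq_smul_one, Algebra.algebraMap_eq_smul_one, TensorProduct.smul_tmul]

theorem linearIndependent_ofBase {ι : Type*} {v : ι → K} (hv : LinearIndependent Fq v) :
    LinearIndependent L fun i => FunField.ofBase Fq L (v i) :=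
  (linearIndependent_one_tmul L hv).map' (Algebra.linearMap (L ⊗[Fq] K) (FunField Fq L K)
    |>.restrictScalars L) (LinearMap.ker_eq_bot.2
      (IsFractionRing.injective (L ⊗[Fq] K) (FunField Fq L K)))

variable [Algebra (RatFunc Fq) K] [IsScalarTower Fq (RatFunc Fq) K]

theorem linearIndependent_X_pow : LinearIndependent Fq fun j : ℕ => (RatFunc.X : RatFunc Fq) ^ j := by
  have h := (Polynomial.basisMonomials Fq).linearIndependent.map'
    (Algebra.linearMap Fq[X] (RatFunc Fq) |>.restrictScalars Fq)
    (LinearMap.ker_eq_bot.2 (IsFractionRing.injective Fq[X] (RatFunc Fq)))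
  have he : (fun j : ℕ => (RatFunc.X : RatFunc Fq) ^ j) =
      (Algebra.linearMap Fq[X] (RatFunc Fq) |>.restrictScalars Fq) ∘
        Polynomial.basisMonomials Fq := by
    ext j
    simp [Polynomial.monomial_one_right_eq_X_pow]
  rw [he]
  exact h

theorem aeval_t_ofBase (p : Fq[X]) :
    Polynomial.aeval (FunField.t Fq L K) (p.map (algebraMap Fq L)) =
      FunField.ofBase Fq L (algebraMap (RatFunc Fq) K (algebraMap Fq[X] (RatFunc Fq) p)) := by
  induction p using Polynomial.induction_on' with
  | add p q hp hq => simp [hp, hq]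
  | monomial n a =>
    rw [Polynomial.map_monomial, Polynomial.aeval_monomial, ← Polynomial.C_mul_X_pow_eq_monomial,
      algebraMap_eq_const, const_algebraMap, FunField.t]
    simp only [map_mul, map_pow, RatFunc.algebraMap_X, RatFunc.algebraMap_C]
    rw [IsScalarTower.algebraMap_apply Fq (RatFunc Fq) K]
    rfl

/-- The products t^j b_i are independent over 𝔽_q in K, and base change to L preserves this. -/
theorem linearIndependent_t_pow_mul {ι : Type*} {b : ι → K}
    (hb : LinearIndependent (RatFunc Fq) b) :
    LinearIndependent L fun p : ℕ × ι =>
      FunField.t Fq L K ^ p.1 * FunField.ofBase Fq L (b p.2) := by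
  have h := linearIndependent_ofBase Fq L K (linearIndependent_smul (linearIndependent_X_pow Fq) hb)
  convert h using 1
  ext p
  rw [Algebra.smul_def, map_mul, map_pow, map_pow, FunField.t]

theorem transcendental_t : Transcendental L (FunField.t Fq L K) := by
  have h := (linearIndependent_ofBase Fq L K (v := fun j : ℕ => algebraMap (RatFunc Fq) K (RatFunc.X ^ j))
    ((linearIndependent_X_pow Fq).map' (Algebra.linearMap (RatFunc Fq) K |>.restrictScalars Fq)
      (LinearMap.ker_eq_bot.2 (algebraMap (RatFunc Fq) K).injective)))
  rw [transcendental_iff]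
  intro p hp
  rw [Polynomial.aeval_eq_sum_range] at hp
  ext n
  by_cases hn : n ∈ Finset.range (p.natDegree + 1)
  · refine linearIndependent_iff'.1 h (Finset.range (p.natDegree + 1)) p.coeff ?_ n hn
    simpa [FunField.t] using hp
  · simp only [Finset.mem_range, not_lt] at hn
    exact Polynomial.coeff_eq_zero_of_natDegree_lt (by lia)

variable [IsDomain (L ⊗[Fq] K)]

theorem ofBase_ratFunc_mem (r : RatFunc Fq) :
    FunField.ofBase Fq L (algebraMap (RatFunc Fq) K r) ∈ L⟮FunField.t Fq L K⟯ := by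
  have hpoly : ∀ p : Fq[X], FunField.ofBase Fq L (algebraMap (RatFunc Fq) K
      (algebraMap Fq[X] (RatFunc Fq) p)) ∈ L⟮FunField.t Fq L K⟯ := fun p => by
    rw [← aeval_t_ofBase]
    exact IntermediateField.algebra_adjoin_le_adjoin _ _
      (Polynomial.aeval_mem_adjoin_singleton L _)
  induction r using RatFunc.induction_on with
  | f p q hq =>
    rw [map_div₀, map_div₀]
    exact div_mem (hpoly p) (hpoly q)

/-- The inclusion of `𝔽_q(t)` in `L(t)`. -/
def ratFuncToAdjoin : RatFunc Fq →+* L⟮FunField.t Fq L K⟯ :=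
  ((FunField.ofBase Fq L).comp (algebraMap (RatFunc Fq) K)).codRestrict _
    (ofBase_ratFunc_mem Fq L K)

theorem ofBase_smul (r : RatFunc Fq) (x : K) :
    FunField.ofBase Fq L (r • x) = ratFuncToAdjoin Fq L K r • FunField.ofBase Fq L x := by
  rw [Algebra.smul_def, map_mul]
  rfl

theorem isSeparable_ofBase [Algebra.IsSeparable (RatFunc Fq) K] (x : K) :
    IsSeparable L⟮FunField.t Fq L K⟯ (FunField.ofBase Fq L x) := by
  have hs : (minpoly (RatFunc Fq) x).Separable := Algebra.IsSeparable.isSeparable _ x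
  refine (hs.map (f := ratFuncToAdjoin Fq L K)).of_dvd (minpoly.dvd _ _ ?_)
  have h := congr(FunField.ofBase Fq L $(minpoly.aeval (RatFunc Fq) x))
  rw [Polynomial.aeval_def, Polynomial.hom_eval₂, map_zero] at h
  rw [Polynomial.aeval_def, Polynomial.eval₂_map]
  exact h

theorem linearIndependent_ofBase_adjoin {ι : Type*} [Fintype ι] {b : ι → K}
    (hb : LinearIndependent (RatFunc Fq) b) :
    LinearIndependent L⟮FunField.t Fq L K⟯ fun i => FunField.ofBase Fq L (b i) := by
  -- Clearing denominators leaves a relation with coefficients in L[t]. Expanding them in powers of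
  -- t up to a common degree reduces it to the independence of the t^j b_i over L.
  rw [← LinearIndependent.iff_fractionRing (Algebra.adjoin L {FunField.t Fq L K}),
    Fintype.linearIndependent_iff]
  intro r hr
  have hp : ∀ i, ∃ p : L[X], Polynomial.aeval (FunField.t Fq L K) p = (r i : FunField Fq L K) := by
    intro i
    obtain ⟨x, hx⟩ := r i
    rw [Algebra.adjoin_singleton_eq_range_aeval] at hx
    exact hx
  choose p hp using hp
  have h := linearIndependent_iff'.1 (linearIndependent_t_pow_mul Fq L K hb)
    (Finset.range ((Finset.univ.sup fun i => (p i).natDegree) + 1) ×ˢ Finset.univ)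
    (fun q => (p q.2).coeff q.1) (by
      rw [Finset.sum_product_right, ← hr]
      refine Finset.sum_congr rfl fun i _ => ?_
      rw [Subalgebra.smul_def, ← hp, Polynomial.aeval_eq_sum_range' (n := _ + 1)
        (Nat.lt_succ_of_le (Finset.le_sup (f := fun i => (p i).natDegree) (Finset.mem_univ i))),
        smul_eq_mul, Finset.sum_mul]
      simp)
  intro i
  have hpi : p i = 0 := by
    ext n
    by_cases hn : n < (Finset.univ.sup fun i => (p i).natDegree) + 1
    · exact h (n, i) (by simpa using hn)
    · have : (p i).natDegree ≤ _ :=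
        Finset.le_sup (f := fun i => (p i).natDegree) (Finset.mem_univ i)
      exact Polynomial.coeff_eq_zero_of_natDegree_lt (by lia)
  ext
  rw [← hp, hpi]
  simp

variable [FiniteDimensional (RatFunc Fq) K]

theorem span_ofBase_eq_top :
    Submodule.span L⟮FunField.t Fq L K⟯
      (Set.range fun i => FunField.ofBase Fq L (Module.finBasis (RatFunc Fq) K i)) = ⊤ := by
  refine span_eq_top_of_adjoin (A := L ⊗[Fq] K) 
    (MonoidHom.mrange ((FunField.ofBase Fq L : K →+* FunField Fq L K) : K →* FunField Fq L K))
    _ ?_ ?_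
  · rintro _ ⟨x, rfl⟩
    change FunField.ofBase Fq L x ∈ _
    rw [← (Module.finBasis (RatFunc Fq) K).sum_repr x, map_sum]
    refine sum_mem fun i _ => ?_
    rw [ofBase_smul]
    exact Submodule.smul_mem _ _ (Submodule.subset_span ⟨i, rfl⟩)
  · intro z
    induction z using TensorProduct.induction_on with
    | zero => simp
    | tmul c y =>
      rw [← const_mul_ofBase]
      refine mul_mem ?_ (Algebra.subset_adjoin ⟨y, rfl⟩)
      exact Subalgebra.algebraMap_mem _ (algebraMap L L⟮FunField.t Fq L K⟯ c)
    | add z w hz hw => rw [map_add]; exact add_mem hz hw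

/-- A basis of `K / 𝔽_q(t)` is a basis of the function field of `𝐗` over `L(t)`. -/
def funFieldBasis : Module.Basis (Fin (Module.finrank (RatFunc Fq) K)) L⟮FunField.t Fq L K⟯
    (FunField Fq L K) :=
  Module.Basis.mk (linearIndependent_ofBase_adjoin Fq L K
    (Module.finBasis (RatFunc Fq) K).linearIndependent) (span_ofBase_eq_top Fq L K).ge

theorem finrank_funField :
    Module.finrank L⟮FunField.t Fq L K⟯ (FunField Fq L K) = Module.finrank (RatFunc Fq) K := by
  rw [Module.finrank_eq_card_basis (funFieldBasis Fq L K), Fintype.card_fin]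

/-- The function field is generated over L(t) by K, whose elements satisfy the same separable
equations as over 𝔽_q(t). -/
theorem isSeparatingElement_t [Algebra.IsSeparable (RatFunc Fq) K] :
    IsSeparatingElement L (FunField.t Fq L K) := by
  have hfin : FiniteDimensional L⟮FunField.t Fq L K⟯ (FunField Fq L K) :=
    Module.Finite.of_basis (funFieldBasis Fq L K)
  refine ⟨transcendental_t Fq L K, hfin, ?_⟩
  have htop : IntermediateField.adjoin L⟮FunField.t Fq L K⟯
      (Set.range (FunField.ofBase Fq L : K → FunField Fq L K)) = ⊤ := by
    rw [eq_top_iff]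
    intro x _
    have hx : x ∈ Submodule.span L⟮FunField.t Fq L K⟯
      (Set.range fun i => FunField.ofBase Fq L (Module.finBasis (RatFunc Fq) K i)) := by
      rw [span_ofBase_eq_top]; trivial
    refine (Submodule.span_le (p := Subalgebra.toSubmodule
      (IntermediateField.adjoin L⟮FunField.t Fq L K⟯
        (Set.range (FunField.ofBase Fq L : K → FunField Fq L K))).toSubalgebra)).2 ?_ hx
    rintro _ ⟨i, rfl⟩
    exact IntermediateField.subset_adjoin _ _ ⟨_, rfl⟩
  have hsep := (IntermediateField.isSeparable_adjoin_iff_isSeparable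
    (F := L⟮FunField.t Fq L K⟯) (S := Set.range (FunField.ofBase Fq L : K → FunField Fq L K))).2 (by
    rintro _ ⟨x, rfl⟩
    exact isSeparable_ofBase Fq L K x)
  rw [htop] at hsep
  exact Algebra.IsSeparable.of_algHom _ _ (IntermediateField.topEquiv (F := L⟮FunField.t Fq L K⟯)
    (E := FunField Fq L K)).symm.toAlgHom

end FunctionField

end CMMotive

namespace CMMotive

/-! ### Free modules over L[σ] from filtrations -/

section Filtration

/-- A linear surjection from an exhaustively filtered vector space onto `k ^ d` has a linear
section that is compatible with the filtration. -/
theorem exists_filtered_section {k M : Type*} [Field k] [AddCommGroup M] [Module k M] {d : ℕ}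
    (φ : M →ₗ[k] (Fin d → k)) (hφ : Function.Surjective φ) (V : ℕ → Submodule k M)
    (hmono : Monotone V) (h0 : V 0 = ⊥) (hV : ∀ x, ∃ n, x ∈ V n) :
    ∃ s : (Fin d → k) →ₗ[k] M, ∀ n, ∀ q ∈ (V n).map φ, s q ∈ V n ∧ φ (s q) = q := by
  have step : ∀ n, ∃ s : (Fin d → k) →ₗ[k] M,
      ∀ m ≤ n, ∀ q ∈ (V m).map φ, s q ∈ V m ∧ φ (s q) = q := by
    intro n
    induction n with
    | zero =>
      refine ⟨0, fun m hm q hq => ?_⟩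
      obtain rfl : m = 0 := by lia
      rw [h0, Submodule.map_bot, Submodule.mem_bot] at hq
      simp [hq]
    | succ n ih =>
      obtain ⟨s, hs⟩ := ih
      have proj (N : Submodule k (Fin d → k)) :
          ∃ p : (Fin d → k) →ₗ[k] N, ∀ x : N, p x = x := by
        obtain ⟨p, hp⟩ := N.subtype.exists_leftInverse_of_injective N.ker_subtype
        exact ⟨p, fun x => congr($hp x)⟩
      obtain ⟨p, hp⟩ := proj ((V n).map φ)
      obtain ⟨p', hp'⟩ := proj ((V (n + 1)).map φ)
      obtain ⟨r, hr⟩ := (φ.submoduleMap (V (n + 1))).exists_rightInverse_of_surjective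
        (LinearMap.range_eq_top.2 (φ.submoduleMap_surjective _))
      let r' : (Fin d → k) →ₗ[k] M := (V (n + 1)).subtype ∘ₗ r ∘ₗ p'
      have hr' : ∀ q ∈ (V (n + 1)).map φ, r' q ∈ V (n + 1) ∧ φ (r' q) = q := by
        intro q hq
        refine ⟨(r (p' q)).2, ?_⟩
        have h1 := congr(($hr (p' q) : Fin d → k))
        have h2 : (p' q : Fin d → k) = q := congr(($(hp' ⟨q, hq⟩) : Fin d → k))
        exact h1.trans h2
      -- Keep the old section on φ(V n) and use r' on the complement cut out by p. This preserves
      -- the conditions for all smaller indices.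
      refine ⟨s ∘ₗ (Submodule.subtype _) ∘ₗ p + r' ∘ₗ (LinearMap.id - (Submodule.subtype _) ∘ₗ p),
        fun m hm q hq => ?_⟩
      rcases Nat.lt_or_eq_of_le hm with hlt | rfl
      · have hq' : q ∈ (V n).map φ := Submodule.map_mono (hmono (by lia)) hq
        have h2 : (p q : Fin d → k) = q := congr(($(hp ⟨q, hq'⟩) : Fin d → k))
        simpa [h2] using hs m (by lia) q hq
      · have h1 := hs n le_rfl (p q) (p q).2
        have h2 := hr' (q - p q) (sub_mem hq (Submodule.map_mono (hmono (by lia)) (p q).2))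
        refine ⟨add_mem (hmono (by lia) h1.1) h2.1, ?_⟩
        change φ (s (p q) + r' (q - p q)) = q
        rw [map_add, h1.2, h2.2, add_sub_cancel]
  choose x hx using fun i => hφ (Pi.single i 1)
  choose n hn using fun i => hV (x i)
  -- The target is finite-dimensional, so some φ(V N) is everything and finitely many steps of the
  -- construction suffice.
  have htop : (V (Finset.univ.sup n)).map φ = ⊤ := by
    rw [eq_top_iff, ← (Pi.basisFun k (Fin d)).span_eq, Submodule.span_le]
    rintro _ ⟨i, rfl⟩
    refine ⟨x i, hmono (Finset.le_sup (Finset.mem_univ i)) (hn i), ?_⟩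
    rw [hx, Pi.basisFun_apply]
  obtain ⟨s, hs⟩ := step (Finset.univ.sup n)
  refine ⟨s, fun m q hq => ?_⟩
  rcases le_total m (Finset.univ.sup n) with h | h
  · exact hs m h q hq
  · have := hs _ le_rfl q (htop ▸ Submodule.mem_top)
    exact ⟨hmono h this.1, this.2⟩

variable {Fq L : Type*} [Field Fq] [Fintype Fq] [Field L] [IsAlgClosed L] [Algebra Fq L]

/-- The length n is left free above a bound so that several elements can be expanded to one common
length. -/
theorem SigmaRing.exists_eq_sum (a : SigmaRing Fq L) :
    ∃ c : ℕ → L, ∃ N : ℕ, ∀ n ≥ N,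
      a = ∑ i ∈ Finset.range n, SigmaRing.const Fq (c i) * SigmaRing.σ Fq L ^ i := by
  have hadd : ∀ f g : SigmaRing Fq L,
      (∃ c : ℕ → L, ∃ N : ℕ, ∀ n ≥ N,
        f = ∑ i ∈ Finset.range n, SigmaRing.const Fq (c i) * SigmaRing.σ Fq L ^ i) →
      (∃ c : ℕ → L, ∃ N : ℕ, ∀ n ≥ N,
        g = ∑ i ∈ Finset.range n, SigmaRing.const Fq (c i) * SigmaRing.σ Fq L ^ i) →
      ∃ c : ℕ → L, ∃ N : ℕ, ∀ n ≥ N,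
        f + g = ∑ i ∈ Finset.range n, SigmaRing.const Fq (c i) * SigmaRing.σ Fq L ^ i := by
    rintro f g ⟨c, N, hc⟩ ⟨c', N', hc'⟩
    refine ⟨c + c', max N N', fun n hn => ?_⟩
    rw [hc n (le_trans (le_max_left _ _) hn), hc' n (le_trans (le_max_right _ _) hn),
      ← Finset.sum_add_distrib]
    simp [add_mul]
  let _ := invFrobAction Fq L
  refine SkewMonoidAlgebra.induction_on' (k := L) (G := Multiplicative ℕ)
    (p := fun a : SigmaRing Fq L => ∃ c : ℕ → L, ∃ N : ℕ, ∀ n ≥ N,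
      a = ∑ i ∈ Finset.range n, SigmaRing.const Fq (c i) * SigmaRing.σ Fq L ^ i) a
    (fun m c => ?_) (fun f g hf hg => ?_)
  · refine ⟨Pi.single m.toAdd c, m.toAdd + 1, fun n hn => ?_⟩
    rw [Finset.sum_eq_single m.toAdd]
    · rw [Pi.single_eq_same]
      have h1 : SigmaRing.σ Fq L ^ m.toAdd = SkewPolynomial.monomial m.toAdd (1 : L) :=
        (SkewPolynomial.monomial_one_right_eq_X_pow (R := L) m.toAdd).symm
      rw [h1]
      refine Eq.trans ?_ (SkewPolynomial.C_mul_monomial (R := L)).symm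
      rw [mul_one]
      rfl
    · intro i _ hi
      rw [Pi.single_eq_of_ne hi, map_zero, zero_mul]
    · intro h
      simp at h
      lia
  · exact hadd f g hf hg

/-- Let `M` be a left `L[σ]`-module on which `σ` is injective, and such that `M / σ M` has dimension
`d` over `L`. If `M` has an exhaustive filtration by subspaces `V n` with `V 0 = 0` such that
`σ x ∈ V (n + 1)` implies `x ∈ V n`, then `M` is free of rank `d`. -/
theorem exists_sigma_basis {M : Type*} [AddCommGroup M] [Module L M] [Module (SigmaRing Fq L) M]
    (hconst : ∀ (c : L) (x : M), SigmaRing.const Fq c • x = c • x)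
    (hinj : ∀ x : M, SigmaRing.σ Fq L • x = 0 → x = 0) {d : ℕ}
    (φ : M →ₗ[L] (Fin d → L)) (hφ : Function.Surjective φ)
    (hker : ∀ x, φ x = 0 ↔ ∃ y, x = SigmaRing.σ Fq L • y)
    (V : ℕ → Submodule L M) (hmono : Monotone V) (h0 : V 0 = ⊥) (hV : ∀ x, ∃ n, x ∈ V n)
    (hσ : ∀ n x, SigmaRing.σ Fq L • x ∈ V (n + 1) → x ∈ V n) :
    Nonempty (Module.Basis (Fin d) (SigmaRing Fq L) M) := by
  obtain ⟨s, hs⟩ := exists_filtered_section φ hφ V hmono h0 hV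
  have hs' : ∀ q, φ (s q) = q := by
    intro q
    obtain ⟨x, rfl⟩ := hφ q
    obtain ⟨n, hn⟩ := hV x
    exact (hs n _ ⟨x, hn, rfl⟩).2
  let b : Fin d → M := fun i => s (Pi.single i 1)
  have hsum : ∀ q : Fin d → L, s q = ∑ i, q i • b i := by
    intro q
    conv_lhs => rw [← Finset.univ_sum_single q, map_sum]
    refine Finset.sum_congr rfl fun i _ => ?_
    rw [← map_smul, ← Pi.single_smul, smul_eq_mul, mul_one]
  have hcomm : ∀ (c : L) (x : M), c • SigmaRing.σ Fq L • x =
      SigmaRing.σ Fq L • (frob Fq L c) • x := by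
    intro c x
    rw [← hconst, ← hconst, ← mul_smul, ← mul_smul, SigmaRing.σ_mul_const,
      AlgEquiv.symm_apply_apply]
  have hli : LinearIndependent (SigmaRing Fq L) b := by
    have key : ∀ (N : ℕ) (c : Fin d → ℕ → L),
        ∑ i, ∑ n ∈ Finset.range N, c i n • SigmaRing.σ Fq L ^ n • b i = 0 →
          ∀ i, ∀ n < N, c i n = 0 := by
      intro N
      induction N with
      | zero => intro c _ i n hn; lia
      | succ N ih =>
        intro c hc
        -- A factor σ is pulled out on the left of all terms of positive degree; `frob` appears
        -- because cσ = σc^q. As φ kills σM, the constant terms vanish, and injectivity of σ lowers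
        -- the degree.
        have hrest : ∑ i, ∑ n ∈ Finset.range (N + 1), c i n • SigmaRing.σ Fq L ^ n • b i =
            s (fun i => c i 0) + SigmaRing.σ Fq L • ∑ i, ∑ n ∈ Finset.range N,
              frob Fq L (c i (n + 1)) • SigmaRing.σ Fq L ^ n • b i := by
          simp_rw [Finset.sum_range_succ', Finset.sum_add_distrib, Finset.smul_sum, hsum]
          rw [add_comm]
          congr 1
          · simp
          · refine Finset.sum_congr rfl fun i _ => Finset.sum_congr rfl fun n _ => ?_
            rw [pow_succ', mul_smul, hcomm]
        rw [hrest] at hc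
        have h1 : (fun i => c i 0) = 0 := by
          rw [← hs' (fun i => c i 0), hker]
          exact ⟨_, (eq_neg_of_add_eq_zero_left hc).trans (smul_neg _ _).symm⟩
        rw [h1, map_zero, zero_add] at hc
        have h2 := ih (fun i n => frob Fq L (c i (n + 1))) (hinj _ hc)
        intro i n hn
        cases n with
        | zero => exact congr_fun h1 i
        | succ n => simpa using h2 i n (by lia)
    rw [Fintype.linearIndependent_iff]
    intro a ha
    choose c N hc using fun i => SigmaRing.exists_eq_sum (a i)
    have ha' : ∀ i, a i = ∑ n ∈ Finset.range (Finset.univ.sup N),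
        SigmaRing.const Fq (c i n) * SigmaRing.σ Fq L ^ n :=
      fun i => hc i _ (Finset.le_sup (Finset.mem_univ i))
    have h := key (Finset.univ.sup N) c (by
      rw [← ha]
      refine Finset.sum_congr rfl fun i _ => ?_
      rw [ha' i, Finset.sum_smul]
      refine Finset.sum_congr rfl fun n _ => ?_
      rw [mul_smul, hconst])
    intro i
    rw [ha' i]
    exact Finset.sum_eq_zero fun n hn => by
      rw [h i n (Finset.mem_range.1 hn), map_zero, zero_mul]
  have hspan : ∀ n, ∀ x ∈ V n, x ∈ Submodule.span (SigmaRing Fq L) (Set.range b) := by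
    intro n
    induction n with
    | zero =>
      intro x hx
      rw [h0, Submodule.mem_bot] at hx
      rw [hx]
      exact zero_mem _
    | succ n ih =>
      intro x hx
      -- Filtered division by σ: since s respects the filtration, σy stays in V (n + 1), so y drops
      -- to V n and the process ends at V 0 = 0.
      obtain ⟨y, hy⟩ := (hker (x - s (φ x))).1 (by rw [map_sub, hs', sub_self])
      have hyV : SigmaRing.σ Fq L • y ∈ V (n + 1) := by
        rw [← hy]
        exact sub_mem hx (hs (n + 1) _ ⟨x, hx, rfl⟩).1
      rw [← sub_add_cancel x (s (φ x)), hy]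
      refine add_mem (Submodule.smul_mem _ _ (ih y (hσ n y hyV))) ?_
      rw [hsum]
      refine sum_mem fun i _ => ?_
      rw [← hconst]
      exact Submodule.smul_mem _ _ (Submodule.subset_span ⟨i, rfl⟩)
  refine ⟨Module.Basis.mk hli fun x _ => ?_⟩
  obtain ⟨n, hn⟩ := hV x
  exact hspan n x hn

end Filtration

end CMMotive

namespace CMMotive

open scoped TensorProduct Polynomial IntermediateField WithZero

/-! ### Sections of O(−D) on U and their quotients -/

section Sections

theorem exists_pow_le_exp {x : ℤᵐ⁰} (hx : x < 1) (b : ℤ) : ∃ n : ℕ, ∀ m ≥ n, x ^ m ≤ WithZero.exp b := by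
  rcases eq_or_ne x 0 with rfl | hx0
  · exact ⟨1, fun m hm => by rw [zero_pow (by lia)]; exact zero_le⟩
  · obtain ⟨j, rfl⟩ : ∃ j : ℤ, x = WithZero.exp j := ⟨_, (WithZero.exp_log hx0).symm⟩
    rw [← WithZero.exp_zero, WithZero.exp_lt_exp] at hx
    refine ⟨(-b).toNat, fun m hm => ?_⟩
    rw [← WithZero.exp_nsmul, WithZero.exp_le_exp, nsmul_eq_mul]
    have : -b ≤ m := Int.toNat_le.1 hm
    nlinarith

theorem lt_exp_iff_le_exp {x : ℤᵐ⁰} {n : ℤ} :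
    x < WithZero.exp n ↔ x ≤ WithZero.exp (n - 1) := by
  rcases eq_or_ne x 0 with rfl | hx0
  · simp [WithZero.exp_pos]
  · obtain ⟨j, rfl⟩ : ∃ j : ℤ, x = WithZero.exp j := ⟨_, (WithZero.exp_log hx0).symm⟩
    rw [WithZero.exp_le_exp, WithZero.exp_lt_exp]
    lia

theorem exists_val_eq_exp {F : Type*} [Field F] (v : Valuation F ℤᵐ⁰) {x : F} (hx : x ≠ 0) :
    ∃ n : ℤ, v x = WithZero.exp n :=
  ⟨_, (WithZero.exp_log ((Valuation.ne_zero_iff _).2 hx)).symm⟩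

variable {Fq L K : Type*} [Field Fq] [Field L] [Field K] [Algebra Fq L] [Algebra Fq K]

theorem Divisor.deg_add (D E : Divisor Fq L K) : (D + E).deg = D.deg + E.deg :=
  Finsupp.sum_add_index' (fun _ => rfl) (fun _ _ _ => rfl)

theorem Divisor.deg_single (P : ClosedPoint Fq L K) (n : ℤ) :
    Divisor.deg (Finsupp.single P n) = n :=
  Finsupp.sum_single_index rfl

theorem aeval_t_ne_zero [Algebra (RatFunc Fq) K] [IsScalarTower Fq (RatFunc Fq) K] {p : L[X]} (hp : p ≠ 0) :
    Polynomial.aeval (FunField.t Fq L K) p ≠ 0 :=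
  fun h => hp (transcendental_iff.1 (transcendental_t Fq L K) p h)

theorem mem_sections_add_single [Algebra (RatFunc Fq) K] {D : Divisor Fq L K} {P : ClosedPoint Fq L K} (hP : P ∈ affinePart)
    {f : FunField Fq L K} :
    f ∈ sections (D + Finsupp.single P 1) ↔
      f ∈ sections D ∧ P.val f < WithZero.exp (-(D P)) := by
  classical
  have hval : ∀ Q, (D + Finsupp.single P 1 : Divisor Fq L K) Q = D Q + if P = Q then 1 else 0 := fun Q => by
    rw [Finsupp.add_apply, Finsupp.single_apply]
  constructor
  · intro hf
    refine ⟨fun Q hQ => (hf Q hQ).trans (WithZero.exp_le_exp.2 ?_), ?_⟩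
    · rw [hval]; split_ifs <;> lia
    · have := hf P hP
      rw [hval, if_pos rfl] at this
      rw [lt_exp_iff_le_exp]
      convert this using 2
      lia
  · rintro ⟨hf, hfP⟩ Q hQ
    rw [hval]
    split_ifs with h
    · subst h
      rw [lt_exp_iff_le_exp] at hfP
      convert hfP using 2
      lia
    · simpa using hf Q hQ

variable [IsDomain (L ⊗[Fq] K)]

theorem ClosedPoint.isPlace (P : ClosedPoint Fq L K) : IsPlace L P.val :=
  ⟨P.val_const, P.surjective⟩

/-- The closed point given by a place. -/
def IsPlace.toClosedPoint {v : Valuation (FunField Fq L K) ℤᵐ⁰} (hv : IsPlace L v) :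
    ClosedPoint Fq L K :=
  ⟨v, hv.map_const, hv.surjective⟩

variable [Algebra (RatFunc Fq) K]

/-- `Γ(𝐔, 𝒪(-D))` as a vector space over `L`. -/
def sectionsSubmodule (D : Divisor Fq L K) : Submodule L (FunField Fq L K) where
  carrier := sections D
  zero_mem' P _ := by rw [map_zero]; exact zero_le
  add_mem' ha hb P hP := (P.val.map_add _ _).trans (max_le (ha P hP) (hb P hP))
  smul_mem' c f hf P hP := by
    rw [Algebra.smul_def, map_mul]
    exact (mul_le_mul' (P.isPlace.map_const_le c) (hf P hP)).trans (one_mul _).le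

variable [IsScalarTower Fq (RatFunc Fq) K] [FiniteDimensional (RatFunc Fq) K]
  [Algebra.IsSeparable (RatFunc Fq) K]

theorem val_aeval_t_le_one {P : ClosedPoint Fq L K} (hP : P ∈ affinePart) (p : L[X]) :
    P.val (Polynomial.aeval (FunField.t Fq L K) p) ≤ 1 :=
  ((isSeparatingElement_t Fq L K).mem_affineRing_iff _).1
    (Subalgebra.algebraMap_mem (integralClosure _ _)
      (⟨_, Polynomial.aeval_mem_adjoin_singleton L _⟩ : Algebra.adjoin L {FunField.t Fq L K}))
    P.val P.isPlace hP

variable [IsAlgClosed L]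

/-- Some nonzero polynomial in `t` vanishes to prescribed orders. -/
theorem exists_polynomial_le (D : Divisor Fq L K) :
    ∃ p : L[X], p ≠ 0 ∧ ∀ P : ClosedPoint Fq L K, P ∈ affinePart →
      P.val (Polynomial.aeval (FunField.t Fq L K) p) ≤ WithZero.exp (-(D P)) := by
  classical
  have hfactor : ∀ P : ClosedPoint Fq L K, P ∈ affinePart →
      ∃ p : L[X], p ≠ 0 ∧ P.val (Polynomial.aeval (FunField.t Fq L K) p) ≤ WithZero.exp (-(D P)) := by
    intro P hP
    obtain ⟨c, hc⟩ := P.isPlace.exists_const_sub_lt (isSeparatingElement_t Fq L K) hP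
    obtain ⟨n, hn⟩ := exists_pow_le_exp hc (-(D P))
    refine ⟨(Polynomial.X - Polynomial.C c) ^ n, pow_ne_zero _ (Polynomial.X_sub_C_ne_zero c), ?_⟩
    simpa using hn n le_rfl
  choose! p hp0 hp using hfactor
  refine ⟨∏ P ∈ D.support with P ∈ affinePart, p P, ?_, fun P hP => ?_⟩
  · exact Finset.prod_ne_zero_iff.2 fun P hP => hp0 P (Finset.mem_filter.1 hP).2
  · rw [map_prod, map_prod]
    by_cases hD : P ∈ D.support
    · rw [← Finset.mul_prod_erase _ _ (Finset.mem_filter.2 ⟨hD, hP⟩)]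
      refine (mul_le_mul' (hp P hP) (Finset.prod_le_one' fun Q _ => val_aeval_t_le_one hP _)).trans
        (mul_one _).le
    · rw [Finsupp.notMem_support_iff.1 hD, neg_zero, WithZero.exp_zero]
      exact Finset.prod_le_one' fun Q _ => val_aeval_t_le_one hP _

/-- A point of `𝐔` is not a base point of `𝒪(-D)`. -/
theorem exists_section_val_eq (D : Divisor Fq L K) {P : ClosedPoint Fq L K} (hP : P ∈ affinePart) :
    ∃ f ∈ sections D, P.val f = WithZero.exp (-(D P)) := by
  classical
  have hs := isSeparatingElement_t Fq L K
  -- With −D here, 1/c has order at most D(P) at P, so the order D(P) can be reached by multiplying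
  -- by a nonnegative power of a uniformizer.
  obtain ⟨p, hp0, hp⟩ := exists_polynomial_le (-D)
  set c := Polynomial.aeval (FunField.t Fq L K) p with hc
  have hc0 : c ≠ 0 := aeval_t_ne_zero hp0
  have hcA : c ∈ integralClosure (Algebra.adjoin L {FunField.t Fq L K}) (FunField Fq L K) :=
    (hs.mem_affineRing_iff c).2 fun v hv hvs =>
      val_aeval_t_le_one (P := hv.toClosedPoint) hvs p
  have hfin : {Q : ClosedPoint Fq L K | Q ∈ affinePart ∧ Q.val c < 1}.Finite :=
    Set.Finite.of_finite_image (f := ClosedPoint.val)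
      ((hs.finite_zeros hcA hc0).subset (by
        rintro _ ⟨Q, ⟨hQ, hQc⟩, rfl⟩
        exact ⟨Q.isPlace, hQ, hQc⟩))
      fun Q _ Q' _ h => ClosedPoint.ext h
  -- Away from P and T, D vanishes on U and c has no zeros there. A regular function a that is a
  -- unit at P and vanishes on T then repairs the finitely many remaining conditions when raised to
  -- a high power.
  let T : Finset (ClosedPoint Fq L K) :=
    ((D.support.filter (· ∈ affinePart)) ∪ hfin.toFinset).erase P
  have hTU : ∀ Q ∈ T, Q ∈ affinePart := by
    intro Q hQ
    rcases Finset.mem_union.1 (Finset.mem_of_mem_erase hQ) with h | h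
    · exact (Finset.mem_filter.1 h).2
    · exact (hfin.mem_toFinset.1 h).1
  have hsep : ∀ Q ∈ T, ∃ x ∈ integralClosure (Algebra.adjoin L {FunField.t Fq L K})
      (FunField Fq L K), P.val x = 1 ∧ Q.val x < 1 := fun Q hQ =>
    hs.exists_separating P.isPlace hP Q.isPlace (hTU Q hQ)
      fun h => (Finset.ne_of_mem_erase hQ) (ClosedPoint.ext h.symm)
  choose! x hxA hxP hxQ using hsep
  have hxle : ∀ Q ∈ T, ∀ R : ClosedPoint Fq L K, R ∈ affinePart → R.val (x Q) ≤ 1 :=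
    fun Q hQ R hR => (hs.mem_affineRing_iff _).1 (hxA Q hQ) R.val R.isPlace hR
  let a := ∏ Q ∈ T, x Q
  have haP : P.val a = 1 := by rw [map_prod]; exact Finset.prod_eq_one hxP
  have hale : ∀ R : ClosedPoint Fq L K, R ∈ affinePart → R.val a ≤ 1 := fun R hR => by
    rw [map_prod]; exact Finset.prod_le_one' fun Q hQ => hxle Q hQ R hR
  have haT : ∀ Q ∈ T, Q.val a < 1 := fun Q hQ => by
    rw [map_prod, ← Finset.mul_prod_erase _ _ hQ, mul_comm]
    exact (mul_le_of_le_one_left' (Finset.prod_le_one' fun R hR =>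
      hxle R (Finset.mem_of_mem_erase hR) Q (hTU Q hQ))).trans_lt (hxQ Q hQ)
  obtain ⟨π, hπA, hπ⟩ := hs.exists_uniformizer P.isPlace hP
  have hπle : ∀ R : ClosedPoint Fq L K, R ∈ affinePart → R.val π ≤ 1 :=
    fun R hR => (hs.mem_affineRing_iff _).1 hπA R.val R.isPlace hR
  obtain ⟨m, hm⟩ := exists_val_eq_exp P.val hc0
  have hm' : m ≤ D P := by
    have := hp P hP
    rw [hm, WithZero.exp_le_exp] at this
    simpa using this
  have hpow : ∀ Q : ClosedPoint Fq L K, ∃ n : ℕ, ∀ j ≥ n, Q ∈ T →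
      Q.val a ^ j ≤ Q.val c * WithZero.exp (-(D Q)) := by
    intro Q
    obtain ⟨r, hr⟩ := exists_val_eq_exp Q.val hc0
    by_cases hQ : Q ∈ T
    · obtain ⟨n, hn⟩ := exists_pow_le_exp (haT Q hQ) (r + -(D Q))
      refine ⟨n, fun j hj _ => ?_⟩
      rw [hr, ← WithZero.exp_add]
      exact hn j hj
    · exact ⟨0, fun _ _ h => absurd h hQ⟩
  choose n hn using hpow
  refine ⟨π ^ (D P - m).toNat * a ^ (T.sup n) / c, fun Q hQ => ?_, ?_⟩
  · have hc0' : Q.val c ≠ 0 := (Valuation.ne_zero_iff _).2 hc0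
    by_cases hQP : Q = P
    · subst hQP
      rw [map_div₀, map_mul, map_pow, map_pow, haP, one_pow, mul_one, hπ, hm,
        ← WithZero.exp_nsmul, ← WithZero.exp_sub, WithZero.exp_le_exp, nsmul_eq_mul,
        Int.toNat_of_nonneg (by lia)]
      lia
    rw [map_div₀, map_mul, map_pow, map_pow, div_le_iff₀ (zero_lt_iff.2 hc0'), mul_comm _ (Q.val c)]
    refine (mul_le_mul' (pow_le_one' (hπle Q hQ) _) le_rfl).trans ?_
    rw [one_mul]
    by_cases hQT : Q ∈ T
    · exact hn Q _ (Finset.le_sup hQT) hQT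
    · have hQ' : Q ∉ D.support.filter (· ∈ affinePart) ∪ hfin.toFinset := fun h =>
        hQT (Finset.mem_erase.2 ⟨hQP, h⟩)
      rw [Finset.notMem_union, hfin.mem_toFinset, Finset.mem_filter] at hQ'
      have hDQ : D Q = 0 := by
        by_contra h
        exact hQ'.1 ⟨Finsupp.mem_support_iff.2 h, hQ⟩
      have hcQ : 1 ≤ Q.val c := by
        by_contra h
        exact hQ'.2 ⟨hQ, not_le.1 h⟩
      rw [hDQ, neg_zero, WithZero.exp_zero, mul_one]
      exact (pow_le_one' (hale Q hQ) _).trans hcQ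
  · rw [map_div₀, map_mul, map_pow, map_pow, haP, one_pow, mul_one, hπ, hm,
      ← WithZero.exp_nsmul, ← WithZero.exp_sub, WithZero.exp_inj, nsmul_eq_mul,
      Int.toNat_of_nonneg (by lia)]
    lia

/-- The map is f ↦ (f/f₀)(P), where f₀ is a section of exact order D(P) at P. -/
theorem exists_linearMap_ker_single (D : Divisor Fq L K) {P : ClosedPoint Fq L K}
    (hP : P ∈ affinePart) :
    ∃ ψ : sectionsSubmodule D →ₗ[L] L, Function.Surjective ψ ∧
      ∀ f, ψ f = 0 ↔ (f : FunField Fq L K) ∈ sections (D + Finsupp.single P 1) := by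
  obtain ⟨f₀, hf₀, hf₀P⟩ := exists_section_val_eq D hP
  obtain ⟨e, he⟩ := P.isPlace.exists_residue (isSeparatingElement_t Fq L K)
  have h0 : f₀ ≠ 0 := fun h => WithZero.exp_ne_zero (hf₀P.symm.trans (by rw [h, map_zero]))
  have hle : ∀ f : sectionsSubmodule D, P.val (f / f₀) ≤ 1 := fun f => by
    rw [map_div₀, hf₀P]
    exact (div_le_one₀ WithZero.exp_pos).2 (f.2 P hP)
  let ψ : sectionsSubmodule D →ₗ[L] L :=
    { toFun := fun f => e ⟨f / f₀, hle f⟩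
      map_add' := fun f g => by
        rw [← map_add]
        congr 1
        ext
        simp [add_div]
      map_smul' := fun c f => by
        have hc : e ⟨algebraMap L (FunField Fq L K) c, P.isPlace.map_const_le c⟩ = c := by
          rw [he]; simp
        rw [RingHom.id_apply, smul_eq_mul]
        conv_rhs => rw [← hc]
        rw [← map_mul]
        congr 1
        ext
        simp [Algebra.smul_def, mul_div_assoc] }
  refine ⟨ψ, fun c => ⟨c • ⟨f₀, hf₀⟩, ?_⟩, fun f => ?_⟩
  · rw [map_smul, smul_eq_mul]
    have : ψ ⟨f₀, hf₀⟩ = 1 := (he _ _).2 (by simp [div_self h0])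
    rw [this, mul_one]
  · rw [mem_sections_add_single hP]
    refine (he _ _).trans ?_
    rw [map_zero, sub_zero, map_div₀, hf₀P, div_lt_one₀ WithZero.exp_pos]
    exact ⟨fun h => ⟨f.2, h⟩, fun h => h.2⟩

/-- `dim Γ(𝐔, 𝒪(-D)) / Γ(𝐔, 𝒪(-D-E)) = deg E` for an effective divisor `E` on `𝐔`. -/
theorem exists_linearMap_ker (D E : Divisor Fq L K) (hE : 0 ≤ E)
    (hEU : ∀ P ∈ E.support, P ∈ affinePart) :
    ∃ d : ℕ, (d : ℤ) = E.deg ∧ ∃ φ : sectionsSubmodule D →ₗ[L] (Fin d → L),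
      Function.Surjective φ ∧
        ∀ f, φ f = 0 ↔ (f : FunField Fq L K) ∈ sections (D + E) := by
  classical
  have hdeg : ∀ E : Divisor Fq L K, 0 ≤ E → 0 ≤ E.deg := fun E hE =>
    Finset.sum_nonneg fun P _ => hE P
  suffices ∀ d : ℕ, ∀ E : Divisor Fq L K, 0 ≤ E → (∀ P ∈ E.support, P ∈ affinePart) →
      (d : ℤ) = E.deg → ∃ φ : sectionsSubmodule D →ₗ[L] (Fin d → L), Function.Surjective φ ∧
        ∀ f, φ f = 0 ↔ (f : FunField Fq L K) ∈ sections (D + E) from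
    ⟨E.deg.toNat, Int.toNat_of_nonneg (hdeg E hE),
      this _ E hE hEU (Int.toNat_of_nonneg (hdeg E hE))⟩
  intro d
  induction d with
  | zero =>
    intro E hE _ hd
    have h0 : E = 0 := by
      ext P
      by_cases hP : P ∈ E.support
      · exact (Finset.sum_eq_zero_iff_of_nonneg fun P _ => hE P).1 hd.symm P hP
      · exact Finsupp.notMem_support_iff.1 hP
    refine ⟨0, fun x => ⟨0, Subsingleton.elim _ _⟩, fun f => ?_⟩
    rw [h0, add_zero]
    exact iff_of_true rfl f.2
  | succ d ih =>
    intro E hE hEU hd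
    obtain ⟨P, hP⟩ : E.support.Nonempty := by
      by_contra h
      rw [Finset.not_nonempty_iff_eq_empty, Finsupp.support_eq_empty] at h
      subst h
      change ((d + 1 : ℕ) : ℤ) = 0 at hd
      lia
    have hPE : 1 ≤ E P := lt_of_le_of_ne (hE P) (Finsupp.mem_support_iff.1 hP).symm
    let E' := E - Finsupp.single P 1
    have hEE' : E = E' + Finsupp.single P 1 := (sub_add_cancel _ _).symm
    have hE'val : ∀ Q, E' Q = E Q - if P = Q then 1 else 0 := fun Q => by
      rw [Finsupp.sub_apply, Finsupp.single_apply]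
    have hE' : 0 ≤ E' := fun Q => by
      change 0 ≤ E' Q
      rw [hE'val]
      split_ifs with h
      · subst h; lia
      · simpa using hE Q
    have hE'U : ∀ Q ∈ E'.support, Q ∈ affinePart := fun Q hQ => by
      rw [Finsupp.mem_support_iff, hE'val] at hQ
      by_cases h : P = Q
      · exact h ▸ hEU P hP
      · exact hEU Q (Finsupp.mem_support_iff.2 (by simpa [h] using hQ))
    have hd' : (d : ℤ) = E'.deg := by
      rw [hEE', Divisor.deg_add, Divisor.deg_single] at hd
      push_cast at hd
      lia
    obtain ⟨φ, hφ, hφk⟩ := ih E' hE' hE'U hd'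
    obtain ⟨ψ, hψ, hψk⟩ := exists_linearMap_ker_single (D + E') (hEU P hP)
    have hkφ : ∀ f : LinearMap.ker φ, ((f : sectionsSubmodule D) : FunField Fq L K) ∈
        sectionsSubmodule (D + E') := fun f => (hφk f).1 f.2
    -- The functional for the last point is defined only on ker φ = Γ(U, O(−D−E')); over a field it
    -- extends to all of Γ(U, O(−D)).
    obtain ⟨ψ', hψ'⟩ := (ψ ∘ₗ ((sectionsSubmodule D).subtype ∘ₗ
      (LinearMap.ker φ).subtype).codRestrict (sectionsSubmodule (D + E')) hkφ).exists_extend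
    have hψ'' : ∀ f (hf : φ f = 0), ψ' f = ψ ⟨f, (hφk f).1 hf⟩ := fun f hf =>
      congr($hψ' ⟨f, hf⟩)
    have hle : ∀ f : FunField Fq L K, f ∈ sections (D + E') → f ∈ sections D := fun f hf Q hQ =>
      (hf Q hQ).trans (WithZero.exp_le_exp.2 (by
        have : 0 ≤ E' Q := hE' Q
        rw [Finsupp.add_apply]; lia))
    refine ⟨LinearMap.pi (Fin.cons ψ' fun i => LinearMap.proj i ∘ₗ φ), fun y => ?_, fun f => ?_⟩
    · obtain ⟨x, hx⟩ := hφ (Fin.tail y)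
      obtain ⟨z, hz⟩ := hψ (y 0 - ψ' x)
      have hzk : φ ⟨z, hle z z.2⟩ = 0 := (hφk _).2 z.2
      refine ⟨x + ⟨z, hle z z.2⟩, ?_⟩
      ext i
      refine Fin.cases ?_ (fun i => ?_) i
      · simp [hψ'' _ hzk, hz]
      · simp [hzk, hx, Fin.tail]
    · rw [hEE', ← add_assoc]
      have h1 : (LinearMap.pi (Fin.cons ψ' fun i => LinearMap.proj i ∘ₗ φ) :
          sectionsSubmodule D →ₗ[L] (Fin (d + 1) → L)) f = 0 ↔ ψ' f = 0 ∧ φ f = 0 := by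
        rw [funext_iff, Fin.forall_fin_succ, funext_iff]
        simp
      rw [h1]
      constructor
      · rintro ⟨ha, hb⟩
        rw [hψ'' f hb] at ha
        exact (hψk _).1 ha
      · intro hf
        have hb : φ f = 0 := (hφk f).2 ((mem_sections_add_single (hEU P hP)).1 hf).1
        exact ⟨by rw [hψ'' f hb]; exact (hψk _).2 hf, hb⟩

end Sections

end CMMotive

namespace CMMotive

open scoped TensorProduct Polynomial IntermediateField WithZero
open IntermediateField.algebraAdjoinAdjoin

/-! ### Modules commensurable with the integral closure -/

section Commensurable

variable {k F : Type*} [Field k] [Field F] [Algebra k F]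

/-- A `k[s]`-submodule of `F` that is commensurable with the integral closure of `k[s]` is free of
rank `[F : k(s)]`. -/
theorem IsSeparatingElement.exists_basis_of_commensurable {s : F} (hs : IsSeparatingElement k s)
    {N : Type*} [AddCommGroup N] [Module k[X] N] (j : N →+ F) (hj : Function.Injective j)
    (hsmul : ∀ (p : k[X]) (x : N), j (p • x) = Polynomial.aeval s p * j x)
    {p q : k[X]} (hp0 : p ≠ 0) (hq0 : q ≠ 0)
    (hp : ∀ x, Polynomial.aeval s p * j x ∈ integralClosure (Algebra.adjoin k {s}) F)
    (hq : ∀ a ∈ integralClosure (Algebra.adjoin k {s}) F, ∃ x, j x = Polynomial.aeval s q * a) :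
    Nonempty (Module.Basis (Fin (Module.finrank k⟮s⟯ F)) k[X] N) := by
  have := hs.isPrincipalIdealRing
  have := hs.finite
  have := hs.separable
  have hfree : Module.Free (Algebra.adjoin k {s}) (affineRing k s) :=
    IsIntegralClosure.module_free _ k⟮s⟯ F _
  have hfin : Module.Finite (Algebra.adjoin k {s}) (affineRing k s) :=
    IsIntegralClosure.finite _ k⟮s⟯ F _
  have hrank : Module.finrank (Algebra.adjoin k {s}) (affineRing k s) = Module.finrank k⟮s⟯ F :=
    IsIntegralClosure.rank _ k⟮s⟯ F _
  have hne : ∀ {r : k[X]}, r ≠ 0 → Polynomial.aeval s r ≠ 0 := fun hr h =>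
    hr (transcendental_iff.1 hs.transcendental _ h)
  let e : k[X] ≃ₐ[k] Algebra.adjoin k {s} :=
    Polynomial.algEquivOfTranscendental k s hs.transcendental
  have he : ∀ p, (e p : F) = Polynomial.aeval s p := fun p => by
    simp [e, Polynomial.algEquivOfTranscendental]
  let _ : Module k[X] (affineRing k s) := Module.compHom _ (e : k[X] →+* Algebra.adjoin k {s})
  have hsmulA : ∀ (p : k[X]) (a : affineRing k s),
      ((p • a : affineRing k s) : F) = Polynomial.aeval s p * a := fun p a => by
    rw [← he]; rfl
  let b : Module.Basis (Fin (Module.finrank k⟮s⟯ F)) k[X] (affineRing k s) :=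
    (Module.finBasisOfFinrankEq _ _ hrank).mapCoeffs e.symm.toRingEquiv fun c x => by
      change e (e.symm c) • x = c • x
      rw [AlgEquiv.apply_symm_apply]
  let f : N →ₗ[k[X]] affineRing k s :=
    { toFun := fun x => ⟨_, hp x⟩
      map_add' := fun x y => Subtype.ext (by
        change Polynomial.aeval s p * j (x + y) = Polynomial.aeval s p * j x +
          Polynomial.aeval s p * j y
        rw [map_add, mul_add])
      map_smul' := fun r x => Subtype.ext (by
        rw [RingHom.id_apply, hsmulA]
        change Polynomial.aeval s p * j (r • x) =
          Polynomial.aeval s r * (Polynomial.aeval s p * j x)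
        rw [hsmul]; ring) }
  have hf : Function.Injective f := fun x y hxy =>
    hj (mul_left_cancel₀ (hne hp0) congr(($hxy : F)))
  choose g hg using fun a : affineRing k s => hq a a.2
  let g' : affineRing k s →ₗ[k[X]] N :=
    { toFun := g
      map_add' := fun x y => hj (by
        rw [map_add, hg, hg, hg, ← mul_add]; rfl)
      map_smul' := fun r x => hj (by
        rw [RingHom.id_apply, hsmul, hg, hg, hsmulA]; ring) }
  have hg' : Function.Injective g' := fun x y hxy => by
    have h := (hg x).symm.trans ((congrArg j hxy).trans (hg y))
    exact Subtype.ext (mul_left_cancel₀ (hne hq0) h)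
  -- Multiplication by p(s) embeds N in a free module over the principal ideal domain k[X], so N is
  -- free. Multiplication by q(s) embeds that module back in N, so the ranks agree.
  obtain ⟨n, ⟨bn⟩⟩ := Submodule.nonempty_basis_of_pid b (LinearMap.range f)
  let bN : Module.Basis (Fin n) k[X] N := bn.map (LinearEquiv.ofInjective f hf).symm
  have := Module.Finite.of_basis b
  have := Module.Finite.of_basis bN
  have h1 := LinearMap.finrank_le_finrank_of_injective hf
  have h2 := LinearMap.finrank_le_finrank_of_injective hg'
  rw [Module.finrank_eq_card_basis b, Module.finrank_eq_card_basis bN, Fintype.card_fin,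
    Fintype.card_fin] at h1 h2
  obtain rfl := le_antisymm h1 h2
  exact ⟨bN⟩

end Commensurable

/-! ### Freeness over L[t] -/

section FreeOverT

variable {Fq L K : Type*} [Field Fq] [Field L] [IsAlgClosed L] [Field K] [Algebra Fq L]
  [Algebra Fq K] [IsDomain (L ⊗[Fq] K)] [Algebra (RatFunc Fq) K] [IsScalarTower Fq (RatFunc Fq) K]
  [FiniteDimensional (RatFunc Fq) K] [Algebra.IsSeparable (RatFunc Fq) K]

/-- `Γ(𝐔, 𝒪(-D))` is free of rank `[K : 𝔽_q(t)]` over `L[t]`. -/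
theorem exists_poly_basis (D : Divisor Fq L K) {N : Type*} [AddCommGroup N] [Module L[X] N]
    (j : N →+ FunField Fq L K) (hj : Function.Injective j)
    (hsmul : ∀ (p : L[X]) (x : N),
      j (p • x) = Polynomial.aeval (FunField.t Fq L K) p * j x)
    (hrange : ∀ f, f ∈ sections D ↔ f ∈ Set.range j) :
    Nonempty (Module.Basis (Fin (Module.finrank (RatFunc Fq) K)) L[X] N) := by
  have hs := isSeparatingElement_t Fq L K
  -- p(t) clears the poles on U that D allows; q(t) below forces regular functions to satisfy the
  -- vanishing that D demands.
  obtain ⟨p, hp0, hp⟩ := exists_polynomial_le (-D)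
  obtain ⟨q, hq0, hq⟩ := exists_polynomial_le D
  rw [← finrank_funField Fq L K]
  refine hs.exists_basis_of_commensurable j hj hsmul hp0 hq0 (fun x => ?_) fun a ha => ?_
  · rw [hs.mem_affineRing_iff]
    intro v hv hvs
    have h1 := hp hv.toClosedPoint hvs
    have h2 := (hrange _).2 ⟨x, rfl⟩ hv.toClosedPoint hvs
    rw [map_mul]
    refine (mul_le_mul' h1 h2).trans ?_
    rw [← WithZero.exp_add, Finsupp.neg_apply, neg_neg, add_neg_cancel, WithZero.exp_zero]
  · exact (hrange _).1 fun P hP => by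
      rw [map_mul]
      exact (mul_le_mul' (hq P hP) ((hs.mem_affineRing_iff _).1 ha _ P.isPlace hP)).trans
        (mul_one _).le

end FreeOverT

/-! ### Growth of sums along Frobenius orbits -/

section Orbits

/-- If every orbit of `T` in the finite `T`-stable set `S` meets the positive locus of `f`, then
the sums of `f` over orbit segments in `S` tend to infinity uniformly. -/
theorem exists_le_sum_iterate {α : Type*} (T : Equiv.Perm α) {S : Set α} (hS : S.Finite)
    (hT : ∀ x ∈ S, T x ∈ S) (f : α → ℤ) (hf : ∀ x, 0 ≤ f x)
    (hpos : ∀ x ∈ S, ∃ i : ℕ, 0 < f ((T ^ i) x)) (B : ℕ) :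
    ∃ N : ℕ, ∀ n ≥ N, ∀ x ∈ S, (B : ℤ) ≤ ∑ i ∈ Finset.range n, f ((T ^ i) x) := by
  classical
  choose! i hi using hpos
  have hpow : ∀ (n : ℕ), ∀ x ∈ S, (T ^ n) x ∈ S := by
    intro n
    induction n with
    | zero => intro x hx; simpa using hx
    | succ n ih => intro x hx; rw [pow_succ', Equiv.Perm.mul_apply]; exact hT _ (ih x hx)
  -- Any r consecutive iterates contribute at least 1, so a segment of length B * r, cut into B
  -- blocks, contributes at least B.
  let r := hS.toFinset.sup i + 1
  have hr : ∀ x ∈ S, 1 ≤ ∑ j ∈ Finset.range r, f ((T ^ j) x) := by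
    intro x hx
    have hmem : i x ∈ Finset.range r :=
      Finset.mem_range.2 (Nat.lt_succ_of_le (Finset.le_sup (hS.mem_toFinset.2 hx)))
    exact (hi x hx).trans_le
      (Finset.single_le_sum (f := fun j => f ((T ^ j) x)) (fun j _ => hf _) hmem)
  refine ⟨B * r, fun n hn x hx => ?_⟩
  refine le_trans ?_ (Finset.sum_le_sum_of_subset_of_nonneg
    (Finset.range_subset_range.2 hn) fun j _ _ => hf _)
  clear hn n
  induction B with
  | zero => simp
  | succ B ih =>
    rw [Nat.succ_mul, Finset.sum_range_add]
    have h := hr _ (hpow (B * r) x hx)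
    simp only [← Equiv.Perm.mul_apply, ← pow_add] at h
    rw [Nat.cast_succ]
    have h' : ∑ j ∈ Finset.range r, f ((T ^ (B * r + j)) x) =
        ∑ j ∈ Finset.range r, f ((T ^ (j + B * r)) x) := by simp_rw [add_comm]
    rw [h']
    linarith

variable {α : Type*} (T : Equiv.Perm α) (f : α → ℤ)

/-- A sequence of divisors with `E (n + 1) x = E n (T x) + f x` and `E m = 0`. -/
def orbitDivisor (m n : ℕ) (x : α) : ℤ :=
  ∑ i ∈ Finset.range n, f ((T ^ ((i : ℤ) - m)) x) - ∑ i ∈ Finset.range m, f ((T ^ ((i : ℤ) - m)) x)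

/-- Evaluating at T x shifts the two index ranges: the first sum lacks the term i = 0, the second
gains the term i = m. The two terms at 0 cancel and f x is what remains. -/
theorem orbitDivisor_succ (m n : ℕ) (x : α) :
    orbitDivisor T f m (n + 1) x = orbitDivisor T f m n (T x) + f x := by
  have h : ∀ i : ℕ, f ((T ^ ((i : ℤ) - m)) (T x)) = f ((T ^ (((i + 1 : ℕ) : ℤ) - m)) x) := by
    intro i
    rw [← Equiv.Perm.mul_apply, ← zpow_add_one]
    congr 3
    push_cast
    ring
  have h1 := Finset.sum_range_succ' (fun i : ℕ => f ((T ^ ((i : ℤ) - m)) x)) n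
  have h2 := Finset.sum_range_succ' (fun i : ℕ => f ((T ^ ((i : ℤ) - m)) x)) m
  have h3 := Finset.sum_range_succ (fun i : ℕ => f ((T ^ ((i : ℤ) - m)) x)) m
  rw [sub_self, zpow_zero, Equiv.Perm.one_apply] at h3
  rw [orbitDivisor, orbitDivisor]
  simp only [h]
  linarith

theorem orbitDivisor_mono (hf : ∀ x, 0 ≤ f x) (m : ℕ) (x : α) :
    Monotone fun n => orbitDivisor T f m n x := by
  refine monotone_nat_of_le_succ fun n => ?_
  simp only [orbitDivisor, Finset.sum_range_succ]
  linarith [hf ((T ^ ((n : ℤ) - m)) x)]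

theorem sum_orbit_shift (m n : ℕ) (x : α) :
    ∑ i ∈ Finset.range n, f ((T ^ ((i : ℤ) - m)) x) =
      ∑ i ∈ Finset.range n, f ((T ^ i) ((T ^ (-m : ℤ)) x)) := by
  refine Finset.sum_congr rfl fun i _ => ?_
  rw [← Equiv.Perm.mul_apply, ← zpow_natCast, ← zpow_add, sub_eq_add_neg]

end Orbits

end CMMotive

namespace CMMotive

open scoped TensorProduct Polynomial IntermediateField WithZero

/-! ### Sections near t = θ and at infinity -/

section Sections

variable {Fq L K : Type*} [Field Fq] [Field L] [Field K] [Algebra Fq L] [Algebra Fq K]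
  [Algebra (RatFunc Fq) K]

theorem sections_add_le {D E : Divisor Fq L K} (hE : 0 ≤ E) : sections (D + E) ⊆ sections D :=
  fun f hf P hP => (hf P hP).trans (WithZero.exp_le_exp.2 (by
    have : 0 ≤ E P := hE P
    rw [Finsupp.add_apply]; lia))

variable [IsDomain (L ⊗[Fq] K)]

theorem pointsAboveTheta_subset [Algebra (RatFunc Fq) L] :
    pointsAboveTheta Fq L K ⊆ affinePart := by
  intro P hP
  set θ := algebraMap (RatFunc Fq) L RatFunc.X
  have h1 : P.val (FunField.t Fq L K - FunField.const Fq K θ) < 1 := hP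
  have h2 : FunField.t Fq L K =
    (FunField.t Fq L K - FunField.const Fq K θ) + FunField.const Fq K θ := by ring
  change P.val (FunField.t Fq L K) ≤ 1
  rw [h2]
  exact (P.val.map_add _ _).trans (max_le h1.le (P.isPlace.map_const_le θ))

/-- t − θ vanishes on the support of Ξ, so the largest multiplicity of Ξ is a sufficient exponent.
This gives the nilpotence of t − θ on M/σM. -/
theorem exists_pow_mul_mem_sections [Algebra (RatFunc Fq) L] {D Ξ : Divisor Fq L K}
    (hΞθ : ↑Ξ.support ⊆ pointsAboveTheta Fq L K) :
    ∃ n : ℕ, ∀ f ∈ sections D,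
      (FunField.t Fq L K - FunField.const Fq K (algebraMap (RatFunc Fq) L RatFunc.X)) ^ n * f ∈
        sections (D + Ξ) := by
  refine ⟨Ξ.support.sup fun P => (Ξ P).toNat, fun f hf P hP => ?_⟩
  set n := Ξ.support.sup fun P => (Ξ P).toNat
  set g := FunField.t Fq L K - FunField.const Fq K (algebraMap (RatFunc Fq) L RatFunc.X) with hg
  have hle : P.val g ≤ 1 :=
    (P.val.map_sub _ _).trans (max_le hP (P.isPlace.map_const_le _))
  rw [map_mul, map_pow]
  have hpow : P.val g ^ n ≤ WithZero.exp (-(Ξ P)) := by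
    by_cases hΞP : P ∈ Ξ.support
    · have hlt : P.val g < WithZero.exp 0 := hΞθ hΞP
      rw [lt_exp_iff_le_exp] at hlt
      refine (pow_le_pow_left' hlt n).trans ?_
      rw [← WithZero.exp_nsmul, WithZero.exp_le_exp, nsmul_eq_mul]
      have h1 : (Ξ P).toNat ≤ n := Finset.le_sup (f := fun P => (Ξ P).toNat) hΞP
      lia
    · rw [Finsupp.notMem_support_iff.1 hΞP, neg_zero, WithZero.exp_zero]
      exact pow_le_one' hle n
  refine (mul_le_mul' hpow (hf P hP)).trans ?_
  rw [← WithZero.exp_add, Finsupp.add_apply, WithZero.exp_le_exp]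
  lia

variable [IsScalarTower Fq (RatFunc Fq) K] [FiniteDimensional (RatFunc Fq) K]
  [Algebra.IsSeparable (RatFunc Fq) K]

-- The poles of t are zeros of t⁻¹, which is separating and regular in its own chart.
variable (Fq L K) in
theorem finite_compl_affinePart : (affinePart : Set (ClosedPoint Fq L K))ᶜ.Finite := by
  have hs := (isSeparatingElement_t Fq L K).inv
  refine Set.Finite.of_finite_image (f := ClosedPoint.val)
    ((hs.finite_zeros (self_mem_affineRing _) hs.ne_zero).subset ?_)
    fun Q _ Q' _ h => ClosedPoint.ext h
  rintro _ ⟨Q, hQ, rfl⟩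
  have : 1 < Q.val (FunField.t Fq L K) := not_le.1 hQ
  have hlt : Q.val (FunField.t Fq L K)⁻¹ < 1 := by
    rw [map_inv₀]; exact inv_lt_one_of_one_lt₀ this
  exact ⟨Q.isPlace, hlt.le, hlt⟩

variable [IsAlgClosed L]

variable (Fq L K) in
theorem nonempty_compl_affinePart : (affinePart : Set (ClosedPoint Fq L K))ᶜ.Nonempty := by
  by_contra hne
  rw [Set.not_nonempty_iff_eq_empty, Set.compl_empty_iff] at hne
  obtain ⟨c, hc⟩ := (isSeparatingElement_t Fq L K).mem_range_of_forall_le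
    (x := FunField.t Fq L K) fun v hv => by
      have : hv.toClosedPoint ∈ (affinePart : Set (ClosedPoint Fq L K)) := hne ▸ Set.mem_univ _
      exact this
  exact transcendental_t Fq L K (hc ▸ isAlgebraic_algebraMap c)

/-- A section of `𝒪(-D)` on `𝐔` that vanishes to high order at all points at infinity is zero. -/
theorem exists_bound_forall_eq_zero (D : Divisor Fq L K) :
    ∃ B : ℤ, ∀ f ∈ sections D,
      (∀ P : ClosedPoint Fq L K, P ∉ affinePart → P.val f ≤ WithZero.exp (-B)) → f = 0 := by
  obtain ⟨p, hp0, hp⟩ := exists_polynomial_le (-D)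
  set c := Polynomial.aeval (FunField.t Fq L K) p
  have hc0 : c ≠ 0 := aeval_t_ne_zero hp0
  choose n hn using fun P : ClosedPoint Fq L K => exists_val_eq_exp P.val hc0
  have hS := finite_compl_affinePart Fq L K
  obtain ⟨B, hB⟩ := (hS.image n).bddAbove
  -- The extra 1 makes c f vanish strictly at infinity. Then c f has no poles at all, so it is
  -- constant, and its zero at a point at infinity makes it 0.
  refine ⟨B + 1, fun f hf hfS => ?_⟩
  have hlt : ∀ P : ClosedPoint Fq L K, P ∉ affinePart → P.val (c * f) < 1 := fun P hP => by
    rw [map_mul, hn]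
    refine (mul_le_mul' le_rfl (hfS P hP)).trans_lt ?_
    rw [← WithZero.exp_add, ← WithZero.exp_zero, WithZero.exp_lt_exp]
    have := hB ⟨P, hP, rfl⟩
    lia
  obtain ⟨a, ha⟩ := (isSeparatingElement_t Fq L K).mem_range_of_forall_le (x := c * f)
    fun v hv => by
      by_cases hU : hv.toClosedPoint ∈ (affinePart : Set (ClosedPoint Fq L K))
      · have h1 := hp _ hU
        have h2 := hf _ hU
        rw [map_mul]
        refine (mul_le_mul' h1 h2).trans ?_
        rw [← WithZero.exp_add, Finsupp.neg_apply, neg_neg, add_neg_cancel, WithZero.exp_zero]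
      · exact (hlt hv.toClosedPoint hU).le
  obtain ⟨P, hP⟩ := nonempty_compl_affinePart Fq L K
  have ha0 : a = 0 := by
    by_contra hne
    have h1 := hlt P hP
    rw [← ha, P.isPlace.map_const a hne] at h1
    exact lt_irrefl _ h1
  rw [ha0, map_zero] at ha
  exact (mul_eq_zero.1 ha.symm).resolve_left hc0

end Sections

/-! ### The action of σ on sections and the construction of M -/

section Motive

variable {Fq L K : Type*} [Field Fq] [Fintype Fq] [Field L] [IsAlgClosed L] [Field K] [Algebra Fq L]
  [Algebra Fq K]

theorem ClosedPoint.twist_val (P : ClosedPoint Fq L K) (f : FunField Fq L K) :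
    (ClosedPoint.twist P).val f = P.val ((CMMotive.twist Fq L K).symm f) := rfl

theorem Divisor.twist_apply (D : Divisor Fq L K) (P : ClosedPoint Fq L K) :
    D.twist (ClosedPoint.twist P) = D P := by
  simp [Divisor.twist, Finsupp.equivMapDomain_apply]

theorem val_sigma {Ξ W : Divisor Fq L K} {I : ClosedPoint Fq L K → ℤ} {h : FunField Fq L K}
    (hh : HasDivisor h fun P => W.twist P - W P + Ξ P - I P)
    (P : ClosedPoint Fq L K) (f : FunField Fq L K) :
    P.val (h * (twist Fq L K).symm f) =
      WithZero.exp (-(W.twist P - W P + Ξ P - I P)) * (ClosedPoint.twist P).val f := by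
  rw [map_mul, hh.2 P, ClosedPoint.twist_val]

theorem val_sigma_le_iff {Ξ W : Divisor Fq L K} {I : ClosedPoint Fq L K → ℤ} {h : FunField Fq L K}
    (hh : HasDivisor h fun P => W.twist P - W P + Ξ P - I P)
    (P : ClosedPoint Fq L K) (f : FunField Fq L K) (n : ℤ) :
    P.val (h * (twist Fq L K).symm f) ≤ WithZero.exp n ↔
      (ClosedPoint.twist P).val f ≤ WithZero.exp (n + (W.twist P - W P + Ξ P - I P)) := by
  rw [val_sigma hh, WithZero.exp_neg, inv_mul_le_iff₀ WithZero.exp_pos, ← WithZero.exp_add,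
    add_comm]

variable [Algebra (RatFunc Fq) K]

/-- t has coefficients in 𝔽_q, so the twist fixes it. -/
theorem twist_mem_affinePart_iff {P : ClosedPoint Fq L K} :
    ClosedPoint.twist P ∈ affinePart ↔ P ∈ affinePart := by
  change P.val ((CMMotive.twist Fq L K).symm (FunField.ofBase Fq L _)) ≤ 1 ↔ _
  rw [twist_symm_ofBase]
  rfl

theorem zpow_twist_mem_affinePart_iff {P : ClosedPoint Fq L K} (n : ℤ) :
    ((ClosedPoint.twist : Equiv.Perm (ClosedPoint Fq L K)) ^ n) P ∈ affinePart ↔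
      P ∈ affinePart := by
  induction n generalizing P with
  | zero => simp
  | succ n ih => rw [zpow_add_one, Equiv.Perm.mul_apply, ih, twist_mem_affinePart_iff]
  | pred n ih =>
    rw [zpow_sub_one, Equiv.Perm.mul_apply, ih,
      ← twist_mem_affinePart_iff (P := (ClosedPoint.twist : Equiv.Perm _)⁻¹ P),
      ← Equiv.Perm.mul_apply, mul_inv_cancel, Equiv.Perm.one_apply]

section Smul

variable (h : FunField Fq L K)

theorem TwistedFunField.poly_smul (p : L[X]) (f : FunField Fq L K) :
    polyToTSigma Fq L p • of h f = of h (Polynomial.aeval (FunField.t Fq L K) p * f) := by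
  induction p using Polynomial.induction_on generalizing f with
  | C a => rw [const_smul, Polynomial.aeval_C, algebraMap_eq_const]
  | add p q hp hq => 
    rw [map_add, add_smul, hp, hq, map_add, add_mul]
    exact ((of h).map_add _ _).symm
  | monomial n a ih =>
    rw [pow_succ, ← mul_assoc, map_mul, mul_smul, t_smul, ih, map_mul (Polynomial.aeval _) _ .X,
      Polynomial.aeval_X, mul_assoc]

theorem TwistedFunField.sigma_const_smul (c : L) (f : FunField Fq L K) :
    sigmaToTSigma Fq L (SigmaRing.const Fq c) • of h f = of h (FunField.const Fq K c * f) := by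
  rw [← const_smul, polyToTSigma, Polynomial.coe_mapRingHom, Polynomial.map_C]
  rfl

theorem TwistedFunField.smul_mem_of_forall {N : Set (FunField Fq L K)} (h0 : (0 : FunField Fq L K) ∈ N)
    (hadd : ∀ f ∈ N, ∀ g ∈ N, f + g ∈ N) (hc : ∀ (c : L), ∀ f ∈ N, FunField.const Fq K c * f ∈ N)
    (ht : ∀ f ∈ N, FunField.t Fq L K * f ∈ N)
    (hσ : ∀ f ∈ N, h * (twist Fq L K).symm f ∈ N) (a : TSigmaRing Fq L) (x : TwistedFunField h)
    (hx : (of h).symm x ∈ N) : (of h).symm (a • x) ∈ N := by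
  have hsum : ∀ (n : ℕ) (g : ℕ → TwistedFunField h), (∀ i, (of h).symm (g i) ∈ N) →
      (of h).symm (∑ i ∈ Finset.range n, g i) ∈ N := by
    intro n g hg
    induction n with
    | zero => simpa using h0
    | succ n ih => rw [Finset.sum_range_succ, map_add]; exact hadd _ ih _ (hg n)
  have hσpow : ∀ (n : ℕ) (x : TwistedFunField h), (of h).symm x ∈ N →
      (of h).symm (sigmaToTSigma Fq L (SigmaRing.σ Fq L ^ n) • x) ∈ N := by
    intro n
    induction n with
    | zero => intro x hx; simpa using hx
    | succ n ih =>
      intro x hx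
      rw [pow_succ, map_mul, mul_smul]
      refine ih _ ?_
      have := σ_smul h ((of h).symm x)
      rw [AddEquiv.apply_symm_apply] at this
      rw [this, AddEquiv.symm_apply_apply]
      exact hσ _ hx
  have hsigma : ∀ (a : SigmaRing Fq L) (x : TwistedFunField h), (of h).symm x ∈ N →
      (of h).symm (sigmaToTSigma Fq L a • x) ∈ N := by
    intro a x hx
    obtain ⟨c, n, hcn⟩ := SigmaRing.exists_eq_sum a
    rw [hcn n le_rfl, map_sum, Finset.sum_smul]
    refine hsum n _ fun i => ?_
    rw [map_mul, mul_smul]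
    have := sigma_const_smul h (c i) ((of h).symm (sigmaToTSigma Fq L (SigmaRing.σ Fq L ^ i) • x))
    rw [AddEquiv.apply_symm_apply] at this
    rw [this, AddEquiv.symm_apply_apply]
    exact hc _ _ (hσpow i x hx)
  induction a using Polynomial.induction_on generalizing x with
  | C a => exact hsigma a x hx
  | add p q hp hq => rw [add_smul, map_add]; exact hadd _ (hp x hx) _ (hq x hx)
  | monomial n a ih =>
    rw [pow_succ, ← mul_assoc, mul_smul]
    refine ih _ ?_
    have := t_smul h ((of h).symm x)
    rw [polyToTSigma, Polynomial.coe_mapRingHom, Polynomial.map_X, AddEquiv.apply_symm_apply] at this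
    rw [this, AddEquiv.symm_apply_apply]
    exact ht _ hx

end Smul

section SigmaSections

variable {Ξ W : Divisor Fq L K} {I : ClosedPoint Fq L K → ℤ} {h : FunField Fq L K}

/-- At P the order condition W^{(1)} + Ξ on σf turns into order at least W(P) at P^{(1)}, and W(P) =
W^{(1)}(P^{(1)}). This is the reason for using W^{(1)}, and not W, in M. -/
theorem sigma_mem_sections_iff (hh : HasDivisor h fun P => W.twist P - W P + Ξ P - I P)
    (hIU : ∀ P ∈ affinePart, I P = 0) (f : FunField Fq L K) :
    h * (twist Fq L K).symm f ∈ sections (W.twist + Ξ) ↔ f ∈ sections W.twist := by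
  constructor
  · intro hf P hP
    obtain ⟨Q, rfl⟩ := ClosedPoint.twist.surjective P
    have hQ := twist_mem_affinePart_iff.1 hP
    have := (val_sigma_le_iff hh Q f _).1 (hf Q hQ)
    rw [hIU Q hQ, Finsupp.add_apply] at this
    rw [Divisor.twist_apply]
    convert this using 2
    ring
  · intro hf P hP
    rw [val_sigma_le_iff hh]
    have := hf _ (twist_mem_affinePart_iff.2 hP)
    rw [Divisor.twist_apply] at this
    rw [hIU P hP, Finsupp.add_apply]
    convert this using 2
    ring

theorem exists_eq_sigma [IsDomain (L ⊗[Fq] K)]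
    (hh : HasDivisor h fun P => W.twist P - W P + Ξ P - I P)
    (hIU : ∀ P ∈ affinePart, I P = 0) {f : FunField Fq L K} (hf : f ∈ sections (W.twist + Ξ)) :
    ∃ y ∈ sections W.twist, f = h * (twist Fq L K).symm y := by
  have hy : f = h * (twist Fq L K).symm (twist Fq L K (f / h)) := by
    rw [RingEquiv.symm_apply_apply]
    exact (mul_div_cancel₀ _ hh.1).symm
  refine ⟨_, ?_, hy⟩
  rw [← sigma_mem_sections_iff hh hIU, ← hy]
  exact hf

end SigmaSections

variable [IsDomain (L ⊗[Fq] K)]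

variable [IsScalarTower Fq (RatFunc Fq) K] [FiniteDimensional (RatFunc Fq) K]
  [Algebra.IsSeparable (RatFunc Fq) K]

set_option maxHeartbeats 800000 in
/-- The main construction, for a divisor `I` at infinity that meets all Frobenius orbits. -/
theorem exists_motive [Algebra (RatFunc Fq) L] {Ξ W : Divisor Fq L K} {I : ClosedPoint Fq L K → ℤ}
    {h : FunField Fq L K} (hh : HasDivisor h fun P => W.twist P - W P + Ξ P - I P)
    (hΞ : 0 ≤ Ξ) (hΞθ : ↑Ξ.support ⊆ pointsAboveTheta Fq L K)
    (hI : ∀ P, 0 ≤ I P) (hIU : ∀ P ∈ affinePart, I P = 0)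
    (hIS : ∀ P ∉ affinePart,
      ∃ i : ℕ, 0 < I (((ClosedPoint.twist : Equiv.Perm (ClosedPoint Fq L K)) ^ i) P)) :
    ∃ M : Submodule (TSigmaRing Fq L) (TwistedFunField h),
      (∀ f, TwistedFunField.of h f ∈ M ↔ f ∈ sections W.twist) ∧
      IsDualTMotive Fq L M ∧
      IsFreeOfRankOverT Fq L M (Module.finrank (RatFunc Fq) K) ∧
      ∃ d : ℕ, (d : ℤ) = Ξ.deg ∧ IsFreeOfRankOverSigma Fq L M d := by
  classical
  have hh0 : h ≠ 0 := hh.1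
  have hΞU : ∀ P ∈ Ξ.support, P ∈ affinePart := fun P hP => pointsAboveTheta_subset (hΞθ hP)
  have hΞS : ∀ P ∉ affinePart, Ξ P = 0 := fun P hP =>
    Finsupp.notMem_support_iff.1 fun h => hP (hΞU P h)
  have hσmem : ∀ f ∈ sections W.twist, h * (twist Fq L K).symm f ∈ sections W.twist :=
    fun f hf => sections_add_le hΞ ((sigma_mem_sections_iff hh hIU f).2 hf)
  let N := sectionsSubmodule W.twist
  let M : Submodule (TSigmaRing Fq L) (TwistedFunField h) :=
    { carrier := {x | (TwistedFunField.of h).symm x ∈ sections W.twist}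
      zero_mem' := N.zero_mem
      add_mem' := fun {x y} hx hy => N.add_mem hx hy
      smul_mem' := fun a x hx => TwistedFunField.smul_mem_of_forall h N.zero_mem
        (fun f hf g hg => N.add_mem hf hg)
        (fun c f hf => by
          have := N.smul_mem c hf
          rwa [Algebra.smul_def] at this)
        (fun f hf P hP => by
          rw [map_mul]
          exact (mul_le_mul' hP (hf P hP)).trans (one_mul _).le)
        hσmem a x hx }
  have hfreeT : IsFreeOfRankOverT Fq L M (Module.finrank (RatFunc Fq) K) := by
    let _ : Module L[X] M := Module.compHom M (polyToTSigma Fq L)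
    exact exists_poly_basis W.twist
      ((TwistedFunField.of h).symm.toAddMonoidHom.comp M.subtype.toAddMonoidHom)
      Subtype.val_injective (fun p x => TwistedFunField.poly_smul h p x.1)
      fun f => ⟨fun hf => ⟨⟨TwistedFunField.of h f, hf⟩, rfl⟩, by rintro ⟨x, rfl⟩; exact x.2⟩
  obtain ⟨d, hd, φ, hφ, hφk⟩ := exists_linearMap_ker W.twist Ξ hΞ hΞU
  have hfreeσ : IsFreeOfRankOverSigma Fq L M d := by
    let _ : Module (SigmaRing Fq L) M := Module.compHom M (sigmaToTSigma Fq L)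
    let _ : Module L M := Module.compHom M ((sigmaToTSigma Fq L).comp (SigmaRing.const Fq))
    have hsmul : ∀ (c : L) (x : M), (TwistedFunField.of h).symm (c • x : M).1 =
        c • (TwistedFunField.of h).symm x.1 := fun c x => by
      rw [Algebra.smul_def]
      exact TwistedFunField.sigma_const_smul h c ((TwistedFunField.of h).symm x.1)
    let j : M →ₗ[L] N :=
      { toFun := fun x => ⟨(TwistedFunField.of h).symm x.1, x.2⟩
        map_add' := fun x y => rfl
        map_smul' := fun c x => Subtype.ext (hsmul c x) }
    have hj : Function.Surjective j := fun f => ⟨⟨TwistedFunField.of h f.1, f.2⟩, rfl⟩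
    obtain ⟨B, hB⟩ := exists_bound_forall_eq_zero W.twist
    have hSfin := finite_compl_affinePart Fq L K
    let T : Equiv.Perm (ClosedPoint Fq L K) := ClosedPoint.twist
    have hgrow := exists_le_sum_iterate T hSfin
      (fun P hP hTP => hP (twist_mem_affinePart_iff.1 hTP)) I hI hIS
    obtain ⟨B', hB'⟩ := (hSfin.image fun P => -W.twist P).bddAbove
    -- At infinity E 0 ≤ −(B + B') for this m, and B' bounds −W^{(1)} there. So elements of V 0
    -- vanish to order at least B at infinity and are zero.
    obtain ⟨m, hm⟩ := hgrow (B + B').toNat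
    let E := orbitDivisor T I m
    let V : ℕ → Submodule L M := fun n =>
      { carrier := {x | ∀ P : ClosedPoint Fq L K, P ∉ affinePart →
          P.val ((TwistedFunField.of h).symm x.1) ≤ WithZero.exp (E n P - W.twist P)}
        zero_mem' := fun P _ => (map_zero P.val).trans_le zero_le
        add_mem' := fun {x y} hx hy P hP =>
          (P.val.map_add _ _).trans (max_le (hx P hP) (hy P hP))
        smul_mem' := fun c x hx P hP => by
          rw [hsmul, Algebra.smul_def, map_mul]
          exact (mul_le_mul' (P.isPlace.map_const_le c) (hx P hP)).trans (one_mul _).le }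
    have hσ_eq : ∀ x : M, (TwistedFunField.of h).symm (SigmaRing.σ Fq L • x : M).1 =
        h * (twist Fq L K).symm ((TwistedFunField.of h).symm x.1) := fun x =>
      TwistedFunField.σ_smul h ((TwistedFunField.of h).symm x.1)
    refine exists_sigma_basis (M := M) (fun c x => rfl) (fun x hx => ?_) (φ ∘ₗ j)
      (hφ.comp hj) (fun x => ?_) V ?_ ?_ ?_ ?_
    · have h1 := (hσ_eq x).symm.trans (congrArg (fun y : M => (TwistedFunField.of h).symm y.1) hx)
      have h2 := (mul_eq_zero.1 h1).resolve_left hh0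
      exact Subtype.ext ((map_eq_zero_iff _ (twist Fq L K).symm.injective).1 h2)
    · rw [LinearMap.comp_apply, hφk]
      constructor
      · intro hx
        obtain ⟨y, hyM, hy⟩ := exists_eq_sigma hh hIU hx
        exact ⟨⟨TwistedFunField.of h y, hyM⟩, Subtype.ext (hy.trans (hσ_eq ⟨_, hyM⟩).symm)⟩
      · rintro ⟨y, rfl⟩
        have := (sigma_mem_sections_iff hh hIU ((TwistedFunField.of h).symm y.1)).2 y.2
        rw [← hσ_eq] at this
        exact this
    · intro a b hab x hx P hP
      exact (hx P hP).trans (WithZero.exp_le_exp.2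
        (sub_le_sub_right (orbitDivisor_mono T I hI m P hab) _))
    · refine (Submodule.eq_bot_iff _).2 fun x hx => ?_
      refine Subtype.ext (hB ((TwistedFunField.of h).symm x.1) x.2 fun P hP => (hx P hP).trans (WithZero.exp_le_exp.2 ?_))
      have h1 := hm m le_rfl ((T ^ (-m : ℤ)) P)
        (fun h => hP ((zpow_twist_mem_affinePart_iff _).1 h))
      have h2 := hB' ⟨P, hP, rfl⟩
      have h3 := Int.self_le_toNat (B + B')
      simp only [E, orbitDivisor, sum_orbit_shift, Finset.range_zero, Finset.sum_empty] at h1 h2 ⊢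
      lia
    · intro x
      by_cases hx0 : (TwistedFunField.of h).symm x.1 = 0
      · exact ⟨0, fun P _ => by
          rw [hx0, map_zero]; exact zero_le⟩
      choose v hv using fun P : ClosedPoint Fq L K => exists_val_eq_exp P.val hx0
      -- C collects the pole order of x, the multiplicity of W^{(1)} and the fixed negative part of
      -- E n; the growing part of E n overtakes it.
      obtain ⟨C, hC⟩ := (hSfin.image fun P => v P + W.twist P +
        ∑ i ∈ Finset.range m, I ((T ^ ((i : ℤ) - m)) P)).bddAbove
      obtain ⟨n, hn⟩ := hgrow C.toNat
      refine ⟨n, fun P hP => (hv P).trans_le (WithZero.exp_le_exp.2 ?_)⟩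
      have h1 := hn n le_rfl ((T ^ (-m : ℤ)) P)
        (fun h => hP ((zpow_twist_mem_affinePart_iff _).1 h))
      have h2 := hC ⟨P, hP, rfl⟩
      have h3 := Int.self_le_toNat C
      rw [← sum_orbit_shift] at h1
      simp only [E, orbitDivisor] at h1 h2 ⊢
      lia
    · intro n x hx P hP
      obtain ⟨Q, rfl⟩ := ClosedPoint.twist.surjective P
      have hQ : Q ∉ affinePart := fun h => hP (twist_mem_affinePart_iff.2 h)
      have h1 := hx Q hQ
      rw [hσ_eq, val_sigma_le_iff hh] at h1
      refine h1.trans (WithZero.exp_le_exp.2 ?_)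
      have h2 : E (n + 1) Q = E n (ClosedPoint.twist Q) + I Q := orbitDivisor_succ T I m n Q
      rw [Divisor.twist_apply, h2, hΞS Q hQ]
      lia
  refine ⟨M, fun f => Iff.rfl, ⟨⟨_, hfreeT⟩, ⟨d, hfreeσ⟩, ?_⟩, hfreeT, d, hd, hfreeσ⟩
  obtain ⟨n, hn⟩ := exists_pow_mul_mem_sections (D := W.twist) hΞθ
  refine ⟨n, fun m => ?_⟩
  obtain ⟨y, hyM, hy⟩ := exists_eq_sigma hh hIU (hn ((TwistedFunField.of h).symm m.1) m.2)
  refine ⟨⟨TwistedFunField.of h y, hyM⟩, Subtype.ext ?_⟩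
  refine (TwistedFunField.poly_smul h _ ((TwistedFunField.of h).symm m.1)).trans
    (Eq.trans ?_ (TwistedFunField.σ_smul h y).symm)
  rw [← hy, map_pow, map_sub, Polynomial.aeval_X, Polynomial.aeval_C, algebraMap_eq_const]

end Motive

end CMMotive

namespace CMMotive

open scoped TensorProduct Polynomial IntermediateField WithZero

/-! ### The absolute value of ℂ_∞ -/

section Norm

theorem norm_completion_add_le_max {E : Type*} [SeminormedAddCommGroup E]
    (hE : ∀ x y : E, ‖x + y‖ ≤ max ‖x‖ ‖y‖) (x y : UniformSpace.Completion E) :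
    ‖x + y‖ ≤ max ‖x‖ ‖y‖ := by
  refine UniformSpace.Completion.induction_on₂ x y ?_ fun a b => ?_
  · exact isClosed_le (by fun_prop) (by fun_prop)
  · rw [← UniformSpace.Completion.coe_add]
    simpa only [UniformSpace.Completion.norm_coe] using hE a b

variable (Fq : Type*) [Field Fq] [Fintype Fq]

instance cInftyUltrametric : IsUltrametricDist (CInfty Fq) :=
  IsUltrametricDist.isUltrametricDist_of_forall_norm_add_le_max_norm
    (norm_completion_add_le_max
      (isNonarchimedean_spectralNorm (K := KInfty Fq) (L := KInftyAlg Fq)))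

theorem one_lt_norm_theta : 1 < ‖algebraMap (RatFunc Fq) (CInfty Fq) RatFunc.X‖ := by
  have h1 : ‖algebraMap (RatFunc Fq) (CInfty Fq) RatFunc.X‖ =
      ‖algebraMap (KInfty Fq) (KInftyAlg Fq) (algebraMap (RatFunc Fq) (KInfty Fq) RatFunc.X)‖ :=
    UniformSpace.Completion.norm_coe _
  have h2 : ‖algebraMap (KInfty Fq) (KInftyAlg Fq) (algebraMap (RatFunc Fq) (KInfty Fq) RatFunc.X)‖ =
      ‖algebraMap (RatFunc Fq) (KInfty Fq) RatFunc.X‖ := spectralNorm_extends _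
  rw [h1, h2]
  refine Valued.toNormedField.one_lt_norm_iff.2 ?_
  rw [kInfty_valuation_coe]
  let _ := Classical.decEq (RatFunc Fq)
  rw [RatFunc.inftyValuation.X, ← WithZero.exp_zero, WithZero.exp_lt_exp]
  exact one_pos

variable {Fq} in
-- c lies in a finite field, so it is a root of unity.
theorem norm_eq_one_of_isAlgebraic {c : CInfty Fq} (hc : IsAlgebraic Fq c) (h0 : c ≠ 0) :
    ‖c‖ = 1 := by
  have := IntermediateField.adjoin.finiteDimensional hc.isIntegral
  have : Finite Fq⟮c⟯ := Module.finite_of_finite Fq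
  have := Fintype.ofFinite Fq⟮c⟯
  have hpow : c ^ (Fintype.card Fq⟮c⟯ - 1) = 1 := by
    have := FiniteField.pow_card_sub_one_eq_one (IntermediateField.AdjoinSimple.gen Fq c)
      (fun h => h0 (by simpa using congrArg (algebraMap Fq⟮c⟯ (CInfty Fq)) h))
    simpa using congrArg (algebraMap Fq⟮c⟯ (CInfty Fq)) this
  have h1 := congrArg norm hpow
  rw [norm_pow, norm_one] at h1
  exact (pow_eq_one_iff_of_nonneg (norm_nonneg _)
    (Nat.sub_ne_zero_of_lt Fintype.one_lt_card)).1 h1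

/-- The valuation ring of `ℂ_∞`. -/
def cInftyRing : ValuationSubring (CInfty Fq) :=
  (NormedField.valuation (K := CInfty Fq)).valuationSubring

variable {Fq}

theorem cInftyRing_valuation_lt_one {x : CInfty Fq} :
    (cInftyRing Fq).valuation x < 1 ↔ ‖x‖ < 1 := by
  have := ((NormedField.valuation (K := CInfty Fq)).isEquiv_valuation_valuationSubring).lt_one_iff_lt_one
    (x := x)
  exact this.symm

end Norm

end CMMotive

namespace CMMotive

open scoped TensorProduct Polynomial IntermediateField WithZero Pointwise

/-! ### Extension and conjugacy of valuation rings -/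

section ValuationSubring

variable {F N : Type*} [Field F] [Field N]

theorem valuation_lt_one_iff_inv_notMem (V : ValuationSubring F) (x : F) :
    V.valuation x < 1 ↔ x = 0 ∨ x⁻¹ ∉ V := by
  rcases eq_or_ne x 0 with rfl | hx
  · simp
  · rw [← V.valuation_le_one_iff, not_le, map_inv₀,
      one_lt_inv₀ (zero_lt_iff.2 ((map_ne_zero _).2 hx))]
    simp [hx]

theorem valuation_comap_lt_one_iff (f : F →+* N) (V : ValuationSubring N) (x : F) :
    (V.comap f).valuation x < 1 ↔ V.valuation (f x) < 1 := by
  rw [valuation_lt_one_iff_inv_notMem, valuation_lt_one_iff_inv_notMem, ValuationSubring.mem_comap,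
    map_inv₀, map_eq_zero]

/-- A valuation ring V dominating f(A) restricts exactly to A: if f(x) ∈ V but x ∉ A, then x⁻¹ ∈ A
becomes a unit in V, so domination makes it a unit of A. -/
theorem exists_comap_eq (f : F →+* N) (A : ValuationSubring F) :
    ∃ V : ValuationSubring N, V.comap f = A := by
  obtain ⟨V, hle, hloc⟩ := (A.toLocalSubring.map f).exists_le_valuationSubring
  refine ⟨V, le_antisymm (fun x hx => ?_) fun x hx => hle ⟨x, hx, rfl⟩⟩
  by_contra hxA
  have hx0 : x ≠ 0 := by rintro rfl; exact hxA A.zero_mem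
  have hinv : x⁻¹ ∈ A := (A.mem_or_inv_mem x).resolve_left hxA
  have hy : f x⁻¹ ∈ (A.toLocalSubring.map f).toSubring := ⟨x⁻¹, hinv, rfl⟩
  have hunit : IsUnit (Subring.inclusion hle ⟨f x⁻¹, hy⟩) :=
    IsUnit.of_mul_eq_one ⟨f x, hx⟩ (Subtype.ext (by
      change f x⁻¹ * f x = 1
      rw [← map_mul, inv_mul_cancel₀ hx0, map_one]))
  obtain ⟨⟨_, ⟨z, hz, rfl⟩⟩, hz1⟩ := (hloc.map_nonunit _ hunit).exists_right_inv
  have h1 : f (x⁻¹ * z) = f 1 := by rw [map_mul, map_one]; exact congrArg Subtype.val hz1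
  have h2 : z = x := by
    have := f.injective h1
    field_simp at this
    exact this
  exact hxA (h2 ▸ hz)

theorem mem_of_isIntegral (V : ValuationSubring N) {R : Type*} [CommRing R] [Algebra R N]
    (hR : ∀ r : R, algebraMap R N r ∈ V) {x : N} (hx : IsIntegral R x) : x ∈ V := by
  obtain ⟨p, hp, hpx⟩ := hx
  have : IsIntegral V x := by
    refine ⟨p.map ((algebraMap R N).codRestrict V.toSubring hR), hp.map _, ?_⟩
    rw [Polynomial.eval₂_map]
    exact hpx
  obtain ⟨y, rfl⟩ := IsIntegrallyClosed.isIntegral_iff.1 this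
  exact y.2

variable [Algebra F N]

/-- In a finite Galois extension, the extensions of a discrete valuation ring are conjugate. -/
theorem exists_algEquiv_comap_eq [FiniteDimensional F N] [IsGalois F N] (A : ValuationSubring F)
    [IsDiscreteValuationRing A] {V W : ValuationSubring N} (hV : V.comap (algebraMap F N) = A)
    (hW : W.comap (algebraMap F N) = A) :
    ∃ σ : N ≃ₐ[F] N, V.comap (σ : N →+* N) = W := by
  have := integralClosure.isDedekindDomain A F N
  have := integralClosure.isFractionRing_of_finite_extension (A := A) F N
  let C := integralClosure A N
  let _ := IsIntegralClosure.MulSemiringAction A F N C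
  have := Algebra.isInvariant_of_isGalois A F N C
  have hmem : ∀ V : ValuationSubring N, V.comap (algebraMap F N) = A →
      (∀ c : C, algebraMap C N c ∈ V) ∧ V ≠ ⊤ := by
    intro V hV
    refine ⟨fun c => mem_of_isIntegral V (R := A) (fun r => ?_) c.2, ?_⟩
    · exact (SetLike.ext_iff.1 hV (r : F)).2 r.2
    · rintro rfl
      obtain ⟨ϖ, hϖ⟩ := IsDiscreteValuationRing.exists_irreducible A
      have hinv : (ϖ : F)⁻¹ ∈ A := 
        (SetLike.ext_iff.1 hV _).1 (ValuationSubring.mem_top _)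
      refine hϖ.not_isUnit (IsUnit.of_mul_eq_one ⟨_, hinv⟩ (Subtype.ext ?_))
      exact mul_inv_cancel₀ fun h => hϖ.ne_zero (Subtype.ext h)
  obtain ⟨P, -, hPi⟩ := exists_heightOneSpectrum_of_le V (hmem V hV).1 (hmem V hV).2
  obtain ⟨Q, hQ, hQi⟩ := exists_heightOneSpectrum_of_le W (hmem W hW).1 (hmem W hW).2
  -- Both centres contract to the non-units of A, so the Galois group carries one to the other; a
  -- valuation ring here is determined by its centre.
  have hunder : P.asIdeal.under A = Q.asIdeal.under A := by
    ext a
    rw [Ideal.mem_comap, Ideal.mem_comap, hPi, hQi, ← IsScalarTower.algebraMap_apply,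
      IsScalarTower.algebraMap_apply A F N, ← valuation_comap_lt_one_iff,
      ← valuation_comap_lt_one_iff, hV, hW]
  have := P.isPrime
  have := Q.isPrime
  have : SMulCommClass (N ≃ₐ[F] N) A C := ⟨fun σ a c => map_smul (galRestrict A F N C σ) a c⟩
  obtain ⟨g, hg⟩ := Algebra.IsInvariant.exists_smul_of_under_eq A C (N ≃ₐ[F] N) P.asIdeal Q.asIdeal
    hunder
  refine ⟨g⁻¹, ?_⟩
  have hcomap : (V.comap ((g⁻¹ : N ≃ₐ[F] N) : N →+* N)).comap (algebraMap F N) = A := by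
    rw [← hV]
    ext x
    simp [ValuationSubring.mem_comap]
  obtain ⟨P', hP', hPi'⟩ := exists_heightOneSpectrum_of_le _ (hmem _ hcomap).1 (hmem _ hcomap).2
  have hPQ : P' = Q := by
    ext a
    have hga : algebraMap C N (g⁻¹ • a) = g⁻¹ (algebraMap C N a) :=
      algebraMap_galRestrictHom_apply A F N C _ a
    rw [hPi', valuation_comap_lt_one_iff, hg, Ideal.mem_pointwise_smul_iff_inv_smul_mem, hPi, hga]
    rfl
  ext x
  rw [← hP', hPQ, hQ]

end ValuationSubring

/-! ### Places above ∞ and embeddings in ℂ_∞ -/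

section Infinity

variable {Fq : Type*} [Field Fq]

theorem eq_inftyPlace {V : ValuationSubring (RatFunc Fq)}
    (hc : ∀ c : Fq, algebraMap Fq (RatFunc Fq) c ∈ V) (hX : RatFunc.X ∉ V) : V = inftyPlace Fq := by
  classical
  have htriv : V.valuation.IsTrivialOn Fq := ⟨fun a ha => by
    refine le_antisymm ((V.valuation_le_one_iff _).2 (hc a)) ?_
    have := (V.valuation_le_one_iff _).2 (hc a⁻¹)
    rwa [map_inv₀, map_inv₀, inv_le_one₀ (zero_lt_iff.2 (by simpa using ha))] at this⟩
  have h1 : 1 < V.valuation RatFunc.X := by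
    rwa [← not_le, V.valuation_le_one_iff]
  have h := RatFunc.valuation_isEquiv_inftyValuation_of_one_lt_valuation_X h1
  ext x
  rw [← V.valuation_le_one_iff, h.le_one_iff_le_one]
  have : (fun a b => Classical.propDecidable (a = b)) = Classical.decEq (RatFunc Fq) :=
    Subsingleton.elim _ _
  rw [inftyPlace, Valuation.mem_valuationSubring_iff]

instance : IsDiscreteValuationRing (inftyPlace Fq) := by
  unfold inftyPlace
  infer_instance

variable [Fintype Fq] {L : IntermediateField (RatFunc Fq) (CInfty Fq)} {K : Type*} [Field K]

/-- The valuation ring of `K` induced by an embedding in `ℂ_∞`. -/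
def embeddingRing (ν : K →+* L) : ValuationSubring K :=
  (cInftyRing Fq).comap ((algebraMap L (CInfty Fq)).comp ν)

theorem mem_embeddingRing {ν : K →+* L} {f : K} :
    f ∈ embeddingRing ν ↔ ‖(ν f : CInfty Fq)‖ ≤ 1 := Iff.rfl

theorem embeddingRing_valuation_lt_one {ν : K →+* L} {f : K} :
    (embeddingRing ν).valuation f < 1 ↔ ‖(ν f : CInfty Fq)‖ < 1 := by
  rw [embeddingRing, valuation_comap_lt_one_iff, cInftyRing_valuation_lt_one]
  rfl

theorem embeddingRing_comap {K' : Type*} [Field K'] (ν : K →+* L) (i : K' →+* K) :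
    (embeddingRing ν).comap i = embeddingRing (ν.comp i) := rfl

theorem embeddingRing_algebraMap :
    embeddingRing (algebraMap (RatFunc Fq) L) = inftyPlace Fq := by
  refine eq_inftyPlace (fun c => ?_) fun h => ?_
  · rw [mem_embeddingRing]
    rcases eq_or_ne c 0 with rfl | hc
    · simp
    · exact (norm_eq_one_of_isAlgebraic (isAlgebraic_algebraMap (A := CInfty Fq) c)
        ((map_ne_zero _).2 hc)).le
  · exact (one_lt_norm_theta Fq).not_ge h

/-- Every extension of `∞` to a finite separable extension comes from an embedding in `ℂ_∞`. -/
theorem exists_embeddingRing_eq [IsAlgClosed L] [Algebra (RatFunc Fq) K]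
    [FiniteDimensional (RatFunc Fq) K] [Algebra.IsSeparable (RatFunc Fq) K]
    (A : ValuationSubring K) (hA : A.comap (algebraMap (RatFunc Fq) K) = inftyPlace Fq) :
    ∃ ν : K →ₐ[RatFunc Fq] L, embeddingRing (ν : K →+* L) = A := by
  let N := IntermediateField.normalClosure (RatFunc Fq) K (AlgebraicClosure K)
  have : Algebra.IsSeparable (RatFunc Fq) N := (le_separableClosure_iff _ _ N).1
    (normalClosure_le_iff.2 fun i => (le_separableClosure_iff _ _ _).2
      (AlgEquiv.Algebra.isSeparable (AlgEquiv.ofInjectiveField i)))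
  have : IsGalois (RatFunc Fq) N := ⟨⟩
  obtain ⟨V, hV⟩ := exists_comap_eq (algebraMap K N) A
  let ν₀ : N →ₐ[RatFunc Fq] L := IsAlgClosed.lift
  have hV' : V.comap (algebraMap (RatFunc Fq) N) = inftyPlace Fq := by
    rw [← hA, ← hV, IsScalarTower.algebraMap_eq (RatFunc Fq) K N]
    rfl
  have hW : (embeddingRing (ν₀ : N →+* L)).comap (algebraMap (RatFunc Fq) N) = inftyPlace Fq := by
    rw [embeddingRing_comap, AlgHom.comp_algebraMap, embeddingRing_algebraMap]
  -- Any one embedding of the normal closure induces some extension of ∞; conjugating it by σ moves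
  -- that extension to the prescribed V.
  obtain ⟨σ, hσ⟩ := exists_algEquiv_comap_eq (inftyPlace Fq) hW hV'
  refine ⟨(ν₀.comp σ.toAlgHom).comp (IsScalarTower.toAlgHom (RatFunc Fq) K N), ?_⟩
  rw [← hV, ← hσ]
  rfl

end Infinity

end CMMotive

namespace CMMotive

open scoped TensorProduct Polynomial IntermediateField WithZero

/-! ### Points of the curve and embeddings of K -/

section Evaluation

variable {Fq L K : Type*} [Field Fq] [Field L] [Field K] [Algebra Fq L] [Algebra Fq K]

theorem IsEvaluation.eq_of_lt_one [IsDomain (L ⊗[Fq] K)] {ξ : ClosedPoint Fq L K} {ν : K →ₐ[Fq] L}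
    (hν : IsEvaluation ξ ν) {f : K} {c : L}
    (hc : ξ.val (FunField.ofBase Fq L f - FunField.const Fq K c) < 1) : ν f = c := by
  by_contra hne
  have h := ξ.val.map_sub (FunField.ofBase Fq L f - FunField.const Fq K c)
    (FunField.ofBase Fq L f - FunField.const Fq K (ν f))
  rw [sub_sub_sub_cancel_left, ← map_sub, ξ.val_const _ (sub_ne_zero.2 hne)] at h
  exact (h.trans_lt (max_lt hc (hν f))).ne rfl

variable [Algebra (RatFunc Fq) K]

theorem t_sub_const_ne_zero [IsScalarTower Fq (RatFunc Fq) K] (c : L) :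
    FunField.t Fq L K - FunField.const Fq K c ≠ 0 := fun h =>
  transcendental_t Fq L K (sub_eq_zero.1 h ▸ isAlgebraic_algebraMap c)

variable [IsDomain (L ⊗[Fq] K)]

theorem IsEvaluation.mem_pointsAboveTheta_iff [Algebra (RatFunc Fq) L] {ξ : ClosedPoint Fq L K} {ν : K →ₐ[Fq] L}
    (hν : IsEvaluation ξ ν) : ξ ∈ pointsAboveTheta Fq L K ↔
      ν (algebraMap (RatFunc Fq) K RatFunc.X) = algebraMap (RatFunc Fq) L RatFunc.X := by
  refine ⟨fun h => hν.eq_of_lt_one h, fun h => ?_⟩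
  have := hν (algebraMap (RatFunc Fq) K RatFunc.X)
  rw [h] at this
  exact this

variable [IsScalarTower Fq (RatFunc Fq) K]

variable [FiniteDimensional (RatFunc Fq) K] [Algebra.IsSeparable (RatFunc Fq) K]

/-- The valuation ring of a point is that of a closed point. -/
theorem exists_closedPoint (V : ValuationSubring (FunField Fq L K))
    (hk : ∀ c : L, FunField.const Fq K c ∈ V) (hV : V ≠ ⊤) :
    ∃ P : ClosedPoint Fq L K, ∀ x, P.val x ≤ 1 ↔ x ∈ V := by
  obtain ⟨v, hv, hvV⟩ := (isSeparatingElement_t Fq L K).exists_isPlace V hk hV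
  exact ⟨hv.toClosedPoint, hvV⟩

/-- Every embedding of `K` in `L` is the evaluation at a point. -/
theorem exists_isEvaluation (ν : K →ₐ[Fq] L) : ∃ ξ : ClosedPoint Fq L K, IsEvaluation ξ ν := by
  let f := algebraMap (L ⊗[Fq] K) (FunField Fq L K)
  have hf : Function.Injective f := IsFractionRing.injective _ _
  let ψ : L ⊗[Fq] K →ₐ[Fq] L := Algebra.TensorProduct.lift (AlgHom.id Fq L) ν fun _ _ => .all _ _
  -- The kernel of c ⊗ x ↦ c ν(x) is the ideal of the wanted point, and a valuation ring with I in
  -- its non-units has that point as centre.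
  let I := (RingHom.ker ψ).map f.rangeRestrict
  have hI : I ≠ ⊤ := by
    rw [Ideal.ne_top_iff_one]
    intro h
    obtain ⟨x, hx, hx1⟩ :=
      (Ideal.mem_map_iff_of_surjective _ f.rangeRestrict_surjective).1 h
    have : x = 1 := hf ((congrArg Subtype.val hx1).trans (map_one f).symm)
    rw [this, RingHom.mem_ker, map_one] at hx
    exact one_ne_zero hx
  obtain ⟨V, hle, hI⟩ := I.image_subset_nonunits_valuationSubring hI
  have hlt : ∀ x : K, FunField.ofBase Fq L x - FunField.const Fq K (ν x) ∈ V.nonunits := by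
    intro x
    refine hI ⟨f.rangeRestrict (1 ⊗ₜ x - ν x ⊗ₜ 1), Ideal.mem_map_of_mem _ ?_, ?_⟩
    · simp [ψ]
    · change f (1 ⊗ₜ x - ν x ⊗ₜ 1) = _
      rw [map_sub]
      rfl
  have hV : V ≠ ⊤ := by
    rintro rfl
    have h := hlt (algebraMap (RatFunc Fq) K RatFunc.X)
    have h0 := t_sub_const_ne_zero (Fq := Fq) (L := L) (K := K)
      (ν (algebraMap (RatFunc Fq) K RatFunc.X))
    rw [ValuationSubring.mem_nonunits_iff, valuation_lt_one_iff_inv_notMem] at h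
    exact h.elim h0 fun h => h (ValuationSubring.mem_top _)
  obtain ⟨ξ, hξ⟩ := exists_closedPoint V (fun c => hle ⟨c ⊗ₜ 1, rfl⟩) hV
  refine ⟨ξ, fun x => ?_⟩
  have h := hlt x
  rw [ValuationSubring.mem_nonunits_iff, valuation_lt_one_iff_inv_notMem] at h
  rcases h with h | h
  · rw [h, map_zero]; exact zero_lt_one
  · rw [← hξ, not_le, map_inv₀] at h
    exact (one_lt_inv₀ (zero_lt_iff.2 fun h0 => by simp [h0] at h)).1 h

variable [IsAlgClosed L]

theorem exists_isEvaluation_of_le_one {ξ : ClosedPoint Fq L K}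
    (hξ : ∀ f : K, ξ.val (FunField.ofBase Fq L f) ≤ 1) : ∃ ν : K →ₐ[Fq] L, IsEvaluation ξ ν := by
  obtain ⟨e, he⟩ := ξ.isPlace.exists_residue (isSeparatingElement_t Fq L K)
  let ν := e.comp ((FunField.ofBase Fq L : K →+* FunField Fq L K).codRestrict ξ.val.integer hξ)
  have hν : ∀ c : Fq, ν (algebraMap Fq K c) = algebraMap Fq L c := fun c => by
    refine (he _ _).2 ?_
    change ξ.val (FunField.ofBase Fq L (algebraMap Fq K c) - FunField.const Fq K _) < 1
    rw [const_algebraMap, sub_self, map_zero]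
    exact zero_lt_one
  exact ⟨⟨ν, hν⟩, fun f => (he ⟨FunField.ofBase Fq L f, hξ f⟩ _).1 rfl⟩

variable [Algebra (RatFunc Fq) L] [IsScalarTower Fq (RatFunc Fq) L]

/-- θ is transcendental over 𝔽_q, so a nonzero p(t) over 𝔽_q has the nonzero value p(θ) at ξ. Thus
𝔽_q(t) is regular at ξ, and so is K, being integral over it. -/
theorem exists_isEvaluation_of_mem {ξ : ClosedPoint Fq L K} (hξ : ξ ∈ pointsAboveTheta Fq L K) :
    ∃ ν : K →ₐ[Fq] L, IsEvaluation ξ ν := by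
  refine exists_isEvaluation_of_le_one fun f => ?_
  let V : ValuationSubring K := ξ.val.valuationSubring.comap (FunField.ofBase Fq L)
  suffices ∀ r : RatFunc Fq, algebraMap (RatFunc Fq) K r ∈ V from
    mem_of_isIntegral V this (Algebra.IsIntegral.isIntegral f)
  have hp : ∀ p : Fq[X], p ≠ 0 → ξ.val (FunField.ofBase Fq L (algebraMap (RatFunc Fq) K
      (algebraMap Fq[X] (RatFunc Fq) p))) = 1 := by
    intro p hp
    set θ := algebraMap (RatFunc Fq) L RatFunc.X
    have hθ : (p.map (algebraMap Fq L)).eval θ ≠ 0 := by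
      rw [Polynomial.eval_map_algebraMap, Polynomial.aeval_algebraMap_apply, RatFunc.aeval_X_left_eq_algebraMap]
      simpa using hp
    obtain ⟨g, hg⟩ := Polynomial.X_sub_C_dvd_sub_C_eval (p := p.map (algebraMap Fq L)) (a := θ)
    rw [sub_eq_iff_eq_add] at hg
    rw [← aeval_t_ofBase, hg, map_add, map_mul, map_sub, Polynomial.aeval_X, Polynomial.aeval_C,
      Polynomial.aeval_C, algebraMap_eq_const, algebraMap_eq_const]
    rw [Valuation.map_add_eq_of_lt_right _ ?_, ξ.val_const _ hθ]
    rw [map_mul, ξ.val_const _ hθ]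
    exact mul_lt_one_of_lt_of_le hξ (val_aeval_t_le_one (pointsAboveTheta_subset hξ) g)
  intro r
  induction r using RatFunc.induction_on with
  | f p q hq =>
    change ξ.val (FunField.ofBase Fq L _) ≤ 1
    rw [map_div₀, map_div₀, map_div₀, hp q hq, div_one]
    rcases eq_or_ne p 0 with rfl | hp0
    · simp
    · exact (hp p hp0).le

end Evaluation

/-! ### Points of 𝐗 above points of 𝐗⁺ -/

section LiesAbove

variable {Fq L K K' : Type*} [Field Fq] [Field L] [Field K] [Algebra Fq L] [Algebra Fq K]
  [Field K'] [Algebra Fq K'] [IsDomain (L ⊗[Fq] K)]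

theorem ClosedPoint.LiesAbove.isEvaluation {i : K' →ₐ[Fq] K} {ξ : ClosedPoint Fq L K}
    {ξ' : ClosedPoint Fq L K'} (h : ξ.LiesAbove i ξ') {ν : K →ₐ[Fq] L} (hν : IsEvaluation ξ ν)
    {ν' : K' →ₐ[Fq] L} (hν' : IsEvaluation ξ' ν') : ν.comp i = ν' := by
  ext f
  refine hν.eq_of_lt_one ?_
  have h1 := (h.lt_one_iff_lt_one (x := 1 ⊗ₜ f - ν' f ⊗ₜ 1)).2 (by
    rw [Valuation.comap_apply, map_sub]
    exact hν' f)
  rw [Valuation.comap_apply, map_sub] at h1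
  simpa [FunField.ofBase, FunField.const] using h1

variable [IsDomain (L ⊗[Fq] K')] [Algebra (RatFunc Fq) K'] [IsScalarTower Fq (RatFunc Fq) K']
  [FiniteDimensional (RatFunc Fq) K'] [Algebra.IsSeparable (RatFunc Fq) K']
  [Algebra (RatFunc Fq) K] [Algebra (RatFunc Fq) L]

/-- The point is the restriction of ξ along the inclusion of function fields; the restriction is not
trivial because it is nontrivial on t − θ. -/
theorem exists_liesAbove (i : K' →ₐ[Fq] K)
    (hi : i (algebraMap (RatFunc Fq) K' RatFunc.X) = algebraMap (RatFunc Fq) K RatFunc.X)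
    {ξ : ClosedPoint Fq L K} (hξ : ξ ∈ pointsAboveTheta Fq L K) :
    ∃ ξ' ∈ pointsAboveTheta Fq L K', ξ.LiesAbove i ξ' := by
  let g : L ⊗[Fq] K' →+* FunField Fq L K := (algebraMap (L ⊗[Fq] K) (FunField Fq L K)).comp
      (Algebra.TensorProduct.map (AlgHom.id Fq L) i).toRingHom
  have hg : Function.Injective g := (IsFractionRing.injective (L ⊗[Fq] K) (FunField Fq L K)).comp
    (Module.Flat.lTensor_preserves_injective_linearMap (M := L) i.toLinearMap i.injective)
  let G : FunField Fq L K' →+* FunField Fq L K := IsFractionRing.lift hg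
  have hG : ∀ x, G (algebraMap _ _ x) = g x := fun x => IsFractionRing.lift_algebraMap hg x
  let V : ValuationSubring (FunField Fq L K') := ξ.val.valuationSubring.comap G
  have hconst : ∀ c : L, G (FunField.const Fq K' c) = FunField.const Fq K c := fun c => by
    refine (hG (c ⊗ₜ 1)).trans ?_
    simp [g, FunField.const]
  have hbase : ∀ x, G (FunField.ofBase Fq L x) = FunField.ofBase Fq L (i x) := fun x => by
    refine (hG (1 ⊗ₜ x)).trans ?_
    simp [g, FunField.ofBase]
  set θ := algebraMap (RatFunc Fq) L RatFunc.X
  have hθ : ξ.val (G (FunField.t Fq L K' - FunField.const Fq K' θ)) < 1 := by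
    rw [map_sub, hconst, FunField.t, hbase, hi]
    exact hξ
  have hV : V ≠ ⊤ := by
    intro h
    have h1 : (FunField.t Fq L K' - FunField.const Fq K' θ)⁻¹ ∈ V := h ▸ ValuationSubring.mem_top _
    have h2 : ξ.val (G _) ≤ 1 := h1
    rw [map_inv₀, map_inv₀] at h2
    exact h2.not_gt ((one_lt_inv₀ (zero_lt_iff.2 ((map_ne_zero _).2 ((map_ne_zero _).2
      (t_sub_const_ne_zero θ))))).2 hθ)
  obtain ⟨ξ', hξ'⟩ := exists_closedPoint V (fun c => by
    change ξ.val (G _) ≤ 1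
    rw [hconst]
    exact ξ.isPlace.map_const_le c) hV
  have hequiv : (ξ.val.comap G).IsEquiv ξ'.val :=
    Valuation.isEquiv_iff_val_le_one.2 fun {x} => (hξ' x).symm
  refine ⟨ξ', hequiv.lt_one_iff_lt_one.1 hθ, ?_⟩
  refine Valuation.IsEquiv.trans (Valuation.IsEquiv.of_eq ?_)
    (hequiv.comap (algebraMap (L ⊗[Fq] K') (FunField Fq L K')))
  ext x
  exact congrArg ξ.val (hG x).symm

end LiesAbove

end CMMotive

namespace CMMotive

open scoped TensorProduct Polynomial IntermediateField WithZero

/-! ### Residue maps up to Frobenius -/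

section Frobenius

/-- The conjugates over a finite field are the Frobenius powers. -/
theorem exists_eq_pow_of_isConjRoot {k L : Type*} [Field k] [Fintype k] [Field L] [Algebra k L]
    {x y : L} (hx : IsIntegral k x) (h : IsConjRoot k x y) :
    ∃ i : ℕ, y = x ^ Fintype.card k ^ i := by
  have hy : IsIntegral k y := h.isIntegral_iff.1 hx
  let E := IntermediateField.adjoin k {x, y}
  have : FiniteDimensional k E := IntermediateField.finiteDimensional_adjoin
    (by rintro z (rfl | rfl) <;> assumption)
  have : Finite E := Module.finite_of_finite k
  let x' : E := ⟨x, IntermediateField.subset_adjoin _ _ (by simp)⟩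
  let y' : E := ⟨y, IntermediateField.subset_adjoin _ _ (by simp)⟩
  have h' : IsConjRoot k x' y' := by
    rw [IsConjRoot, ← minpoly.algebraMap_eq (algebraMap E L).injective x',
      ← minpoly.algebraMap_eq (algebraMap E L).injective y']
    exact h
  obtain ⟨σ, hσ⟩ := h'.exists_algEquiv
  obtain ⟨i, hi⟩ := (FiniteField.bijective_frobeniusAlgEquivOfAlgebraic_pow k E).2 σ⁻¹
  refine ⟨i, ?_⟩
  have h1 : y' = σ⁻¹ x' := by rw [← hσ]; exact (σ.symm_apply_apply y').symm
  rw [← hi, AlgEquiv.coe_pow, FiniteField.coe_frobeniusAlgEquivOfAlgebraic_iterate] at h1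
  exact congrArg Subtype.val h1

variable {Fq : Type*} [Field Fq] [Fintype Fq] {L : IntermediateField (RatFunc Fq) (CInfty Fq)}

instance intermediateFieldTower : IsScalarTower Fq L (CInfty Fq) :=
  IsScalarTower.of_algebraMap_eq fun _ => rfl

/-- g(z) is the product of the z − y over the roots y, so some factor has absolute value less than
1. -/
theorem exists_root_norm_sub_lt_one [IsAlgClosed L] {g : Fq[X]} (hg : g.Monic) {z : L}
    (hz : ‖(Polynomial.aeval z g : CInfty Fq)‖ < 1) :
    ∃ y : L, Polynomial.aeval y g = 0 ∧ ‖(z - y : CInfty Fq)‖ < 1 := by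
  by_contra! hne
  have hprod : ∀ s : Multiset L, (∀ y ∈ s, 1 ≤ ‖(z - y : CInfty Fq)‖) →
      1 ≤ ‖((s.map fun y => z - y).prod : CInfty Fq)‖ := by
    intro s
    induction s using Multiset.induction with
    | empty => simp
    | cons a s ih =>
      intro hs
      rw [Multiset.map_cons, Multiset.prod_cons, MulMemClass.coe_mul, norm_mul]
      exact one_le_mul_of_one_le_of_one_le (hs a (Multiset.mem_cons_self a s))
        (ih fun y hy => hs y (Multiset.mem_cons_of_mem hy))
  refine hz.not_ge ?_
  rw [(IsAlgClosed.splits (g.map (algebraMap Fq L))).aeval_eq_prod_aroots_of_monic hg]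
  exact hprod _ fun y hy => hne y (Polynomial.mem_aroots.1 hy).2

variable {K : Type*} [Field K] [Algebra Fq K]

theorem norm_sub_lt_one {x y : CInfty Fq} (hx : ‖x‖ < 1) (hy : ‖y‖ < 1) : ‖x - y‖ < 1 :=
  sub_eq_add_neg x y ▸ (IsUltrametricDist.norm_add_le_max x (-y)).trans_lt
    (max_lt hx ((norm_neg y).trans_lt hy))

theorem norm_pow_sub_pow_lt_one {x y : CInfty Fq} (hx : ‖x‖ ≤ 1) (hy : ‖y‖ ≤ 1)
    (h : ‖x - y‖ < 1) (n : ℕ) : ‖x ^ n - y ^ n‖ < 1 := by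
  induction n with
  | zero => simp
  | succ n ih =>
    have : x ^ (n + 1) - y ^ (n + 1) = x ^ n * (x - y) + (x ^ n - y ^ n) * y := by ring
    rw [this]
    refine (IsUltrametricDist.norm_add_le_max _ _).trans_lt (max_lt ?_ ?_)
    · rw [norm_mul, norm_pow]
      exact mul_lt_one_of_nonneg_of_lt_one_right (pow_le_one₀ (norm_nonneg _) hx)
        (norm_nonneg _) h
    · rw [norm_mul]
      exact mul_lt_one_of_nonneg_of_lt_one_left (norm_nonneg _) ih hy

theorem norm_le_one_of_isAlgebraic {c : CInfty Fq} (hc : IsAlgebraic Fq c) : ‖c‖ ≤ 1 := by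
  rcases eq_or_ne c 0 with rfl | h
  · simp
  · exact (norm_eq_one_of_isAlgebraic hc h).le

/-- Two residue maps on the valuation ring of an embedding differ by a power of Frobenius. -/
theorem exists_norm_sub_pow_lt_one [IsAlgClosed L] (ν : K →ₐ[Fq] L)
    (φ : embeddingRing (ν : K →+* L) →+* L)
    (hφ : ∀ f, φ f = 0 ↔ ‖(ν f : CInfty Fq)‖ < 1)
    (hφc : ∀ (c : Fq) (hc : algebraMap Fq K c ∈ embeddingRing (ν : K →+* L)),
      φ ⟨_, hc⟩ = algebraMap Fq L c)
    (hfin : (Set.range φ).Finite) :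
    ∃ i : ℕ, ∀ f : embeddingRing (ν : K →+* L),
      ‖(ν f - φ f ^ Fintype.card Fq ^ i : CInfty Fq)‖ < 1 := by
  have hmem : ∀ c : Fq, algebraMap Fq K c ∈ embeddingRing (ν : K →+* L) := fun c => by
    rw [mem_embeddingRing]
    change ‖(ν (algebraMap Fq K c) : CInfty Fq)‖ ≤ 1
    rw [ν.commutes]
    exact norm_le_one_of_isAlgebraic (isAlgebraic_algebraMap (A := CInfty Fq) c)
  have : Finite φ.range := hfin
  -- The image of φ is a finite domain, so its nonzero elements are the powers of one φ(f₀), and the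
  -- Frobenius power needs to be found for f₀ only.
  obtain ⟨⟨u, hu⟩⟩ := (inferInstance : IsCyclic φ.rangeˣ)
  obtain ⟨f₀, hf₀⟩ : ∃ f₀, φ f₀ = (u : φ.range) := (u : φ.range).2
  have hunit : ∀ f, φ f ≠ 0 → ∃ n : ℕ, φ f = φ f₀ ^ n := by
    intro f hf
    have hne : (⟨φ f, f, rfl⟩ : φ.range) ≠ 0 := fun h => hf (congrArg Subtype.val h)
    obtain ⟨w, hw⟩ : IsUnit (⟨φ f, f, rfl⟩ : φ.range) :=
      IsArtinianRing.isUnit_of_mem_nonZeroDivisors (mem_nonZeroDivisors_of_ne_zero hne)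
    obtain ⟨n, hn⟩ := (mem_powers_iff_mem_zpowers (y := w)).2 (hu w)
    refine ⟨n, ?_⟩
    have := congrArg (fun z : φ.rangeˣ => ((z : φ.range) : L)) hn
    simp only [Units.val_pow_eq_pow_val, SubmonoidClass.coe_pow, hw] at this
    rw [hf₀]
    exact this.symm
  have hint : IsIntegral Fq (φ f₀) := by
    obtain ⟨n, hn0, hn⟩ := isOfFinOrder_iff_pow_eq_one.1 (isOfFinOrder_of_finite u)
    refine ⟨.X ^ n - 1, Polynomial.monic_X_pow_sub_C 1 hn0.ne', ?_⟩
    have := congrArg (fun z : φ.rangeˣ => ((z : φ.range) : L)) hn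
    simp only [Units.val_pow_eq_pow_val, SubmonoidClass.coe_pow] at this
    rw [← hf₀] at this
    simp [this]
  let g := minpoly Fq (φ f₀)
  let C : Fq →+* embeddingRing (ν : K →+* L) := (algebraMap Fq K).codRestrict _ hmem
  have hCφ : φ.comp C = algebraMap Fq L := RingHom.ext fun c => hφc c _
  -- g(f₀) lies in ker φ, which is also the kernel of reduction through ν. So ν(f₀) is close to a
  -- root of g, that is, to a conjugate of φ(f₀), and conjugates over 𝔽_q are Frobenius powers.
  have hg0 : φ (g.eval₂ C f₀) = 0 := by
    rw [Polynomial.hom_eval₂, hCφ]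
    exact minpoly.aeval Fq (φ f₀)
  have hνg : ν (g.eval₂ C f₀ : embeddingRing (ν : K →+* L)) = Polynomial.aeval (ν f₀) g := by
    rw [Polynomial.aeval_algHom_apply]
    congr 1
    exact Polynomial.hom_eval₂ g C (embeddingRing (ν : K →+* L)).subtype f₀
  have hlt := (hφ _).1 hg0
  rw [hνg] at hlt
  obtain ⟨y, hy, hyz⟩ := exists_root_norm_sub_lt_one (minpoly.monic hint) hlt
  obtain ⟨i, rfl⟩ := exists_eq_pow_of_isConjRoot hint
    ((isConjRoot_iff_aeval_eq_zero hint).2 hy)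
  refine ⟨i, fun f => ?_⟩
  by_cases hf : φ f = 0
  · rw [hf]
    simpa [zero_pow (pow_ne_zero _ Fintype.card_ne_zero)] using (hφ f).1 hf
  obtain ⟨n, hn⟩ := hunit f hf
  have h1 : ‖(ν f - ν f₀ ^ n : CInfty Fq)‖ < 1 := by
    have := (hφ (f - f₀ ^ n)).1 (by rw [map_sub, map_pow, hn, sub_self])
    simpa using this
  have hf₀1 : ‖(ν f₀ : CInfty Fq)‖ ≤ 1 := mem_embeddingRing.1 f₀.2
  have halg : ‖((φ f₀ ^ Fintype.card Fq ^ i : L) : CInfty Fq)‖ ≤ 1 :=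
    norm_le_one_of_isAlgebraic ((hint.pow _).isAlgebraic.algebraMap (A := CInfty Fq))
  have h2 := norm_pow_sub_pow_lt_one hf₀1 halg hyz n
  have h3 := (IsUltrametricDist.norm_add_le_max _ _).trans_lt (max_lt h1 h2)
  rw [sub_add_sub_cancel] at h3
  rw [SubmonoidClass.coe_pow, pow_right_comm] at h3
  rw [hn, SubmonoidClass.coe_pow]
  exact h3

end Frobenius

end CMMotive

namespace CMMotive

open scoped TensorProduct Polynomial IntermediateField WithZero

/-! ### Reduction of points to infinity -/

section Reduction

theorem isAlgebraic_of_pow_eq_self {k L : Type*} [Field k] [Field L] [Algebra k L] {n : ℕ}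
    (hn : 1 < n) {x : L} (hx : x ^ n = x) : IsAlgebraic k x := by
  refine ⟨Polynomial.X ^ n - Polynomial.X, FiniteField.X_pow_card_sub_X_ne_zero k hn, ?_⟩
  rw [map_sub, map_pow, Polynomial.aeval_X, hx, sub_self]

theorem finite_setOf_pow_eq_self (L : Type*) [Field L] {n : ℕ} (hn : 1 < n) :
    {x : L | x ^ n = x}.Finite := by
  refine ((Polynomial.X ^ n - Polynomial.X : L[X]).rootSet_finite L).subset fun x hx => ?_
  rw [Polynomial.mem_rootSet]
  exact ⟨FiniteField.X_pow_card_sub_X_ne_zero L hn, by simpa [sub_eq_zero] using hx⟩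

variable {Fq K : Type*} [Field Fq] [Fintype Fq] [Field K] [Algebra Fq K]

section Twist

variable {L : Type*} [Field L] [IsAlgClosed L] [Algebra Fq L]

/-- For f defined over 𝔽_q, the value at P^{(n)} is the q^n-th power of the value at P. -/
theorem pow_twist_val_sub (P : ClosedPoint Fq L K) (f : K) (c : L) (n : ℕ) :
    (((ClosedPoint.twist : Equiv.Perm (ClosedPoint Fq L K)) ^ n) P).val
      (FunField.ofBase Fq L f - FunField.const Fq K (c ^ Fintype.card Fq ^ n)) =
    P.val (FunField.ofBase Fq L f - FunField.const Fq K c) := by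
  induction n with
  | zero => simp
  | succ n ih =>
    have hc : (frob Fq L).symm (c ^ Fintype.card Fq ^ (n + 1)) = c ^ Fintype.card Fq ^ n := by
      rw [pow_succ (Fintype.card Fq), pow_mul]
      exact (frob Fq L).symm_apply_apply (c ^ Fintype.card Fq ^ n)
    have hsub := (twist Fq L K).symm.toRingHom.map_sub (FunField.ofBase Fq L f)
      (FunField.const Fq K (c ^ Fintype.card Fq ^ (n + 1)))
    rw [pow_succ', Equiv.Perm.mul_apply, ClosedPoint.twist_val, ← ih]
    refine congrArg _ (hsub.trans (congrArg₂ _ (twist_symm_ofBase Fq f) ?_))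
    exact (twist_symm_const Fq _).trans (congrArg _ hc)

variable [Algebra (RatFunc Fq) K] [IsDomain (L ⊗[Fq] K)] [IsScalarTower Fq (RatFunc Fq) K]
  [FiniteDimensional (RatFunc Fq) K] [Algebra.IsSeparable (RatFunc Fq) K]

theorem exists_pow_twist_eq {P : ClosedPoint Fq L K} (hP : P ∉ affinePart) :
    ∃ r : ℕ, 0 < r ∧ ((ClosedPoint.twist : Equiv.Perm (ClosedPoint Fq L K)) ^ r) P = P := by
  have hmaps : Set.MapsTo
      (fun n : ℕ => ((ClosedPoint.twist : Equiv.Perm (ClosedPoint Fq L K)) ^ n) P) Set.univ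
      affinePartᶜ := fun n _ h => hP ((zpow_twist_mem_affinePart_iff (n : ℤ)).1 (by simpa using h))
  obtain ⟨m, -, n, -, hmn, heq⟩ := Set.infinite_univ.exists_lt_map_eq_of_mapsTo hmaps
    (finite_compl_affinePart Fq L K)
  refine ⟨n - m, Nat.sub_pos_of_lt hmn, ?_⟩
  apply ((ClosedPoint.twist : Equiv.Perm (ClosedPoint Fq L K)) ^ m).injective
  rw [← Equiv.Perm.mul_apply, ← pow_add, Nat.add_sub_cancel' hmn.le]
  exact heq.symm

/-- Evaluation at a point at infinity of the functions in `K` that are regular there. -/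
theorem exists_residue_of_notMem_affinePart {P : ClosedPoint Fq L K} (hP : P ∉ affinePart)
    (B : ValuationSubring K) (hB : ∀ f : K, P.val (FunField.ofBase Fq L f) ≤ 1 ↔ f ∈ B) :
    ∃ φ : B →+* L, (∀ (f : B) (c : L), φ f = c ↔
        P.val (FunField.ofBase Fq L (f : K) - FunField.const Fq K c) < 1) ∧
      (∀ f : B, φ f = 0 ↔ B.valuation (f : K) < 1) ∧
      (∀ (c : Fq) (hc : algebraMap Fq K c ∈ B), φ ⟨_, hc⟩ = algebraMap Fq L c) ∧
      (∀ f, IsAlgebraic Fq (φ f)) ∧ (Set.range φ).Finite := by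
  obtain ⟨e, he⟩ := P.isPlace.exists_residue (isSeparatingElement_t Fq L K)
  obtain ⟨φ, hφ⟩ : ∃ φ : B →+* L, ∀ (f : B) (c : L), φ f = c ↔
      P.val (FunField.ofBase Fq L (f : K) - FunField.const Fq K c) < 1 :=
    ⟨e.comp (((FunField.ofBase Fq L : K →+* FunField Fq L K).comp
      B.subtype).codRestrict P.val.integer fun f => (hB f).2 f.2), fun f c => he _ c⟩
  have hφ0 : ∀ f : B, φ f = 0 ↔ B.valuation (f : K) < 1 := by
    intro f
    rw [hφ, map_zero, sub_zero]
    have h1 := valuation_comap_lt_one_iff (FunField.ofBase Fq L) P.val.valuationSubring (f : K)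
    have h2 : P.val.valuationSubring.comap (FunField.ofBase Fq L) = B := by
      ext x
      exact hB x
    rw [h2, ← P.val.isEquiv_valuation_valuationSubring.lt_one_iff_lt_one] at h1
    exact h1.symm
  have hφc : ∀ (c : Fq) (hc : algebraMap Fq K c ∈ B), φ ⟨_, hc⟩ = algebraMap Fq L c := by
    intro c hc
    rw [hφ, const_algebraMap, sub_self, map_zero]
    exact zero_lt_one
  obtain ⟨r, hr, hrP⟩ := exists_pow_twist_eq hP
  -- P has finite orbit at infinity, so T^r P = P for some r > 0. Values of functions of K at P are
  -- therefore fixed by the q^r-power map, which bounds the image of φ.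
  have hpow : ∀ f : B, φ f ^ Fintype.card Fq ^ r = φ f := by
    intro f
    refine ((hφ f _).2 ?_).symm
    have := pow_twist_val_sub P (f : K) (φ f) r
    rw [hrP] at this
    rw [this]
    exact (hφ f _).1 rfl
  have hq : 1 < Fintype.card Fq ^ r := one_lt_pow₀ Fintype.one_lt_card hr.ne'
  refine ⟨φ, hφ, hφ0, hφc, fun f => ?_, ?_⟩
  · exact isAlgebraic_of_pow_eq_self hq (hpow f)
  · refine (finite_setOf_pow_eq_self L hq).subset ?_
    rintro _ ⟨f, rfl⟩
    exact hpow f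

end Twist

variable {L : IntermediateField (RatFunc Fq) (CInfty Fq)}

theorem eq_of_norm_sub_lt_one {c d : L} (hc : IsAlgebraic Fq c) (hd : IsAlgebraic Fq d)
    {x : CInfty Fq} (hxc : ‖x - c‖ < 1) (hxd : ‖x - d‖ < 1) : c = d := by
  by_contra hne
  have hlt := norm_sub_lt_one hxd hxc
  rw [sub_sub_sub_cancel_left] at hlt
  exact hlt.ne (norm_eq_one_of_isAlgebraic ((hc.sub hd).algebraMap (A := CInfty Fq))
    ((map_ne_zero (algebraMap L (CInfty Fq))).2 (sub_ne_zero.2 hne)))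

variable [Algebra (RatFunc Fq) K] [IsDomain (L ⊗[Fq] K)] [IsScalarTower Fq (RatFunc Fq) K]

/-- As |θ| > 1, the function t⁻¹ has value θ⁻¹ at ξ, which reduces to 0, so t⁻¹ vanishes at P. -/
theorem ReducesTo.notMem_affinePart {ξ P : ClosedPoint Fq L K}
    (hξ : ξ ∈ pointsAboveTheta Fq L K) (h : ReducesTo ξ P) : P ∉ affinePart := by
  obtain ⟨ν, hν, hP⟩ := h
  have ht := hν.mem_pointsAboveTheta_iff.1 hξ
  have hθ : ‖(ν (algebraMap (RatFunc Fq) K RatFunc.X)⁻¹ : CInfty Fq)‖ < 1 := by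
    rw [map_inv₀, ht]
    have := one_lt_norm_theta Fq
    change ‖((algebraMap (RatFunc Fq) (CInfty Fq) RatFunc.X)⁻¹)‖ < 1
    rw [norm_inv]
    exact inv_lt_one_of_one_lt₀ this
  have h1 := hP _ hθ.le 0 isAlgebraic_zero (by simpa using hθ)
  rw [map_zero, sub_zero, map_inv₀, map_inv₀] at h1
  intro h2
  have h3 : P.val (FunField.t Fq L K) ≠ 0 := by
    simpa using t_sub_const_ne_zero (Fq := Fq) (K := K) (0 : L)
  exact h2.not_gt ((inv_lt_one₀ (zero_lt_iff.2 h3)).1 h1)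

variable [IsAlgClosed L] [FiniteDimensional (RatFunc Fq) K] [Algebra.IsSeparable (RatFunc Fq) K]

/-- If `ξ` induces on `K` the same place as the point `P` at infinity, then it reduces to a Frobenius
twist of `P`. -/
theorem exists_reducesTo_pow_twist {P ξ : ClosedPoint Fq L K} (hP : P ∉ affinePart)
    {ν : K →ₐ[Fq] L} (hν : IsEvaluation ξ ν)
    (hPν : ∀ f : K, P.val (FunField.ofBase Fq L f) ≤ 1 ↔ f ∈ embeddingRing (ν : K →+* L)) :
    ∃ i : ℕ, ReducesTo ξ (((ClosedPoint.twist : Equiv.Perm (ClosedPoint Fq L K)) ^ i) P) := by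
  obtain ⟨φ, hφ, hφ0, hφc, halg, hfin⟩ := exists_residue_of_notMem_affinePart hP _ hPν
  obtain ⟨i, hi⟩ := exists_norm_sub_pow_lt_one ν φ
    (fun f => (hφ0 f).trans embeddingRing_valuation_lt_one) hφc hfin
  refine ⟨i, ν, hν, fun f hf c hc hfc => ?_⟩
  have hcf : c = φ ⟨f, hf⟩ ^ Fintype.card Fq ^ i :=
    eq_of_norm_sub_lt_one hc ((halg _).pow _) hfc (hi ⟨f, hf⟩)
  rw [hcf, pow_twist_val_sub]
  exact (hφ ⟨f, hf⟩ _).1 rfl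

end Reduction

/-! ### The CM condition: I_Ξ meets every Frobenius orbit at infinity -/

section CMField

variable {Fq K : Type*} [Field Fq] [Fintype Fq] [Field K] [Algebra Fq K]
  {L : IntermediateField (RatFunc Fq) (CInfty Fq)} [IsAlgClosed L] [Algebra (RatFunc Fq) K]
  [IsScalarTower Fq (RatFunc Fq) K]

/-- Every Frobenius orbit at infinity meets the reduction of a generalized CM type. -/
theorem exists_mem_support_reducesTo (hCM : IsCMField Fq K) (hgeom : IsGeometric Fq K)
    {Ξ : Divisor Fq L K} (hΞ : IsGeneralizedCMType Ξ) {P : ClosedPoint Fq L K}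
    (hP : P ∉ affinePart) :
    ∃ i : ℕ, ∃ ξ ∈ Ξ.support,
      ReducesTo ξ (((ClosedPoint.twist : Equiv.Perm (ClosedPoint Fq L K)) ^ i) P) := by
  classical
  have := hCM.finite
  have := hCM.separable
  have : IsDomain (L ⊗[Fq] K) := isDomain_tensorProduct hgeom
  let K' := maxTotallyReal Fq K
  have : IsScalarTower Fq K' K := IsScalarTower.of_algebraMap_eq fun _ => rfl
  have hgeom' : IsGeometric Fq K' := fun x hx => by
    obtain ⟨c, hc⟩ := hgeom (x : K) (hx.algebraMap (A := K))
    exact ⟨c, Subtype.ext hc⟩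
  have : IsDomain (L ⊗[Fq] K') := isDomain_tensorProduct hgeom'
  let i : K' →ₐ[Fq] K := K'.val.restrictScalars Fq
  let B : ValuationSubring K := P.val.valuationSubring.comap (FunField.ofBase Fq L)
  let A : ValuationSubring K' := B.comap (algebraMap K' K)
  have hA : A.comap (algebraMap (RatFunc Fq) K') = inftyPlace Fq := by
    refine eq_inftyPlace (fun c => ?_) fun h => hP h
    change P.val (FunField.ofBase Fq L (algebraMap (RatFunc Fq) K (algebraMap Fq _ c))) ≤ 1
    rw [← IsScalarTower.algebraMap_apply, ← const_algebraMap]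
    exact P.isPlace.map_const_le _
  obtain ⟨ν', hν'⟩ := exists_embeddingRing_eq (L := L) A hA
  obtain ⟨ξ', hξ'⟩ := exists_isEvaluation (ν'.restrictScalars Fq)
  have hξ'θ : ξ' ∈ pointsAboveTheta Fq L K' := hξ'.mem_pointsAboveTheta_iff.2 (ν'.commutes _)
  have hnonneg : ∀ Q : ClosedPoint Fq L K', ∀ ξ ∈ {ξ ∈ Ξ.support | ξ.LiesAbove i Q}, 0 ≤ Ξ ξ :=
    fun _ ξ _ => hΞ.effective ξ
  obtain ⟨ξ, hξ, hξξ'⟩ : ∃ ξ ∈ Ξ.support, ξ.LiesAbove i ξ' := by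
    obtain ⟨ξ₀, hξ₀⟩ := Finsupp.support_nonempty_iff.2 hΞ.ne_zero
    obtain ⟨ξ₀', hξ₀'θ, hξ₀'⟩ := exists_liesAbove i rfl (hΞ.support_subset hξ₀)
    have hpos : 0 < fibreSum Ξ ξ₀' := by
      refine Finset.sum_pos' (hnonneg ξ₀') ⟨ξ₀, Finset.mem_filter.2 ⟨hξ₀, hξ₀'⟩, ?_⟩
      exact lt_of_le_of_ne (hΞ.effective ξ₀) (Finsupp.mem_support_iff.1 hξ₀).symm
    -- Ξ is nonzero and effective, so one fibre sum is positive; the weight condition transports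
    -- this to the fibre over ξ'.
    rw [hΞ.weight _ hξ₀'θ _ hξ'θ] at hpos
    obtain ⟨ξ, hξ⟩ := Finset.nonempty_of_sum_ne_zero hpos.ne'
    exact ⟨ξ, (Finset.mem_filter.1 hξ).1, (Finset.mem_filter.1 hξ).2⟩
  obtain ⟨ν, hν⟩ := exists_isEvaluation_of_mem (hΞ.support_subset hξ)
  have hνν' : ν.comp i = ν'.restrictScalars Fq := hξξ'.isEvaluation hν hξ'
  have hBν : (embeddingRing (ν : K →+* L)).comap (algebraMap K' K) = A := by
    rw [← hν', embeddingRing_comap]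
    exact congrArg embeddingRing (congrArg AlgHom.toRingHom hνν')
  -- Both rings extend A, so the uniqueness of the place above A identifies the place of P with that
  -- of ν_ξ.
  have hB : B = embeddingRing (ν : K →+* L) := (hCM.nonsplit A hA).unique rfl hBν
  obtain ⟨n, hn⟩ := exists_reducesTo_pow_twist hP hν fun f => SetLike.ext_iff.1 hB f
  exact ⟨n, ξ, hξ, hn⟩

end CMField

end CMMotive

end

open scoped TensorProduct

/-- Everything reduces to `exists_motive` with I = I_Ξ: this divisor is effective, lies at infinity
by `ReducesTo.notMem_affinePart`, and meets every Frobenius orbit there by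
`exists_mem_support_reducesTo`. -/
theorem mainTheorem6 (Fq : Type*) [Field Fq] [Fintype Fq]
    (K : Type*) [Field K] [Algebra Fq K] [Algebra (RatFunc Fq) K] [IsScalarTower Fq (RatFunc Fq) K]
    (hCM : CMMotive.IsCMField Fq K) (hgeom : CMMotive.IsGeometric Fq K)
    (L : IntermediateField (RatFunc Fq) (CMMotive.CInfty Fq)) [IsAlgClosed L]
    (Ξ : CMMotive.Divisor Fq L K) (hΞ : CMMotive.IsGeneralizedCMType Ξ)
    (W : CMMotive.Divisor Fq L K) (h : CMMotive.FunField Fq L K)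
    (hh : CMMotive.IsShtukaFunction Ξ W h) :
    ∃ M : Submodule (CMMotive.TSigmaRing Fq L) (CMMotive.TwistedFunField h),
      (∀ f, CMMotive.TwistedFunField.of h f ∈ M ↔ f ∈ CMMotive.sections W.twist) ∧
      CMMotive.IsDualTMotive Fq L M ∧
      CMMotive.IsFreeOfRankOverT Fq L M (Module.finrank (RatFunc Fq) K) ∧
      ∃ d : ℕ, (d : ℤ) = Ξ.deg ∧ CMMotive.IsFreeOfRankOverSigma Fq L M d := by
  classical
  have := hCM.finite
  have := hCM.separable
  have : IsDomain (L ⊗[Fq] K) := CMMotive.isDomain_tensorProduct hgeom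
  have hnonneg : ∀ (P : CMMotive.ClosedPoint Fq L K),
      ∀ ξ ∈ {ξ ∈ Ξ.support | CMMotive.ReducesTo ξ P}, 0 ≤ Ξ ξ := fun _ ξ _ => hΞ.effective ξ
  refine CMMotive.exists_motive hh hΞ.effective hΞ.support_subset
    (fun P => Finset.sum_nonneg (hnonneg P)) (fun P hP => ?_) fun P hP => ?_
  · refine Finset.sum_eq_zero fun ξ hξ => ?_
    obtain ⟨hξΞ, hξP⟩ := Finset.mem_filter.1 hξ
    exact absurd hP (hξP.notMem_affinePart (hΞ.support_subset hξΞ))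
  · obtain ⟨i, ξ, hξ, hξP⟩ := CMMotive.exists_mem_support_reducesTo hCM hgeom hΞ hP
    refine ⟨i, Finset.sum_pos' (hnonneg _) ⟨ξ, Finset.mem_filter.2 ⟨hξ, hξP⟩, ?_⟩⟩
    exact lt_of_le_of_ne (hΞ.effective ξ) (Finsupp.mem_support_iff.1 hξ).symm
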